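/- **Notation.** For subgroups $H,K$ of a group, $[H,K]$ is the subgroup generated by the commutators $[h,k]$, $h\in H$, $k\in K$; $\gamma_1(H)=H$ and $\gamma_{n+1}(H)=[\gamma_n(H),H]$. Let $F$ be a free group and $R$ a normal subgroup of $F$. Let $\mathfrak f$ be the augmentation ideal of $\mathbb Z[F]$ and $\mathfrak r$ the augmentation ideal of $\mathbb Z[R]$, regarded inside $\mathbb Z[F]$; $\mathfrak r\mathfrak f^3$ is the additive span of the products $rf_1f_2f_3$ with $r\in\mathfrak r$, $f_i\in\mathfrak f$. Put $$F(3,R)=F\cap(1+\mathfrak r\mathfrak f^3),\qquad G(3,R)=\gamma_2(R\cap\gamma_3(F))\,[[R\cap\gamma_2(F),R],R\cap\gamma_2(F)]\,\gamma_4(R).$$ For an abelian group $A$, let ${\sf SP}^2(A)=A\otimes A/\langle a\otimes b-b\otimes a\mid a,b\in A\rangle$, and let $L_1{\sf SP}^2(A)=\pi_1({\sf SP}^2(KP_*))$ be its first derived functor in the sense of Dold and Puppe, where $P_*\to A$ is a projective resolution and $K$ is the inverse of the Moore normalization functor from simplicial abelian groups to chain complexes. **Theorem.** Let $F$ be a free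 group and $R$ a normal subgroup of $F$. Then $G(3,R)\subseteq F(3,R)$, and: (a) There is an isomorphism $$\frac{F(3,R)}{G(3,R)}\;\simeq\; L_1{\sf SP}^2\!\left(\frac{R\cap\gamma_2(F)}{\gamma_2(R)\,(R\cap\gamma_3(F))}\right),$$ natural in the pair $(F,R)$ with respect to all homomorphisms $f:F\to F'$ of free groups with $f(R)\subseteq R'$. (b) $F(3,R)=G(3,R)\,W$, where $W$ is the subgroup of $F$ generated by all elements $$[x,y]^m\,[x,s_y]^{-1}\,[y,s_x]$$ with $m\in\mathbb Z$, $x,y\in R\cap\gamma_2(F)$, $x^m=r_xs_x$, $y^m=r_ys_y$, $r_x,r_y\in R\cap\gamma_3(F)$ and $s_x,s_y\in\gamma_2(R)$. -/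

import Mathlib

open CategoryTheory

universe u

noncomputable section

/-! ### Subgroups of a group attached to a subgroup, and the Fox subgroup -/

section Subgroups

attribute [local instance] commutatorElement

variable {F : Type u} [Group F] {F' : Type u} [Group F']

/-- The `n`-th term `γₙ(H)` of the lower central series of a subgroup `H` of `F`, as a subgroup of
`F`, for `n ≥ 1`: `γ₁(H) = H` and `γₙ₊₁(H) = [γₙ(H), H]`. (The value at `n = 0` is never used.) -/
def gam (H : Subgroup F) : ℕ → Subgroup F
  | 0 => H
  | 1 => H
  | n + 2 => ⁅gam H (n + 1), H⁆

instance gam_normal (H : Subgroup F) [H.Normal] : ∀ n, (gam H n).Normal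
  | 0 => inferInstanceAs H.Normal
  | 1 => inferInstanceAs H.Normal
  | n + 2 => by
    have := gam_normal H (n + 1)
    exact Subgroup.commutator_normal _ _

theorem gam_map_le (f : F →* F') {H : Subgroup F} {H' : Subgroup F'} (h : H.map f ≤ H') :
    ∀ n, (gam H n).map f ≤ gam H' n
  | 0 => h
  | 1 => h
  | n + 2 => by
    show Subgroup.map f ⁅gam H (n + 1), H⁆ ≤ ⁅gam H' (n + 1), H'⁆
    rw [Subgroup.map_commutator]
    exact Subgroup.commutator_mono (gam_map_le f h (n + 1)) h

/-- `R ∩ γₙ(F)`. -/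
def capGam (R : Subgroup F) (n : ℕ) : Subgroup F := R ⊓ gam ⊤ n

instance capGam_normal (R : Subgroup F) [R.Normal] (n : ℕ) : (capGam R n).Normal :=
  inferInstanceAs (R ⊓ gam ⊤ n).Normal

theorem capGam_map_le (f : F →* F') {R : Subgroup F} {R' : Subgroup F'} (h : R.map f ≤ R') (n : ℕ) :
    (capGam R n).map f ≤ capGam R' n :=
  le_inf ((Subgroup.map_mono inf_le_left).trans h)
    ((Subgroup.map_mono inf_le_right).trans (gam_map_le f le_top n))

/-- The augmentation ideal `Δ(H)` of the group ring `ℤ[H]` of a subgroup `H` of `F`, regarded as an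
additive subgroup of `ℤ[F]`: the `ℤ`-span of the elements `h - 1`, `h ∈ H`. -/
def aug (H : Subgroup F) : Submodule ℤ (MonoidAlgebra ℤ F) :=
  Submodule.span ℤ {a | ∃ h ∈ H, a = MonoidAlgebra.of ℤ F h - 1}

theorem aug_map_le (f : F →* F') {H : Subgroup F} {H' : Subgroup F'} (h : H.map f ≤ H') :
    (aug H).map (MonoidAlgebra.mapDomainAlgHom ℤ ℤ f).toLinearMap ≤ aug H' := by
  rw [aug, Submodule.map_span, Submodule.span_le]
  rintro _ ⟨_, ⟨g, hg, rfl⟩, rfl⟩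
  refine Submodule.subset_span ⟨f g, h ⟨g, hg, rfl⟩, ?_⟩
  rw [map_sub]
  simp [MonoidAlgebra.one_def]

/-- `𝔯𝔣ⁿ`, the additive span of the products `r * f₁ * ⋯ * fₙ` with `r` in the augmentation ideal of
`R` and the `fᵢ` in that of `F`. For `n ≥ 1` it is the product of the ideals `𝔯ℤ[F]` and `𝔣ⁿ`
of `ℤ[F]`. -/
def foxIdeal (R : Subgroup F) (n : ℕ) : Submodule ℤ (MonoidAlgebra ℤ F) :=
  aug R * aug (⊤ : Subgroup F) ^ n

theorem foxIdeal_map_le (f : F →* F') {R : Subgroup F} {R' : Subgroup F'} (h : R.map f ≤ R')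
    (n : ℕ) : (foxIdeal R n).map (MonoidAlgebra.mapDomainAlgHom ℤ ℤ f).toLinearMap
      ≤ foxIdeal R' n := by
  rw [foxIdeal, Submodule.map_mul, Submodule.map_pow]
  exact mul_le_mul' (aug_map_le f h) (pow_le_pow_left' (aug_map_le f le_top) n)

theorem aug_top_mul_of {a : MonoidAlgebra ℤ F} (ha : a ∈ aug (⊤ : Subgroup F)) (g : F) :
    a * MonoidAlgebra.of ℤ F g ∈ aug (⊤ : Subgroup F) := by
  induction ha using Submodule.span_induction with
  | mem x hx =>
    obtain ⟨h, -, rfl⟩ := hx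
    have : (MonoidAlgebra.of ℤ F h - 1) * MonoidAlgebra.of ℤ F g
        = (MonoidAlgebra.of ℤ F (h * g) - 1) - (MonoidAlgebra.of ℤ F g - 1) := by
      rw [map_mul]; noncomm_ring
    rw [this]
    exact Submodule.sub_mem _ (Submodule.subset_span ⟨_, trivial, rfl⟩)
      (Submodule.subset_span ⟨_, trivial, rfl⟩)
  | zero => simp
  | add x y _ _ hx hy => rw [add_mul]; exact Submodule.add_mem _ hx hy
  | smul c x _ hx => rw [smul_mul_assoc]; exact Submodule.smul_mem _ c hx

theorem foxIdeal_mul_of (R : Subgroup F) (n : ℕ) {a : MonoidAlgebra ℤ F}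
    (ha : a ∈ foxIdeal R (n + 1)) (g : F) :
    a * MonoidAlgebra.of ℤ F g ∈ foxIdeal R (n + 1) := by
  rw [foxIdeal, pow_succ, ← mul_assoc] at ha ⊢
  induction ha using Submodule.mul_induction_on' with
  | mem_mul_mem x hx y hy =>
    rw [mul_assoc x y]
    exact Submodule.mul_mem_mul hx (aug_top_mul_of hy g)
  | add x _ y _ hx hy => rw [add_mul]; exact Submodule.add_mem _ hx hy

/-- The Fox subgroup `F(n, R) = F ∩ (1 + 𝔯𝔣ⁿ)`, for `n = m + 1 ≥ 1`. -/
def foxSucc (R : Subgroup F) (m : ℕ) : Subgroup F where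
  carrier := {g | MonoidAlgebra.of ℤ F g - 1 ∈ foxIdeal R (m + 1)}
  one_mem' := by
    show MonoidAlgebra.of ℤ F 1 - 1 ∈ foxIdeal R (m + 1)
    rw [map_one, sub_self]
    exact Submodule.zero_mem _
  mul_mem' {a b} ha hb := by
    have : MonoidAlgebra.of ℤ F (a * b) - 1
        = (MonoidAlgebra.of ℤ F a - 1) * MonoidAlgebra.of ℤ F b
          + (MonoidAlgebra.of ℤ F b - 1) := by
      rw [map_mul]; noncomm_ring
    show _ ∈ foxIdeal R (m + 1)
    rw [this]
    exact Submodule.add_mem _ (foxIdeal_mul_of R m ha b) hb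
  inv_mem' {a} ha := by
    have : MonoidAlgebra.of ℤ F a⁻¹ - 1
        = -((MonoidAlgebra.of ℤ F a - 1) * MonoidAlgebra.of ℤ F a⁻¹) := by
      rw [sub_mul, ← map_mul, mul_inv_cancel, map_one]; noncomm_ring
    show _ ∈ foxIdeal R (m + 1)
    rw [this]
    exact Submodule.neg_mem _ (foxIdeal_mul_of R m ha a⁻¹)

/-- The third Fox subgroup `F(3, R) = F ∩ (1 + 𝔯𝔣³)`. -/
def fox3 (R : Subgroup F) : Subgroup F := foxSucc R 2

theorem mem_fox3 (R : Subgroup F) (g : F) :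
    g ∈ fox3 R ↔ MonoidAlgebra.of ℤ F g - 1 ∈ aug R * aug (⊤ : Subgroup F) ^ 3 := Iff.rfl

theorem fox3_map_le (f : F →* F') {R : Subgroup F} {R' : Subgroup F'} (h : R.map f ≤ R') :
    (fox3 R).map f ≤ fox3 R' := by
  rintro _ ⟨g, hg, rfl⟩
  have := foxIdeal_map_le f h 3 ⟨_, hg, rfl⟩
  show MonoidAlgebra.of ℤ F' (f g) - 1 ∈ foxIdeal R' 3
  rw [map_sub] at this
  simpa [MonoidAlgebra.one_def] using this

/-- `G(3, R) = γ₂(R ∩ γ₃(F)) [[R ∩ γ₂(F), R], R ∩ γ₂(F)] γ₄(R)`. For `R` normal in `F` the three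
factors are normal, and their join is their product. -/
def foxG3 (R : Subgroup F) : Subgroup F :=
  gam (capGam R 3) 2 ⊔ ⁅⁅capGam R 2, R⁆, capGam R 2⁆ ⊔ gam R 4

instance foxG3_normal (R : Subgroup F) [R.Normal] : (foxG3 R).Normal :=
  inferInstanceAs
    (gam (capGam R 3) 2 ⊔ ⁅⁅capGam R 2, R⁆, capGam R 2⁆ ⊔ gam R 4 : Subgroup F).Normal

theorem foxG3_map_le (f : F →* F') {R : Subgroup F} {R' : Subgroup F'} (h : R.map f ≤ R') :
    (foxG3 R).map f ≤ foxG3 R' := by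
  have h2 := capGam_map_le f h 2
  rw [foxG3, foxG3, Subgroup.map_sup, Subgroup.map_sup]
  refine sup_le_sup (sup_le_sup (gam_map_le f (capGam_map_le f h 3) 2) ?_) (gam_map_le f h 4)
  rw [Subgroup.map_commutator, Subgroup.map_commutator]
  exact Subgroup.commutator_mono (Subgroup.commutator_mono h2 h) h2

/-- The subgroup `W` generated by the elements `[x, y]ᵐ [x, s_y]⁻¹ [y, s_x]`, where
`x, y ∈ R ∩ γ₂(F)`, `m` is an integer, `xᵐ = r_x s_x`, `yᵐ = r_y s_y`,
`r_x, r_y ∈ R ∩ γ₃(F)` and `s_x, s_y ∈ γ₂(R)`. -/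
def foxW (R : Subgroup F) : Subgroup F :=
  Subgroup.closure {w | ∃ (m : ℤ) (x y rx sx ry sy : F),
    x ∈ capGam R 2 ∧ y ∈ capGam R 2 ∧
    rx ∈ capGam R 3 ∧ sx ∈ gam R 2 ∧ x ^ m = rx * sx ∧
    ry ∈ capGam R 3 ∧ sy ∈ gam R 2 ∧ y ^ m = ry * sy ∧
    w = ⁅x, y⁆ ^ m * ⁅x, sy⁆⁻¹ * ⁅y, sx⁆}

/-- `γ₂(R) (R ∩ γ₃(F))`; for `R` normal in `F` the join is the product. -/
def foxB (R : Subgroup F) : Subgroup F := gam R 2 ⊔ capGam R 3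

instance foxB_normal (R : Subgroup F) [R.Normal] : (foxB R).Normal :=
  inferInstanceAs (gam R 2 ⊔ capGam R 3).Normal

theorem foxB_map_le (f : F →* F') {R : Subgroup F} {R' : Subgroup F'} (h : R.map f ≤ R') :
    (foxB R).map f ≤ foxB R' := by
  rw [foxB, foxB, Subgroup.map_sup]
  exact sup_le_sup (gam_map_le f h 2) (capGam_map_le f h 3)

/-- `F(3, R) / G(3, R)`. -/
abbrev FoxQuot (R : Subgroup F) : Type u := fox3 R ⧸ (foxG3 R).subgroupOf (fox3 R)

/-- `(R ∩ γ₂(F)) / (γ₂(R) (R ∩ γ₃(F)))`. -/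
abbrev FoxK (R : Subgroup F) : Type u := capGam R 2 ⧸ (foxB R).subgroupOf (capGam R 2)

instance foxKCommGroup (R : Subgroup F) [R.Normal] : CommGroup (FoxK R) where
  mul_comm a b := by
    induction a using QuotientGroup.induction_on with | _ a => ?_
    induction b using QuotientGroup.induction_on with | _ b => ?_
    rw [← QuotientGroup.mk_mul, ← QuotientGroup.mk_mul, QuotientGroup.eq, Subgroup.mem_subgroupOf]
    have h : ⁅(b : F)⁻¹, (a : F)⁻¹⁆ ∈ gam R 2 :=
      Subgroup.commutator_mem_commutator (R.inv_mem b.2.1) (R.inv_mem a.2.1)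
    refine Subgroup.mem_sup_left (Eq.subst ?_ h)
    simp [commutatorElement_def, mul_assoc]

end Subgroups

/-! ### The category of pairs `(F, R)` and the two functors on it -/

/-- A pair `(F, R)`: a free group `F` and a normal subgroup `R` of `F`. -/
structure FreePair : Type (u + 1) where
  F : Type u
  [grp : Group F]
  [free : IsFreeGroup F]
  R : Subgroup F
  [nor : R.Normal]

attribute [instance] FreePair.grp FreePair.free FreePair.nor

/-- Morphisms `(F, R) ⟶ (F', R')` are the homomorphisms `f : F → F'` with `f(R) ⊆ R'`. -/
instance freePairCategory : Category FreePair.{u} where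
  Hom P Q := {f : P.F →* Q.F // P.R.map f ≤ Q.R}
  id P := ⟨MonoidHom.id P.F, by simp⟩
  comp f g := ⟨g.1.comp f.1, by
    rw [← Subgroup.map_map]
    exact (Subgroup.map_mono f.2).trans g.2⟩

/-- The functor `(F, R) ↦ F(3, R) / G(3, R)`. -/
def foxQuotFunctor : FreePair.{u} ⥤ GrpCat.{u} where
  obj P := GrpCat.of (FoxQuot P.R)
  map {P Q} f := GrpCat.ofHom
    (QuotientGroup.map _ ((foxG3 Q.R).subgroupOf (fox3 Q.R))
      ((f.1.comp (fox3 P.R).subtype).codRestrict (fox3 Q.R)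
        fun x => fox3_map_le f.1 f.2 ⟨x, x.2, rfl⟩)
      fun x hx => foxG3_map_le f.1 f.2 ⟨x, hx, rfl⟩)
  map_id _ := GrpCat.hom_ext (QuotientGroup.monoidHom_ext _ (MonoidHom.ext fun _ => rfl))
  map_comp _ _ := GrpCat.hom_ext (QuotientGroup.monoidHom_ext _ (MonoidHom.ext fun _ => rfl))

/-- The functor `(F, R) ↦ (R ∩ γ₂(F)) / (γ₂(R) (R ∩ γ₃(F)))`, written multiplicatively. -/
def foxKMul : FreePair.{u} ⥤ CommGrpCat.{u} where
  obj P := CommGrpCat.of (FoxK P.R)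
  map {P Q} f := CommGrpCat.ofHom
    (QuotientGroup.map _ ((foxB Q.R).subgroupOf (capGam Q.R 2))
      ((f.1.comp (capGam P.R 2).subtype).codRestrict (capGam Q.R 2)
        fun x => capGam_map_le f.1 f.2 2 ⟨x, x.2, rfl⟩)
      fun x hx => foxB_map_le f.1 f.2 ⟨x, hx, rfl⟩)
  map_id _ := CommGrpCat.hom_ext (QuotientGroup.monoidHom_ext _ (MonoidHom.ext fun _ => rfl))
  map_comp _ _ := CommGrpCat.hom_ext (QuotientGroup.monoidHom_ext _ (MonoidHom.ext fun _ => rfl))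

/-- The functor `(F, R) ↦ (R ∩ γ₂(F)) / (γ₂(R) (R ∩ γ₃(F)))` to (additive) abelian groups. -/
def foxKFunctor : FreePair.{u} ⥤ AddCommGrpCat.{u} := foxKMul ⋙ CommGrpCat.toAddCommGrp

/-! ### Derived functors in the sense of Dold and Puppe -/

section SymmetricSquare

open TensorProduct

/-- The subgroup of `A ⊗ A` generated by the elements `a ⊗ b - b ⊗ a`. -/
def sp2Rel (A : Type u) [AddCommGroup A] : AddSubgroup (A ⊗[ℤ] A) :=
  AddSubgroup.closure {t | ∃ a b : A, t = a ⊗ₜ[ℤ] b - b ⊗ₜ[ℤ] a}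

/-- The symmetric square `SP²(A) = A ⊗ A / ⟨a ⊗ b - b ⊗ a⟩`. -/
abbrev SP2 (A : Type u) [AddCommGroup A] : Type u := (A ⊗[ℤ] A) ⧸ sp2Rel A

/-- `f ⊗ f : A ⊗ A → B ⊗ B`. -/
def tensorSq {A B : Type u} [AddCommGroup A] [AddCommGroup B] (f : A →+ B) :
    A ⊗[ℤ] A →+ B ⊗[ℤ] B :=
  (TensorProduct.map f.toIntLinearMap f.toIntLinearMap).toAddMonoidHom

theorem tensorSq_tmul {A B : Type u} [AddCommGroup A] [AddCommGroup B] (f : A →+ B) (a b : A) :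
    tensorSq f (a ⊗ₜ[ℤ] b) = f a ⊗ₜ[ℤ] f b := rfl

theorem tensorSq_id (A : Type u) [AddCommGroup A] (x : A ⊗[ℤ] A) :
    tensorSq (AddMonoidHom.id A) x = x := by
  induction x with
  | zero => simp
  | tmul a b => rfl
  | add x y hx hy => rw [map_add, hx, hy]

theorem tensorSq_comp {A B C : Type u} [AddCommGroup A] [AddCommGroup B] [AddCommGroup C]
    (g : B →+ C) (f : A →+ B) (x : A ⊗[ℤ] A) :
    tensorSq (g.comp f) x = tensorSq g (tensorSq f x) := by
  induction x with
  | zero => simp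
  | tmul a b => rfl
  | add x y hx hy => rw [map_add, hx, hy, map_add, map_add]

theorem sp2Rel_le {A B : Type u} [AddCommGroup A] [AddCommGroup B] (f : A →+ B) :
    sp2Rel A ≤ (sp2Rel B).comap (tensorSq f) := by
  rw [sp2Rel, AddSubgroup.closure_le]
  rintro _ ⟨a, b, rfl⟩
  show tensorSq f (a ⊗ₜ[ℤ] b - b ⊗ₜ[ℤ] a) ∈ sp2Rel B
  rw [map_sub, tensorSq_tmul, tensorSq_tmul]
  exact AddSubgroup.subset_closure ⟨f a, f b, rfl⟩

/-- The symmetric square as an endofunctor of the category of abelian groups. -/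
def sp2Functor : AddCommGrpCat.{u} ⥤ AddCommGrpCat.{u} where
  obj A := AddCommGrpCat.of (SP2 A)
  map {A B} f := AddCommGrpCat.ofHom
    (QuotientAddGroup.map (sp2Rel A) (sp2Rel B) (tensorSq f.hom) (sp2Rel_le f.hom))
  map_id A := by
    refine AddCommGrpCat.hom_ext (QuotientAddGroup.addMonoidHom_ext _ (AddMonoidHom.ext fun x => ?_))
    exact congrArg (QuotientAddGroup.mk (s := sp2Rel A)) (tensorSq_id A x)
  map_comp {A B C} f g := by
    refine AddCommGrpCat.hom_ext (QuotientAddGroup.addMonoidHom_ext _ (AddMonoidHom.ext fun x => ?_))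
    exact congrArg (QuotientAddGroup.mk (s := sp2Rel C)) (tensorSq_comp g.hom f.hom x)

end SymmetricSquare

/-- The canonical projection `ℤ[A] → A` from the free abelian group on the set `A`. -/
def freeProj (A : Type u) [AddCommGroup A] : FreeAbelianGroup A →+ A :=
  FreeAbelianGroup.lift id

theorem freeProj_map {A B : Type u} [AddCommGroup A] [AddCommGroup B] (f : A →+ B)
    (x : FreeAbelianGroup A) : freeProj B (FreeAbelianGroup.map f x) = f (freeProj A x) := by
  have : (freeProj B).comp (FreeAbelianGroup.map f) = f.comp (freeProj A) := by
    ext a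
    simp [freeProj]
  exact DFunLike.congr_fun this x

/-- The terms of the canonical free resolution of `A`. -/
def freeResX (A : Type u) [AddCommGroup A] : ℕ → AddCommGrpCat.{u}
  | 0 => AddCommGrpCat.of (FreeAbelianGroup A)
  | 1 => AddCommGrpCat.of (freeProj A).ker
  | _ + 2 => AddCommGrpCat.of PUnit

/-- The differentials of the canonical free resolution of `A`. -/
def freeResD (A : Type u) [AddCommGroup A] : ∀ n, freeResX A (n + 1) ⟶ freeResX A n
  | 0 => AddCommGrpCat.ofHom (freeProj A).ker.subtype
  | _ + 1 => 0

/-- The maps induced by `f : A → B` on the terms of the canonical free resolutions. -/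
def freeResMap {A B : Type u} [AddCommGroup A] [AddCommGroup B] (f : A →+ B) :
    ∀ n, freeResX A n ⟶ freeResX B n
  | 0 => AddCommGrpCat.ofHom (FreeAbelianGroup.map f)
  | 1 => AddCommGrpCat.ofHom
      (((FreeAbelianGroup.map f).comp (freeProj A).ker.subtype).codRestrict (freeProj B).ker
        fun x => by
          rw [AddMonoidHom.mem_ker]
          show freeProj B (FreeAbelianGroup.map f x) = 0
          rw [freeProj_map, AddMonoidHom.mem_ker.1 x.2, map_zero])
  | _ + 2 => 𝟙 _

theorem freeResD_comp (A : Type u) [AddCommGroup A] :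
    ∀ n, freeResD A (n + 1) ≫ freeResD A n = 0
  | 0 => Limits.zero_comp
  | _ + 1 => Limits.zero_comp

theorem freeResMap_comm {A B : Type u} [AddCommGroup A] [AddCommGroup B] (f : A →+ B) :
    ∀ n, freeResMap f (n + 1) ≫ freeResD B n = freeResD A n ≫ freeResMap f n
  | 0 => rfl
  | _ + 1 => Limits.comp_zero.trans Limits.zero_comp.symm

/-- The canonical free resolution `⋯ → 0 → ker(ℤ[A] → A) → ℤ[A]` of `A`, as a complex. -/
def freeResComplex (A : Type u) [AddCommGroup A] : ChainComplex AddCommGrpCat.{u} ℕ :=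
  ChainComplex.of (freeResX A) (freeResD A) (freeResD_comp A)

theorem freeResComplex_d (A : Type u) [AddCommGroup A] (n : ℕ) :
    (freeResComplex A).d (n + 1) n = freeResD A n :=
  ChainComplex.of_d (freeResX A) (freeResD A) n

/-- The canonical free resolution `⋯ → 0 → ker(ℤ[A] → A) → ℤ[A]` of an abelian group `A`, a
projective resolution that is functorial in `A`. -/
def freeRes : AddCommGrpCat.{u} ⥤ ChainComplex AddCommGrpCat.{u} ℕ where
  obj A := freeResComplex A
  map {A B} f := ChainComplex.ofHom (X := freeResComplex A) (Y := freeResComplex B)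
    (freeResMap f.hom) fun n => by
      rw [freeResComplex_d, freeResComplex_d]
      exact freeResMap_comm f.hom n
  map_id A := by
    ext n : 1
    match n with
    | 0 =>
      show AddCommGrpCat.ofHom (FreeAbelianGroup.map (id : A → A)) = 𝟙 _
      rw [FreeAbelianGroup.map_id]
      rfl
    | 1 =>
      ext x
      refine Subtype.ext ?_
      show FreeAbelianGroup.map (id : A → A) x.1 = x.1
      rw [FreeAbelianGroup.map_id]
      rfl
    | n + 2 => rfl
  map_comp {A B C} f g := by
    ext n : 1
    match n with
    | 0 =>
      show AddCommGrpCat.ofHom (FreeAbelianGroup.map (g.hom ∘ f.hom)) = _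
      rw [FreeAbelianGroup.map_comp]
      rfl
    | 1 =>
      ext x
      refine Subtype.ext ?_
      show FreeAbelianGroup.map (g.hom ∘ f.hom) x.1 = _
      rw [FreeAbelianGroup.map_comp]
      rfl
    | n + 2 => rfl

/-- The derived functor `LᵢT(A) = πᵢ(T K P_*)` of an endofunctor `T` of the category of abelian
groups, in the sense of Dold and Puppe: `P_*` is the (canonical) projective resolution of `A`, `K`
is the inverse of the Moore normalization in the Dold-Kan equivalence, `T` is applied in each
simplicial degree, and `πᵢ` of a simplicial abelian group is the `i`-th homology of the complex with
the differential `∑ (-1)ʲ dⱼ`. -/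
def doldPuppe (T : AddCommGrpCat.{u} ⥤ AddCommGrpCat.{u}) (i : ℕ) :
    AddCommGrpCat.{u} ⥤ AddCommGrpCat.{u} :=
  freeRes ⋙ Abelian.DoldKan.Γ ⋙ (SimplicialObject.whiskering _ _).obj T ⋙
    AlgebraicTopology.alternatingFaceMapComplex _ ⋙ HomologicalComplex.homologyFunctor _ _ i

/-- `L₁SP²`, the first derived functor of the symmetric square. -/
def L1SP2 : AddCommGrpCat.{u} ⥤ AddCommGrpCat.{u} := doldPuppe sp2Functor 1

/-- Abelian groups, written multiplicatively, as groups. -/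
def abToGrp : AddCommGrpCat.{u} ⥤ GrpCat.{u} :=
  AddCommGrpCat.toCommGrp ⋙ forget₂ CommGrpCat GrpCat

end

/-! By Nielsen–Schreier `R` is free, so M = R_ab is free abelian. Let B ⊆ M be the image of R ∩
γ₃(F), and let C be the image of M in F_ab, again free abelian. Fox calculus over the free group R
attaches to w ∈ F(3,R) the coefficients ∂ᵢw of w - 1 with respect to free generators of R, and w - 1
∈ 𝔯𝔣³ forces ∂ᵢw ∈ ℤ[R] ∩ 𝔣³. Hence w ∈ γ₂(R). Its second total derivative, the leading term in M ⊗
M, is antisymmetric because w ∈ γ₂(R), and lies in M ⊗ B because first derivatives of elements of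
ℤ[R] ∩ 𝔣³ lie in B (`foxDer1_mem_foxBAb`). This gives a homomorphism `foxHom` from F(3,R) to Λ²(M) ∩
(M ⊗ B).

The preimage of Λ²(B) is exactly G(3,R). After a correction by γ₂(R ∩ γ₃(F)) the leading term
vanishes, so w ∈ γ₃(R). The third derivative of w vanishes in M ⊗ C ⊗ C, and a computation with the
degree three part of the free Lie ring places w in [[R ∩ γ₂(F), R], R ∩ γ₂(F)] γ₄(R)
(`mem_of_foxDer3_eq_zero`). The map is onto: by Smith normal form the target is generated by the
tensors m(x ⊗ y - y ⊗ x) with mx, my ∈ B (`koszulZ_le_tauSub`), and these are the leading terms of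
generators of W. This proves (b) and identifies the quotient with (Λ²(M) ∩ (M ⊗ B)) / Λ²(B), the
first Koszul homology of the pair B ⊆ M.

For (a), let K be the argument of L₁SP² in the statement. Then M/B is an extension of C by K. As C
is free, it splits off and contributes nothing, so the Koszul homology agrees with that of a free
presentation of K (`koszulMap_bijective`). For the canonical presentation, an explicit chain-level
map `rho` identifies it with π₁ of the symmetric square of the simplicial resolution
(`homologyToKoszul_bijective`). The comparison of presentations involves choices, but they matter
only modulo B, and congruent maps of pairs induce the same map (`koszulMap_eq`); this gives
naturality. -/

noncomputable section

open TensorProduct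

/-! ### Submodules of free abelian groups -/

section FreeSubmodule

variable {M : Type*} [AddCommGroup M]

/-- A submodule of a free `ℤ`-module, of arbitrary rank, is free. -/
theorem free_int_submodule [Module.Free ℤ M] (N : Submodule ℤ M) : Module.Free ℤ N := by
  classical
  let b : Module.Basis (Module.Free.ChooseBasisIndex ℤ M) ℤ M := Module.Free.chooseBasis ℤ M
  let ι := Module.Free.ChooseBasisIndex ℤ M
  -- Well-order the basis. `low i` consists of the vectors supported on indices at most `i`, and `I
  -- i` is the ideal of coefficients at `i` of the elements of `N` among them.
  obtain ⟨_, hwf⟩ := exists_wellFoundedLT ι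
  let low (i : ι) : Submodule ℤ M := ⨅ j : Set.Ioi i, LinearMap.ker (b.coord j)
  have mem_low {i : ι} {x : M} : x ∈ low i ↔ ∀ j, i < j → b.repr x j = 0 := by
    simp [low, Submodule.mem_iInf]
  let I (i : ι) : Ideal ℤ := (N ⊓ low i).map (b.coord i)
  let a (i : ι) : ℤ := Submodule.IsPrincipal.generator (I i)
  have ha (i : ι) : ∃ x ∈ N ⊓ low i, b.repr x i = a i :=
    Submodule.IsPrincipal.generator_mem (I i)
  choose x hx hxa using ha
  -- One element of `N` for each nonzero leading ideal, with leading coefficient a generator of that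
  -- ideal; these form the basis.
  let v (i : {i | a i ≠ 0}) : N := ⟨x i, (hx i).1⟩
  refine Module.Free.of_basis (Module.Basis.mk (v := v) ?_ ?_)
  · rw [linearIndependent_iff]
    intro l hl
    by_contra hne
    have hs : l.support.Nonempty := Finsupp.support_nonempty_iff.2 hne
    -- At the largest index of a relation only one term has a nonzero coordinate.
    let m := l.support.max' hs
    have h0 := congrArg (fun y : N => b.repr (y : M) m.1) hl
    simp only [Finsupp.linearCombination_apply, Finsupp.sum, AddSubmonoidClass.coe_finsetSum, map_sum,
      Finsupp.coe_finsetSum, Finset.sum_apply, ZeroMemClass.coe_zero, map_zero,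
      Finsupp.coe_zero, Pi.zero_apply] at h0
    rw [Finset.sum_eq_single m] at h0
    · have h1 : l m * a m.1 = 0 := by simpa [v, hxa] using h0
      rcases mul_eq_zero.1 h1 with h | h
      · exact (Finsupp.mem_support_iff.1 (l.support.max'_mem hs)) h
      · exact m.2 h
    · intro i hi hne'
      have hlt : i < m := lt_of_le_of_ne (l.support.le_max' _ hi) hne'
      have := mem_low.1 (hx i.1).2 m.1 hlt
      simp [v, this]
    · intro h; exact absurd (l.support.max'_mem hs) h
  · have key : ∀ i : ι, ∀ y : N, (y : M) ∈ low i → y ∈ Submodule.span ℤ (Set.range v) := by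
      intro i
      induction i using WellFoundedLT.induction with | ind i ih => ?_
      intro y hy
      -- If the coefficient at `i` vanishes, the leading index of `z` is smaller than `i`, and the
      -- induction hypothesis applies there.
      have below : ∀ z : N, (z : M) ∈ low i → b.repr (z : M) i = 0 →
          z ∈ Submodule.span ℤ (Set.range v) := by
        intro z hz hzi
        by_cases hz0 : z = 0
        · rw [hz0]; exact Submodule.zero_mem _
        have hs : (b.repr (z : M)).support.Nonempty := by
          rw [Finsupp.support_nonempty_iff]
          simpa using hz0
        let m := (b.repr (z : M)).support.max' hs
        have hm := Finsupp.mem_support_iff.1 ((b.repr (z : M)).support.max'_mem hs)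
        have hmi : m < i := by
          rcases lt_trichotomy m i with h | h | h
          · exact h
          · rw [← h] at hzi; exact absurd hzi hm
          · exact absurd (mem_low.1 hz m h) hm
        refine ih m hmi z (mem_low.2 fun j hj => ?_)
        by_contra hne
        exact absurd ((b.repr (z : M)).support.le_max' j (Finsupp.mem_support_iff.2 hne))
          (not_le.2 hj)
      have hmem : b.repr (y : M) i ∈ I i := ⟨y, ⟨y.2, hy⟩, rfl⟩
      obtain ⟨c, hc⟩ := (Submodule.IsPrincipal.mem_iff_eq_smul_generator (I i)).1 hmem
      by_cases hai : a i = 0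
      · refine below y hy ?_
        rw [hc]; show c • a i = 0; rw [hai, smul_zero]
      · have hsub := below (y - c • v ⟨i, hai⟩)
          (Submodule.sub_mem _ hy (Submodule.smul_mem _ _ (hx i).2)) (by
            show b.repr ((y : M) - c • x i) i = 0
            rw [map_sub, map_smul, Finsupp.sub_apply, Finsupp.smul_apply, hxa, hc]
            exact sub_self _)
        have := Submodule.add_mem _ hsub
          (Submodule.smul_mem _ c (Submodule.subset_span (Set.mem_range_self ⟨i, hai⟩)))
        simpa using this
    intro y _
    by_cases hy0 : y = 0
    · rw [hy0]; exact Submodule.zero_mem _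
    have hs : (b.repr (y : M)).support.Nonempty := by
      rw [Finsupp.support_nonempty_iff]
      simpa using hy0
    refine key ((b.repr (y : M)).support.max' hs) y (mem_low.2 fun j hj => ?_)
    by_contra hne
    exact absurd ((b.repr (y : M)).support.le_max' j (Finsupp.mem_support_iff.2 hne)) (not_le.2 hj)

theorem free_addSubgroup [Module.Free ℤ M] (N : AddSubgroup M) : Module.Free ℤ N :=
  free_int_submodule (AddSubgroup.toIntSubmodule N)

end FreeSubmodule

/-! ### Subgroups of the tensor square -/

section TensorSquare

variable {A : Type*} [AddCommGroup A] {A' : Type*} [AddCommGroup A']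

/-- The subgroup of `A ⊗ A'` generated by the `a ⊗ b` with `b ∈ B`. -/
def tensR (A : Type*) [AddCommGroup A] (B : AddSubgroup A') : AddSubgroup (A ⊗[ℤ] A') :=
  AddSubgroup.closure {t | ∃ a : A, ∃ b ∈ B, t = a ⊗ₜ[ℤ] b}

/-- The image of `Λ²(B)` in `A ⊗ A`. -/
def altSq (B : AddSubgroup A) : AddSubgroup (A ⊗[ℤ] A) :=
  AddSubgroup.closure {t | ∃ b ∈ B, ∃ b' ∈ B, t = b ⊗ₜ[ℤ] b' - b' ⊗ₜ[ℤ] b}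

/-- The subgroup of `A ⊗ A'` generated by the `b ⊗ b'` with `b ∈ B`, `b' ∈ B'`. -/
def tensSub (B : AddSubgroup A) (B' : AddSubgroup A') : AddSubgroup (A ⊗[ℤ] A') :=
  AddSubgroup.closure {t | ∃ b ∈ B, ∃ b' ∈ B', t = b ⊗ₜ[ℤ] b'}

abbrev swap (A : Type*) [AddCommGroup A] : A ⊗[ℤ] A ≃ₗ[ℤ] A ⊗[ℤ] A := TensorProduct.comm ℤ A A

@[simp] theorem swap_tmul (a b : A) : swap A (a ⊗ₜ[ℤ] b) = b ⊗ₜ[ℤ] a := rfl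

theorem swap_of_mem_altSq {B : AddSubgroup A} {t : A ⊗[ℤ] A} (ht : t ∈ altSq B) :
    swap A t = -t := by
  induction ht using AddSubgroup.closure_induction with
  | mem x hx => obtain ⟨b, -, b', -, rfl⟩ := hx; simp
  | zero => simp
  | add x y _ _ hx hy => rw [map_add, hx, hy]; abel
  | neg x _ hx => rw [map_neg, hx]

theorem sub_swap_mem_altSq {B : AddSubgroup A} {t : A ⊗[ℤ] A} (ht : t ∈ tensSub B B) :
    t - swap A t ∈ altSq B := by
  induction ht using AddSubgroup.closure_induction with
  | mem x hx =>
    obtain ⟨b, hb, b', hb', rfl⟩ := hx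
    exact AddSubgroup.subset_closure ⟨b, hb, b', hb', by simp⟩
  | zero => simp
  | add x y _ _ hx hy =>
    rw [map_add, add_sub_add_comm]; exact add_mem hx hy
  | neg x _ hx =>
    have h := neg_mem hx
    rwa [neg_sub', ← map_neg] at h

theorem mem_tensSub_top (t : A ⊗[ℤ] A') : t ∈ tensSub (⊤ : AddSubgroup A) (⊤ : AddSubgroup A') := by
  induction t with
  | zero => exact zero_mem _
  | tmul a b => exact AddSubgroup.subset_closure ⟨a, trivial, b, trivial, rfl⟩
  | add x y hx hy => exact add_mem hx hy

theorem altSq_top (A : Type u) [AddCommGroup A] : altSq (⊤ : AddSubgroup A) = sp2Rel A := by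
  simp [altSq, sp2Rel]

theorem repr_swap {ι : Type*} (e : Module.Basis ι ℤ A) (t : A ⊗[ℤ] A) (i j : ι) :
    (e.tensorProduct e).repr (swap A t) (i, j) = (e.tensorProduct e).repr t (j, i) := by
  induction t with
  | zero => simp
  | tmul a b => simp [Module.Basis.tensorProduct_repr_tmul_apply, mul_comm]
  | add x y hx hy => simp only [map_add, Finsupp.add_apply, hx, hy]

/-- An antisymmetric tensor is determined by its part above the diagonal. -/
theorem eq_sub_swap_of_antisymm {ι : Type*} [LinearOrder ι] (e : Module.Basis ι ℤ A)
    {t : A ⊗[ℤ] A} (ht : swap A t = -t) :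
    ∃ s : ι × ι →₀ ℤ, (∀ p, s p ≠ 0 → s p = (e.tensorProduct e).repr t p) ∧
      t = (e.tensorProduct e).repr.symm s - swap A ((e.tensorProduct e).repr.symm s) := by
  classical
  let c := (e.tensorProduct e).repr t
  have hc (i j : ι) : c (j, i) = -c (i, j) := by
    have := repr_swap e t i j
    rw [ht, map_neg, Finsupp.neg_apply] at this
    exact this.symm
  -- `s` is the strictly upper triangular part of the coordinate matrix. Its nonzero entries being
  -- literal coordinates of `t` matters later, when they have to satisfy divisibility conditions.
  refine ⟨c.filter fun p => p.1 < p.2, fun p hp => ?_, ?_⟩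
  · by_cases h : p.1 < p.2
    · exact Finsupp.filter_apply_pos (fun p : ι × ι => p.1 < p.2) c h
    · exact absurd (Finsupp.filter_apply_neg (fun p : ι × ι => p.1 < p.2) c h) hp
  · apply (e.tensorProduct e).repr.injective
    ext ⟨i, j⟩
    rw [map_sub, Finsupp.sub_apply, repr_swap, LinearEquiv.apply_symm_apply,
      Finsupp.filter_apply, Finsupp.filter_apply]
    change c (i, j) = _
    rcases lt_trichotomy i j with h | h | h
    · simp [h, h.not_gt]
    -- On the diagonal a coordinate equals its own negative, hence is zero in ℤ.
    · subst h
      have := hc i i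
      simp; omega
    · simp [h, h.not_gt, hc j i]

theorem mem_altSq_top_of_antisymm [Module.Free ℤ A] {t : A ⊗[ℤ] A} (ht : swap A t = -t) :
    t ∈ altSq (⊤ : AddSubgroup A) := by
  classical
  obtain ⟨_, -⟩ := exists_wellFoundedLT (Module.Free.ChooseBasisIndex ℤ A)
  obtain ⟨s, -, h⟩ := eq_sub_swap_of_antisymm (Module.Free.chooseBasis ℤ A) ht
  rw [h]
  exact sub_swap_mem_altSq (mem_tensSub_top _)

theorem map_mem_altSq {B : AddSubgroup A} {B' : AddSubgroup A'} (f : A →ₗ[ℤ] A')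
    (hf : ∀ b ∈ B, f b ∈ B') {t : A ⊗[ℤ] A} (ht : t ∈ altSq B) :
    TensorProduct.map f f t ∈ altSq B' := by
  induction ht using AddSubgroup.closure_induction with
  | mem x hx =>
    obtain ⟨b, hb, b', hb', rfl⟩ := hx
    exact AddSubgroup.subset_closure ⟨f b, hf b hb, f b', hf b' hb', by simp⟩
  | zero => simp
  | add x y _ _ hx hy => rw [map_add]; exact add_mem hx hy
  | neg x _ hx => rw [map_neg]; exact neg_mem hx

theorem swap_map (f : A →ₗ[ℤ] A') (t : A ⊗[ℤ] A) :
    swap A' (TensorProduct.map f f t) = TensorProduct.map f f (swap A t) := by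
  induction t with
  | zero => simp
  | tmul a b => simp
  | add x y hx hy => simp only [map_add, hx, hy]

theorem exists_of_mem_tensSub {B : AddSubgroup A} {B' : AddSubgroup A'} {t : A ⊗[ℤ] A'}
    (ht : t ∈ tensSub B B') : ∃ s : B ⊗[ℤ] B',
      TensorProduct.map B.subtype.toIntLinearMap B'.subtype.toIntLinearMap s = t := by
  induction ht using AddSubgroup.closure_induction with
  | mem x hx =>
    obtain ⟨b, hb, b', hb', rfl⟩ := hx
    exact ⟨⟨b, hb⟩ ⊗ₜ ⟨b', hb'⟩, rfl⟩
  | zero => exact ⟨0, map_zero _⟩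
  | add x y _ _ hx hy =>
    obtain ⟨a, rfl⟩ := hx; obtain ⟨b, rfl⟩ := hy; exact ⟨a + b, map_add _ _ _⟩
  | neg x _ hx => obtain ⟨a, rfl⟩ := hx; exact ⟨-a, map_neg _ _⟩

/-- Subgroups of free abelian groups are free, hence flat, so tensoring two inclusions stays
injective. -/
theorem map_injective_of_free [Module.Free ℤ A] {C : Type*} [AddCommGroup C] (f : C →ₗ[ℤ] A)
    (hf : Function.Injective f) : Function.Injective (TensorProduct.map f f) := by
  have : Module.Free ℤ C :=
    have := free_int_submodule (LinearMap.range f)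
    Module.Free.of_equiv (LinearEquiv.ofInjective f hf).symm
  exact TensorProduct.map_injective_of_flat_flat f f hf hf

/-- This is Λ²(A) ∩ (B ⊗ B) = Λ²(B). Since B ⊗ B embeds in A ⊗ A, antisymmetry descends to B ⊗ B,
and B is itself free. -/
theorem mem_altSq_of_antisymm [Module.Free ℤ A] {B : AddSubgroup A} {t : A ⊗[ℤ] A}
    (ht : swap A t = -t) (hB : t ∈ tensSub B B) : t ∈ altSq B := by
  obtain ⟨s, rfl⟩ := exists_of_mem_tensSub hB
  have := free_addSubgroup B
  have hs : swap B s = -s := by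
    apply map_injective_of_free B.subtype.toIntLinearMap B.subtype_injective
    rw [← swap_map, ht, map_neg]
  exact map_mem_altSq _ (fun b _ => b.2) (mem_altSq_top_of_antisymm hs)

end TensorSquare

/-! ### The first homology of the Koszul complex of a pair -/

section Koszul

variable {A A' A'' : Type u} [AddCommGroup A] [AddCommGroup A'] [AddCommGroup A'']

/-- The cycles `Λ²(A) ∩ (A ⊗ B)`. -/
def koszulZ (B : AddSubgroup A) : AddSubgroup (A ⊗[ℤ] A) := altSq ⊤ ⊓ tensR A B

/-- `(Λ²(A) ∩ (A ⊗ B)) / Λ²(B)`, the first homology of the Koszul complex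
`Λ²(B) → A ⊗ B → SP²(A)`. -/
abbrev KoszulH (B : AddSubgroup A) : Type u := koszulZ B ⧸ (altSq B).addSubgroupOf (koszulZ B)

theorem map_mem_koszulZ {B : AddSubgroup A} {B' : AddSubgroup A'} (f : A →ₗ[ℤ] A')
    (hf : ∀ b ∈ B, f b ∈ B') {t : A ⊗[ℤ] A} (ht : t ∈ koszulZ B) :
    TensorProduct.map f f t ∈ koszulZ B' := by
  refine AddSubgroup.mem_inf.2
    ⟨map_mem_altSq (B' := ⊤) f (fun _ _ => AddSubgroup.mem_top _) ht.1, ?_⟩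
  obtain ⟨-, ht⟩ := ht
  change t ∈ tensR A B at ht
  induction ht using AddSubgroup.closure_induction with
  | mem x hx =>
    obtain ⟨a, b, hb, rfl⟩ := hx
    exact AddSubgroup.subset_closure ⟨f a, f b, hf b hb, rfl⟩
  | zero => simp
  | add x y _ _ hx hy => rw [map_add]; exact add_mem hx hy
  | neg x _ hx => rw [map_neg]; exact neg_mem hx

/-- The map induced on `KoszulH` by a map of pairs. -/
def koszulMap {B : AddSubgroup A} {B' : AddSubgroup A'} (f : A →ₗ[ℤ] A')
    (hf : ∀ b ∈ B, f b ∈ B') : KoszulH B →+ KoszulH B' :=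
  QuotientAddGroup.map _ _
    (((TensorProduct.map f f).toAddMonoidHom.comp (koszulZ B).subtype).codRestrict (koszulZ B')
      fun t => map_mem_koszulZ f hf t.2)
    fun t ht => map_mem_altSq f hf (t := t.1) ht

theorem koszulMap_mk {B : AddSubgroup A} {B' : AddSubgroup A'} (f : A →ₗ[ℤ] A')
    (hf : ∀ b ∈ B, f b ∈ B') (t : koszulZ B) :
    koszulMap f hf (t : KoszulH B) =
      ((⟨TensorProduct.map f f t, map_mem_koszulZ f hf t.2⟩ : koszulZ B') : KoszulH B') := rfl

theorem koszulH_eq {B : AddSubgroup A} (s t : koszulZ B) :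
    (s : KoszulH B) = t ↔ (t : A ⊗[ℤ] A) - s ∈ altSq B := by
  rw [QuotientAddGroup.eq, AddSubgroup.mem_addSubgroupOf, AddSubgroup.coe_add, AddSubgroup.coe_neg,
    neg_add_eq_sub]

theorem koszulMap_comp {B : AddSubgroup A} {B' : AddSubgroup A'} {B'' : AddSubgroup A''}
    (f : A →ₗ[ℤ] A') (hf : ∀ b ∈ B, f b ∈ B') (g : A' →ₗ[ℤ] A'') (hg : ∀ b ∈ B', g b ∈ B'')
    (x : KoszulH B) :
    koszulMap g hg (koszulMap f hf x) =
      koszulMap (g.comp f) (fun b hb => hg _ (hf b hb)) x := by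
  induction x using QuotientAddGroup.induction_on with | H t => ?_
  rw [koszulMap_mk, koszulMap_mk, koszulMap_mk]
  congr 2
  rw [TensorProduct.map_comp]
  rfl

theorem map_mem_tensSub_left {B B' : AddSubgroup A'} (f g : A →ₗ[ℤ] A') {B₀ : AddSubgroup A}
    (hf : ∀ a, f a ∈ B) (hg : ∀ b ∈ B₀, g b ∈ B') {t : A ⊗[ℤ] A} (ht : t ∈ tensR A B₀) :
    TensorProduct.map f g t ∈ tensSub B B' := by
  induction ht using AddSubgroup.closure_induction with
  | mem x hx =>
    obtain ⟨a, b, hb, rfl⟩ := hx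
    exact AddSubgroup.subset_closure ⟨f a, hf a, g b, hg b hb, rfl⟩
  | zero => simp
  | add x y _ _ hx hy => rw [map_add]; exact add_mem hx hy
  | neg x _ hx => rw [map_neg]; exact neg_mem hx

theorem swap_mem_tensSub {B B' : AddSubgroup A} {t : A ⊗[ℤ] A} (ht : t ∈ tensSub B B') :
    swap A t ∈ tensSub B' B := by
  induction ht using AddSubgroup.closure_induction with
  | mem x hx =>
    obtain ⟨b, hb, b', hb', rfl⟩ := hx
    exact AddSubgroup.subset_closure ⟨b', hb', b, hb, rfl⟩
  | zero => simp
  | add x y _ _ hx hy => rw [map_add]; exact add_mem hx hy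
  | neg x _ hx => rw [map_neg]; exact neg_mem hx

theorem map_swap (f g : A →ₗ[ℤ] A') (t : A ⊗[ℤ] A) :
    swap A' (TensorProduct.map f g t) = TensorProduct.map g f (swap A t) := by
  induction t with
  | zero => simp
  | tmul a b => simp
  | add x y hx hy => simp only [map_add, hx, hy]

theorem tensorMap_sub_left (f f' g : A →ₗ[ℤ] A') (t : A ⊗[ℤ] A) :
    TensorProduct.map (f - f') g t = TensorProduct.map f g t - TensorProduct.map f' g t := by
  induction t with
  | zero => simp
  | tmul a b => simp [sub_tmul]
  | add x y hx hy => simp only [map_add, hx, hy]; abel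

theorem tensorMap_sub_right (f g g' : A →ₗ[ℤ] A') (t : A ⊗[ℤ] A) :
    TensorProduct.map f (g - g') t = TensorProduct.map f g t - TensorProduct.map f g' t := by
  induction t with
  | zero => simp
  | tmul a b => simp [tmul_sub]
  | add x y hx hy => simp only [map_add, hx, hy]; abel

/-- Maps of pairs that are congruent induce the same map. -/
theorem koszulMap_eq [Module.Free ℤ A'] {B : AddSubgroup A} {B' : AddSubgroup A'}
    (f g : A →ₗ[ℤ] A') (hf : ∀ b ∈ B, f b ∈ B') (hg : ∀ b ∈ B, g b ∈ B')
    (hfg : ∀ a, f a - g a ∈ B') : koszulMap f hf = koszulMap g hg := by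
  ext t
  simp only [AddMonoidHom.comp_apply, QuotientAddGroup.mk'_apply]
  rw [koszulMap_mk, koszulMap_mk, koszulH_eq]
  have hs := swap_of_mem_altSq t.2.1
  refine mem_altSq_of_antisymm ?_ ?_
  · rw [map_sub, swap_map, swap_map, hs, map_neg, map_neg]; abel
  -- The difference is (g - f) ⊗ g + f ⊗ (g - f). Only the second factor of `t` is known to lie in
  -- `B`, so antisymmetry is used to move g - f to the first factor in the second summand as well;
  -- then both summands lie in B' ⊗ B'.
  · have e : TensorProduct.map g g t.1 - TensorProduct.map f f t.1 =
        TensorProduct.map (g - f) g t.1 - swap A' (TensorProduct.map (g - f) f t.1) := by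
      rw [map_swap, hs, map_neg, tensorMap_sub_left, tensorMap_sub_right]
      abel
    have hgf : ∀ a, (g - f) a ∈ B' := fun a => by
      rw [LinearMap.sub_apply, ← neg_sub]; exact neg_mem (hfg a)
    rw [e]
    exact sub_mem (map_mem_tensSub_left _ _ hgf hg t.2.2)
      (swap_mem_tensSub (map_mem_tensSub_left _ _ hgf hf t.2.2))

theorem koszulMap_id [Module.Free ℤ A] {B : AddSubgroup A} (f : A →ₗ[ℤ] A)
    (hf : ∀ b ∈ B, f b ∈ B) (hfB : ∀ a, f a - a ∈ B) (x : KoszulH B) : koszulMap f hf x = x := by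
  rw [koszulMap_eq f LinearMap.id hf (fun _ h => h) hfB]
  induction x using QuotientAddGroup.induction_on with | H t => ?_
  rw [koszulMap_mk]
  congr 2
  rw [TensorProduct.map_id]
  rfl

/-- An endomorphism of `A` that is the identity on `B` acts trivially. -/
theorem koszulMap_of_eqOn {B : AddSubgroup A} (f : A →ₗ[ℤ] A) (hf : ∀ b ∈ B, f b = b)
    (x : KoszulH B) : koszulMap f (fun b hb => (hf b hb).symm ▸ hb) x = x := by
  induction x using QuotientAddGroup.induction_on with | H t => ?_
  rw [koszulMap_mk]
  congr 2
  have h1 : ∀ s ∈ tensR A B, TensorProduct.map LinearMap.id f s = s := fun s hs => by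
    induction hs using AddSubgroup.closure_induction with
    | mem x hx => obtain ⟨a, b, hb, rfl⟩ := hx; simp [hf b hb]
    | zero => simp
    | add x y _ _ hx hy => rw [map_add, hx, hy]
    | neg x _ hx => rw [map_neg, hx]
  have hs := swap_of_mem_altSq t.2.1
  -- By antisymmetry `t` also lies in B ⊗ A, so `f` acts trivially on the first factor too.
  have h2 : TensorProduct.map f LinearMap.id t.1 = t.1 := by
    apply (swap A).injective
    rw [map_swap, hs, map_neg, h1 _ t.2.2]
  calc TensorProduct.map f f t.1
      = TensorProduct.map f LinearMap.id (TensorProduct.map LinearMap.id f t.1) := by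
        rw [← LinearMap.comp_apply, ← TensorProduct.map_comp]; simp
    _ = t.1 := by rw [h1 _ t.2.2, h2]

/-! ### Generators of the cycles -/

/-- Reduction to finite rank, where Smith normal form is available. Quantifying over all larger `N`
lets the finite sets of two summands be merged. -/
theorem exists_finset_of_mem_tensR {B : AddSubgroup A} {t : A ⊗[ℤ] A} (ht : t ∈ tensR A B) :
    ∃ S : Finset A, ∀ N : Submodule ℤ A, Submodule.span ℤ (S : Set A) ≤ N →
      ∃ s ∈ tensR N (B.comap N.subtype.toAddMonoidHom),
        TensorProduct.map N.subtype N.subtype s = t := by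
  classical
  induction ht using AddSubgroup.closure_induction with
  | mem x hx =>
    obtain ⟨a, b, hb, rfl⟩ := hx
    refine ⟨{a, b}, fun N hN => ?_⟩
    have ha : a ∈ N := hN (Submodule.subset_span (by simp))
    have hb' : b ∈ N := hN (Submodule.subset_span (by simp))
    exact ⟨⟨a, ha⟩ ⊗ₜ ⟨b, hb'⟩, AddSubgroup.subset_closure ⟨_, ⟨b, hb'⟩, hb, rfl⟩, rfl⟩
  | zero => exact ⟨∅, fun N _ => ⟨0, zero_mem _, map_zero _⟩⟩
  | add x y _ _ hx hy =>
    obtain ⟨S, hS⟩ := hx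
    obtain ⟨T, hT⟩ := hy
    refine ⟨S ∪ T, fun N hN => ?_⟩
    rw [Finset.coe_union, Submodule.span_union, sup_le_iff] at hN
    obtain ⟨s, hs, rfl⟩ := hS N hN.1
    obtain ⟨s', hs', rfl⟩ := hT N hN.2
    exact ⟨s + s', add_mem hs hs', map_add _ _ _⟩
  | neg x _ hx =>
    obtain ⟨S, hS⟩ := hx
    refine ⟨S, fun N hN => ?_⟩
    obtain ⟨s, hs, rfl⟩ := hS N hN
    exact ⟨-s, neg_mem hs, map_neg _ _⟩

/-- The subgroup of `A ⊗ A` generated by the `m (x ⊗ y - y ⊗ x)` with `m x, m y ∈ B`. -/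
def tauSub (B : AddSubgroup A) : AddSubgroup (A ⊗[ℤ] A) :=
  AddSubgroup.closure {t | ∃ (m : ℤ) (x y : A), m • x ∈ B ∧ m • y ∈ B ∧
    t = m • (x ⊗ₜ[ℤ] y - y ⊗ₜ[ℤ] x)}

/-- In a Smith normal form basis, B is spanned by multiples of basis vectors, so it contains each
coordinate component of each of its elements. -/
theorem exists_basis_smul_mem [Module.Free ℤ A] [Module.Finite ℤ A] (B : Submodule ℤ A) :
    ∃ (n : ℕ) (e : Module.Basis (Fin n) ℤ A), ∀ b ∈ B, ∀ i, e.repr b i • e i ∈ B := by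
  obtain ⟨k, snf⟩ := B.smithNormalForm (Module.finBasis ℤ A)
  refine ⟨_, snf.bM, fun b hb i => ?_⟩
  by_cases hi : i ∈ Set.range snf.f
  · obtain ⟨j, rfl⟩ := hi
    have := snf.repr_apply_embedding_eq_repr_smul ⟨b, hb⟩ (i := j)
    rw [map_smul, Finsupp.smul_apply, smul_eq_mul] at this
    rw [show snf.bM.repr b (snf.f j) = _ from this, mul_comm, mul_smul, ← snf.snf]
    exact B.smul_mem _ (snf.bN j).2
  · rw [show snf.bM.repr b i = 0 from snf.repr_eq_zero_of_notMem_range ⟨b, hb⟩ hi, zero_smul]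
    exact B.zero_mem

/-- In an adapted basis t is the sum over i < j of c(i,j) (eᵢ ⊗ eⱼ - eⱼ ⊗ eᵢ). Membership in A ⊗ B
gives c(i,j) eⱼ ∈ B and antisymmetry gives c(i,j) eᵢ ∈ B, so every summand is a generator with m =
c(i,j). -/
theorem mem_tauSub_of_finite [Module.Free ℤ A] [Module.Finite ℤ A] {B : AddSubgroup A}
    {t : A ⊗[ℤ] A} (hs : swap A t = -t) (ht : t ∈ tensR A B) : t ∈ tauSub B := by
  obtain ⟨n, e, he⟩ := exists_basis_smul_mem (AddSubgroup.toIntSubmodule B)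
  have hB (i j : Fin n) : (e.tensorProduct e).repr t (i, j) • e j ∈ B := by
    -- Contracting the first factor with the i-th coordinate sends A ⊗ B into B.
    let φ : A ⊗[ℤ] A →ₗ[ℤ] A := (TensorProduct.lid ℤ A).toLinearMap ∘ₗ (e.coord i).rTensor A
    have hφ : φ t ∈ B := by
      clear hs
      induction ht using AddSubgroup.closure_induction with
      | mem x hx =>
        obtain ⟨a, b, hb, rfl⟩ := hx
        exact B.zsmul_mem hb _
      | zero => rw [map_zero]; exact zero_mem _
      | add x y h₁ h₂ hx hy => rw [map_add]; exact add_mem hx hy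
      | neg x _ hx => rw [map_neg]; exact neg_mem hx
    have hr : ∀ s : A ⊗[ℤ] A, (e.tensorProduct e).repr s (i, j) = e.repr (φ s) j := fun s => by
      induction s with
      | zero => simp
      | tmul a b =>
        have : φ (a ⊗ₜ[ℤ] b) = e.repr a i • b := rfl
        rw [this, Module.Basis.tensorProduct_repr_tmul_apply, map_smul, Finsupp.smul_apply]
        simp [mul_comm]
      | add x y hx hy => simp only [map_add, Finsupp.add_apply, hx, hy]
    rw [hr]
    exact he _ hφ j
  obtain ⟨s, hs', h⟩ := eq_sub_swap_of_antisymm e hs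
  have hc (i j : Fin n) : (e.tensorProduct e).repr t (i, j) • e i ∈ B := by
    have := hB j i
    rw [← repr_swap, hs, map_neg, Finsupp.neg_apply, neg_smul] at this
    exact neg_mem_iff.1 this
  have hsum : (e.tensorProduct e).repr.symm s = s.sum fun p c => c • (e p.1 ⊗ₜ[ℤ] e p.2) := by
    rw [Module.Basis.repr_symm_apply, Finsupp.linearCombination_apply]
    simp [Module.Basis.tensorProduct_apply']
  rw [h, hsum, Finsupp.sum, map_sum, ← Finset.sum_sub_distrib]
  refine AddSubgroup.sum_mem _ fun p hp => ?_
  rw [map_smul, swap_tmul, ← smul_sub, hs' p (Finsupp.mem_support_iff.1 hp)]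
  exact AddSubgroup.subset_closure ⟨_, _, _, hc p.1 p.2, hB p.1 p.2, rfl⟩

theorem koszulZ_le_tauSub [Module.Free ℤ A] (B : AddSubgroup A) : koszulZ B ≤ tauSub B := by
  intro t ht
  obtain ⟨S, hS⟩ := exists_finset_of_mem_tensR ht.2
  obtain ⟨s, hs, rfl⟩ := hS _ le_rfl
  have hfree := free_int_submodule (Submodule.span ℤ (S : Set A))
  have hfin : Module.Finite ℤ (Submodule.span ℤ (S : Set A)) := Module.Finite.span_finset ℤ S
  have hsw : swap _ s = -s := by
    apply map_injective_of_free (Submodule.span ℤ (S : Set A)).subtype Subtype.val_injective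
    rw [← swap_map, swap_of_mem_altSq ht.1, map_neg]
  have := mem_tauSub_of_finite hsw hs
  clear hsw hs ht hS
  induction this using AddSubgroup.closure_induction with
  | mem x hx =>
    obtain ⟨m, x, y, hx, hy, rfl⟩ := hx
    exact AddSubgroup.subset_closure ⟨m, x, y, hx, hy, by simp⟩
  | zero => simp
  | add x y _ _ hx hy => rw [map_add]; exact add_mem hx hy
  | neg x _ hx => rw [map_neg]; exact neg_mem hx

end Koszul

/-! ### Fox calculus for a free subgroup -/

section Fox

local notation "⟪" g "⟫" => MonoidAlgebra.of ℤ _ g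

variable {F : Type u} [Group F]

theorem groupRing_induction {P : MonoidAlgebra ℤ F → Prop} (a : MonoidAlgebra ℤ F)
    (of : ∀ g : F, P ⟪g⟫) (add : ∀ x y, P x → P y → P (x + y)) (smul : ∀ (n : ℤ) x, P x → P (n • x)) :
    P a :=
  MonoidAlgebra.induction_on a of add smul

/-- The linear extension to the group ring of a function on the group. -/
def linExt {V : Type*} [AddCommGroup V] (f : F → V) : MonoidAlgebra ℤ F →ₗ[ℤ] V :=
  (MonoidAlgebra.basis F ℤ).constr ℤ f

@[simp] theorem linExt_of {V : Type*} [AddCommGroup V] (f : F → V) (g : F) :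
    linExt f ⟪g⟫ = f g :=
  (MonoidAlgebra.basis F ℤ).constr_basis ℤ f g

/-- The augmentation. -/
def eps (F : Type u) [Group F] : MonoidAlgebra ℤ F →ₐ[ℤ] ℤ := MonoidAlgebra.lift ℤ ℤ F 1

@[simp] theorem eps_of (g : F) : eps F ⟪g⟫ = 1 := by simp [eps]

@[simp] theorem eps_sub_one (g : F) : eps F (⟪g⟫ - 1) = 0 := by
  rw [map_sub, eps_of, map_one, sub_self]

theorem sub_one_mem_aug {S : Subgroup F} {u : F} (hu : u ∈ S) : ⟪u⟫ - 1 ∈ aug S :=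
  Submodule.subset_span ⟨u, hu, rfl⟩

theorem eps_of_mem_aug {S : Subgroup F} {a : MonoidAlgebra ℤ F} (ha : a ∈ aug S) : eps F a = 0 := by
  induction ha using Submodule.span_induction with
  | mem x hx => obtain ⟨h, -, rfl⟩ := hx; exact eps_sub_one h
  | zero => simp
  | add x y _ _ hx hy => simp [hx, hy]
  | smul c x _ hx => simp [hx]

/-- The group ring of a subgroup `S` of `F`, as a subgroup of `ℤ[F]`. -/
def subRing (S : Subgroup F) : Submodule ℤ (MonoidAlgebra ℤ F) :=
  Submodule.span ℤ {a | ∃ u ∈ S, a = ⟪u⟫}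

theorem of_mem_subRing {S : Subgroup F} {u : F} (hu : u ∈ S) : ⟪u⟫ ∈ subRing S :=
  Submodule.subset_span ⟨u, hu, rfl⟩

theorem subRing_mul_of {S : Subgroup F} {a : MonoidAlgebra ℤ F} (ha : a ∈ subRing S) {v : F}
    (hv : v ∈ S) : a * ⟪v⟫ ∈ subRing S := by
  induction ha using Submodule.span_induction with
  | mem x hx =>
    obtain ⟨u, hu, rfl⟩ := hx
    rw [← map_mul]; exact of_mem_subRing (S.mul_mem hu hv)
  | zero => simp
  | add x y _ _ hx hy => rw [add_mul]; exact Submodule.add_mem _ hx hy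
  | smul c x _ hx => rw [smul_mul_assoc]; exact Submodule.smul_mem _ c hx

/-- The abelianization of a subgroup, written additively. -/
abbrev AbM (S : Subgroup F) : Type u := Additive (Abelianization S)

/-- The class of an element in the abelianization. -/
def cls (S : Subgroup F) (u : S) : AbM S := Additive.ofMul (Abelianization.of u)

@[simp] theorem cls_mul (S : Subgroup F) (u v : S) : cls S (u * v) = cls S u + cls S v := by
  simp [cls]

@[simp] theorem cls_one (S : Subgroup F) : cls S 1 = 0 := by simp [cls]

@[simp] theorem cls_inv (S : Subgroup F) (u : S) : cls S u⁻¹ = -cls S u := by simp [cls]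

theorem cls_surjective (S : Subgroup F) : Function.Surjective (cls S) := fun x => by
  obtain ⟨u, hu⟩ := QuotientGroup.mk_surjective (s := commutator S) x.toMul
  exact ⟨u, congrArg Additive.ofMul hu⟩

theorem cls_eq_zero_iff (S : Subgroup F) (u : S) : cls S u = 0 ↔ (u : F) ∈ gam S 2 := by
  have h1 : cls S u = 0 ↔ u ∈ commutator S := by
    rw [← Abelianization.ker_of]; exact Iff.rfl
  rw [h1]
  change _ ↔ (u : F) ∈ ⁅S, S⁆
  rw [← Subgroup.map_subtype_commutator]
  simp

variable (S : Subgroup F)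

/-- Right multiplication on `A ⊗ ℤ[F]`. -/
def rmul (A : Type u) [AddCommGroup A] :
    MonoidAlgebra ℤ F →ₗ[ℤ] (A ⊗[ℤ] MonoidAlgebra ℤ F →ₗ[ℤ] A ⊗[ℤ] MonoidAlgebra ℤ F) :=
  LinearMap.lTensorHom A ∘ₗ (LinearMap.mul ℤ (MonoidAlgebra ℤ F)).flip

/-- A transversal `q` of the cosets S g, with S-component `r`. The behaviour under left
multiplication by S is what makes the Fox derivative extend from S to ℤ[F]. -/
theorem exists_cosetRep : ∃ (q : F → F) (r : F → S), (∀ g, (r g : F) * q g = g) ∧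
    (∀ (u : S) g, q (u * g) = q g) ∧ ∀ (u : S) g, r (u * g) = u * r g := by
  let q : F → F := fun g => Quotient.out (Quotient.mk (QuotientGroup.rightRel S) g)
  have hq (g : F) : g * (q g)⁻¹ ∈ S := by
    have h := Quotient.mk_out (s := QuotientGroup.rightRel S) g
    exact QuotientGroup.rightRel_apply.1 h
  have hqu (u : S) (g : F) : q (u * g) = q g := by
    have : Quotient.mk (QuotientGroup.rightRel S) (u * g) = Quotient.mk _ g := by
      refine Quotient.sound (QuotientGroup.rightRel_apply.2 ?_)
      simp
    simp only [q, this]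
  refine ⟨q, fun g => ⟨g * (q g)⁻¹, hq g⟩, fun g => by simp, hqu, fun u g => ?_⟩
  ext
  simp [hqu, mul_assoc]

variable {A : Type u} [AddCommGroup A]

@[simp] theorem rmul_tmul (a b : MonoidAlgebra ℤ F) (m : A) :
    rmul A a (m ⊗ₜ[ℤ] b) = m ⊗ₜ[ℤ] (b * a) := rfl

theorem rmul_mul (a b : MonoidAlgebra ℤ F) (v : A ⊗[ℤ] MonoidAlgebra ℤ F) :
    rmul A (a * b) v = rmul A b (rmul A a v) := by
  induction v with
  | zero => simp
  | tmul m x => simp [mul_assoc]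
  | add x y hx hy => rw [map_add, hx, hy, map_add, map_add]

@[simp] theorem rmul_one (v : A ⊗[ℤ] MonoidAlgebra ℤ F) : rmul A 1 v = v := by
  induction v with
  | zero => simp
  | tmul m x => simp
  | add x y hx hy => rw [map_add, hx, hy]

@[simp] theorem rmul_of_inv_of (g : F) (v : A ⊗[ℤ] MonoidAlgebra ℤ F) :
    rmul A ⟪g⟫ (rmul A ⟪g⁻¹⟫ v) = v := by
  rw [← rmul_mul, ← map_mul, inv_mul_cancel, map_one, rmul_one]

@[simp] theorem rmul_of_of_inv (g : F) (v : A ⊗[ℤ] MonoidAlgebra ℤ F) :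
    rmul A ⟪g⁻¹⟫ (rmul A ⟪g⟫ v) = v := by
  rw [← rmul_mul, ← map_mul, mul_inv_cancel, map_one, rmul_one]

/-- `S_ab ⊗ ℤ[F] → S_ab`, induced by the augmentation. -/
def augTensor : AbM S ⊗[ℤ] MonoidAlgebra ℤ F →ₗ[ℤ] AbM S :=
  (TensorProduct.rid ℤ (AbM S)).toLinearMap ∘ₗ (eps F).toLinearMap.lTensor (AbM S)

@[simp] theorem augTensor_tmul (m : AbM S) (a : MonoidAlgebra ℤ F) :
    augTensor S (m ⊗ₜ a) = eps F a • m := rfl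

theorem augTensor_rmul (a : MonoidAlgebra ℤ F) (v : AbM S ⊗[ℤ] MonoidAlgebra ℤ F) :
    augTensor S (rmul _ a v) = eps F a • augTensor S v := by
  induction v with
  | zero => simp
  | tmul m x => simp [mul_comm, mul_smul]
  | add x y hx hy => rw [map_add, map_add, hx, hy, map_add, smul_add]

theorem closure_range_of (G : Type u) [Group G] [IsFreeGroup G] :
    Subgroup.closure (Set.range (IsFreeGroup.of : IsFreeGroup.Generators G → G)) = ⊤ := by
  have : Set.range (IsFreeGroup.of : IsFreeGroup.Generators G → G) =
      (IsFreeGroup.mulEquiv G).toMonoidHom '' Set.range FreeGroup.of := by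
    rw [← Set.range_comp]; rfl
  rw [this, ← MonoidHom.map_closure, FreeGroup.closure_range_of, ← MonoidHom.range_eq_map]
  exact MonoidHom.range_eq_top.2 (IsFreeGroup.mulEquiv G).surjective

variable [IsFreeGroup S]

open IsFreeGroup (Generators)

/-- The abelianization of `S` is free abelian on the free generators of `S`. -/
def freeAbEquiv : FreeAbelianGroup (Generators S) ≃+ AbM S :=
  MulEquiv.toAdditive (MulEquiv.abelianizationCongr (IsFreeGroup.mulEquiv S))

/-- The basis of the abelianization given by the free generators. -/
def genBasis : Module.Basis (Generators S) ℤ (AbM S) :=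
  (FreeAbelianGroup.basis (Generators S)).map
    (freeAbEquiv S).toIntLinearEquiv

theorem genBasis_apply (i : Generators S) : genBasis S i = cls S (IsFreeGroup.of i) := by
  have : FreeAbelianGroup.basis (Generators S) i = FreeAbelianGroup.of i := by
    simp [FreeAbelianGroup.basis]
  rw [genBasis, Module.Basis.map_apply, this]
  rfl

instance : Module.Free ℤ (AbM S) := Module.Free.of_basis (genBasis S)

/-- The affine action of `S` on `S_ab ⊗ ℤ[F]` that encodes the Fox derivative. -/
def foxAct : S →* Equiv.Perm (AbM S ⊗[ℤ] MonoidAlgebra ℤ F) :=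
  -- A crossed homomorphism is not directly an instance of the universal property of a free group,
  -- but an action by affine permutations is; its translation part yields the cocycle.
  IsFreeGroup.lift fun i =>
    { toFun := fun v => rmul _ ⟪((IsFreeGroup.of i : S) : F)⁻¹⟫ (v + genBasis S i ⊗ₜ 1)
      invFun := fun v => rmul _ ⟪((IsFreeGroup.of i : S) : F)⟫ v - genBasis S i ⊗ₜ 1
      left_inv := fun v => by beta_reduce; rw [rmul_of_inv_of, add_sub_cancel_right]
      right_inv := fun v => by beta_reduce; rw [sub_add_cancel, rmul_of_of_inv] }

/-- The linear part of the action of u is right multiplication by u⁻¹ (inverse because permutations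
act on the left), so u is recorded by the value at 0. -/
theorem foxAct_apply (u : S) (v : AbM S ⊗[ℤ] MonoidAlgebra ℤ F) :
    foxAct S u v = rmul _ ⟪(u : F)⁻¹⟫ v + foxAct S u 0 := by
  have hu : u ∈ Subgroup.closure (Set.range (IsFreeGroup.of : Generators S → S)) := by
    rw [closure_range_of]; trivial
  induction hu using Subgroup.closure_induction generalizing v with
  | mem x hx =>
    obtain ⟨i, rfl⟩ := hx
    rw [foxAct, IsFreeGroup.lift_of]
    simp [-MonoidAlgebra.of_apply]
  | one => rw [map_one, Subgroup.coe_one, inv_one, map_one, rmul_one]; simp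
  | mul x y _ _ hx hy =>
    rw [map_mul, Equiv.Perm.mul_apply, Equiv.Perm.mul_apply, hy v, hx, hx (foxAct S y 0),
      map_add, Subgroup.coe_mul, mul_inv_rev, map_mul, rmul_mul, add_assoc]
  | inv x _ hx =>
    have key : ∀ v, foxAct S x⁻¹ v = rmul _ ⟪(x : F)⟫ (v - foxAct S x 0) := fun v => by
      rw [map_inv, Equiv.Perm.inv_eq_iff_eq, hx, rmul_of_of_inv, sub_add_cancel]
    rw [key, key 0, Subgroup.coe_inv, inv_inv, zero_sub, map_neg, map_sub, sub_eq_add_neg]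

/-- The Fox derivative on `S`: the crossed homomorphism `S → S_ab ⊗ ℤ[F]` that sends each free
generator `y` to `y ⊗ 1`. -/
def foxCross (u : S) : AbM S ⊗[ℤ] MonoidAlgebra ℤ F := rmul _ ⟪(u : F)⟫ (foxAct S u 0)

theorem foxCross_mul (u v : S) :
    foxCross S (u * v) = rmul _ ⟪(v : F)⟫ (foxCross S u) + foxCross S v := by
  rw [foxCross, map_mul, Equiv.Perm.mul_apply, foxAct_apply, map_add, Subgroup.coe_mul, map_mul,
    rmul_mul, rmul_mul, rmul_of_inv_of, foxCross, foxCross, add_comm]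

theorem foxCross_of (i : Generators S) : foxCross S (IsFreeGroup.of i) = genBasis S i ⊗ₜ 1 := by
  rw [foxCross, foxAct, IsFreeGroup.lift_of]
  change rmul (AbM S) ⟪_⟫ (rmul (AbM S) ⟪_⟫ (0 + genBasis S i ⊗ₜ 1)) = _
  rw [rmul_of_inv_of, zero_add]

@[simp] theorem foxCross_one : foxCross S 1 = 0 := by
  have := foxCross_mul S 1 1
  rw [mul_one, Subgroup.coe_one, map_one, rmul_one] at this
  exact left_eq_add.1 this

theorem foxCross_inv (u : S) : foxCross S u⁻¹ = -rmul _ ⟪(u : F)⁻¹⟫ (foxCross S u) := by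
  have := foxCross_mul S u u⁻¹
  rw [mul_inv_cancel, foxCross_one, Subgroup.coe_inv] at this
  exact (neg_eq_of_add_eq_zero_right this.symm).symm

theorem foxCross_induction {P : S → Prop} (u : S) (gen : ∀ i, P (IsFreeGroup.of i)) (one : P 1)
    (mul : ∀ x y, P x → P y → P (x * y)) (inv : ∀ x, P x → P x⁻¹) : P u := by
  have hu : u ∈ Subgroup.closure (Set.range (IsFreeGroup.of : Generators S → S)) := by
    rw [closure_range_of]; trivial
  induction hu using Subgroup.closure_induction with
  | mem x hx => obtain ⟨i, rfl⟩ := hx; exact gen i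
  | one => exact one
  | mul x y _ _ hx hy => exact mul x y hx hy
  | inv x _ hx => exact inv x hx

/-- The crossed homomorphism `foxCross S` takes its values in `S_ab ⊗ ℤ[S]`. -/
theorem foxCross_mem (u : S) :
    foxCross S u ∈ tensR (AbM S) (subRing S).toAddSubgroup := by
  have hr : ∀ (v : S) {t : AbM S ⊗[ℤ] MonoidAlgebra ℤ F},
      t ∈ tensR (AbM S) (subRing S).toAddSubgroup →
      rmul _ ⟪(v : F)⟫ t ∈ tensR (AbM S) (subRing S).toAddSubgroup := fun v t ht => by
    induction ht using AddSubgroup.closure_induction with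
    | mem x hx =>
      obtain ⟨m, a, ha, rfl⟩ := hx
      exact AddSubgroup.subset_closure ⟨m, _, subRing_mul_of ha v.2, rfl⟩
    | zero => simp
    | add x y _ _ hx hy => rw [map_add]; exact add_mem hx hy
    | neg x _ hx => rw [map_neg]; exact neg_mem hx
  induction u using foxCross_induction with
  | gen i =>
    rw [foxCross_of]
    refine AddSubgroup.subset_closure ⟨_, 1, ?_, rfl⟩
    rw [← map_one (MonoidAlgebra.of ℤ F)]
    exact of_mem_subRing S.one_mem
  | one => rw [foxCross_one]; exact zero_mem _
  | mul x y hx hy => rw [foxCross_mul]; exact add_mem (hr y hx) hy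
  | inv x hx => rw [foxCross_inv]; exact neg_mem (hr x⁻¹ hx)

theorem augTensor_foxCross (u : S) : augTensor S (foxCross S u) = cls S u := by
  induction u using foxCross_induction with
  | gen i => rw [foxCross_of, augTensor_tmul, map_one, one_smul, genBasis_apply]
  | one => simp
  | mul x y hx hy => rw [foxCross_mul, map_add, augTensor_rmul, hx, hy, eps_of, one_smul, cls_mul]
  | inv x hx => rw [foxCross_inv, map_neg, augTensor_rmul, hx, eps_of, one_smul, cls_inv]

/-- The Fox derivative `ℤ[F] → S_ab ⊗ ℤ[F]`, with `(u - 1) a ↦ d(u) a` for `u ∈ S`. -/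
def foxD : MonoidAlgebra ℤ F →ₗ[ℤ] AbM S ⊗[ℤ] MonoidAlgebra ℤ F :=
  linExt fun g => rmul _ ⟪(exists_cosetRep S).choose g⟫
    (foxCross S ((exists_cosetRep S).choose_spec.choose g))

/-- For a = g, the elements ug and g have the same representative q(g), while r(ug) = u r(g). The
product rule then leaves d(u) r(g) q(g) = d(u) g. -/
theorem foxD_mul (u : S) (a : MonoidAlgebra ℤ F) :
    foxD S ((⟪(u : F)⟫ - 1) * a) = rmul _ a (foxCross S u) := by
  induction a using groupRing_induction with
  | of g =>
    obtain ⟨h1, h2, h3⟩ := (exists_cosetRep S).choose_spec.choose_spec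
    rw [sub_mul, one_mul, ← map_mul, map_sub, foxD, linExt_of, linExt_of, h2, h3, foxCross_mul,
      map_add, add_sub_cancel_right, ← rmul_mul, ← map_mul, h1]
  | add x y hx hy => rw [mul_add, map_add, hx, hy, map_add, LinearMap.add_apply]
  | smul n x hx => rw [mul_smul_comm, map_smul, hx, map_smul, LinearMap.smul_apply]

theorem foxD_sub_one (u : S) : foxD S (⟪(u : F)⟫ - 1) = foxCross S u := by
  have := foxD_mul S u 1
  rwa [mul_one, rmul_one] at this

/-- The coefficients of d(u) lie in ℤ[S], and an S-invariant `l` sees them only through their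
augmentations; augmenting d(u) gives the class of u. All higher total derivatives are evaluated
through this lemma. -/
theorem lTensor_foxD {V : Type*} [AddCommGroup V] (l : MonoidAlgebra ℤ F →ₗ[ℤ] V)
    {a : MonoidAlgebra ℤ F} (ha : ∀ v ∈ S, l (⟪v⟫ * a) = l a) (u : S) :
    l.lTensor (AbM S) (foxD S ((⟪(u : F)⟫ - 1) * a)) = cls S u ⊗ₜ l a := by
  have h1 : ∀ b ∈ subRing S, l (b * a) = eps F b • l a := fun b hb => by
    induction hb using Submodule.span_induction with
    | mem x hx => obtain ⟨v, hv, rfl⟩ := hx; rw [ha v hv, eps_of, one_smul]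
    | zero => simp
    | add x y _ _ hx hy => rw [add_mul, map_add, hx, hy, map_add, add_smul]
    | smul c x _ hx => rw [smul_mul_assoc, map_smul, hx, map_smul, smul_assoc]
  have h2 : ∀ t ∈ tensR (AbM S) (subRing S).toAddSubgroup,
      l.lTensor (AbM S) (rmul _ a t) = augTensor S t ⊗ₜ l a := fun t ht => by
    induction ht using AddSubgroup.closure_induction with
    | mem x hx =>
      obtain ⟨m, b, hb, rfl⟩ := hx
      rw [rmul_tmul, LinearMap.lTensor_tmul, h1 b hb, augTensor_tmul, TensorProduct.smul_tmul]
    | zero => simp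
    | add x y _ _ hx hy => rw [map_add, map_add, hx, hy, map_add, add_tmul]
    | neg x _ hx => rw [map_neg, map_neg, hx, map_neg, neg_tmul]
  rw [foxD_mul, h2 _ (foxCross_mem S u), augTensor_foxCross]

/-- The total first derivative `ℤ[F] → S_ab`, with `(u - 1) a ↦ ε(a) u`. -/
def foxDer1 : MonoidAlgebra ℤ F →ₗ[ℤ] AbM S := augTensor S ∘ₗ foxD S

theorem foxDer1_mul (u : S) (a : MonoidAlgebra ℤ F) :
    foxDer1 S ((⟪(u : F)⟫ - 1) * a) = eps F a • cls S u := by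
  rw [foxDer1, LinearMap.comp_apply, foxD_mul, augTensor_rmul, augTensor_foxCross]

theorem foxDer1_sub_one (u : S) : foxDer1 S (⟪(u : F)⟫ - 1) = cls S u := by
  have := foxDer1_mul S u 1
  rwa [mul_one, map_one, one_smul] at this

theorem foxDer1_of_mul {a : MonoidAlgebra ℤ F} (ha : eps F a = 0) {v : F} (hv : v ∈ S) :
    foxDer1 S (⟪v⟫ * a) = foxDer1 S a := by
  have := foxDer1_mul S ⟨v, hv⟩ a
  rwa [ha, zero_smul, sub_mul, one_mul, map_sub, sub_eq_zero] at this

/-- The total second derivative `ℤ[F] → S_ab ⊗ S_ab`, with `(u - 1) (v - 1) ↦ u ⊗ v`. -/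
def foxDer2 : MonoidAlgebra ℤ F →ₗ[ℤ] AbM S ⊗[ℤ] AbM S :=
  (foxDer1 S).lTensor (AbM S) ∘ₗ foxD S

theorem foxDer2_mul (u : S) {a : MonoidAlgebra ℤ F} (ha : eps F a = 0) :
    foxDer2 S ((⟪(u : F)⟫ - 1) * a) = cls S u ⊗ₜ foxDer1 S a :=
  lTensor_foxD S _ (fun _ hv => foxDer1_of_mul S ha hv) u

theorem foxDer2_mul_sub_one (u v : S) :
    foxDer2 S ((⟪(u : F)⟫ - 1) * (⟪(v : F)⟫ - 1)) = cls S u ⊗ₜ cls S v := by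
  rw [foxDer2_mul S u (eps_sub_one _), foxDer1_sub_one]

/-- The total third derivative, with values in `S_ab ⊗ (N ⊗ N)` for a quotient `N` of `S_ab`. -/
def foxDer3 {N : Type u} [AddCommGroup N] (p : AbM S →ₗ[ℤ] N) :
    MonoidAlgebra ℤ F →ₗ[ℤ] AbM S ⊗[ℤ] (N ⊗[ℤ] N) :=
  (TensorProduct.map p p ∘ₗ foxDer2 S).lTensor (AbM S) ∘ₗ foxD S

theorem foxDer3_mul {N : Type u} [AddCommGroup N] (p : AbM S →ₗ[ℤ] N) (u : S)
    {a : MonoidAlgebra ℤ F}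
    (ha : ∀ v ∈ S, TensorProduct.map p p (foxDer2 S (⟪v⟫ * a)) =
      TensorProduct.map p p (foxDer2 S a)) :
    foxDer3 S p ((⟪(u : F)⟫ - 1) * a) = cls S u ⊗ₜ TensorProduct.map p p (foxDer2 S a) :=
  lTensor_foxD S (TensorProduct.map p p ∘ₗ foxDer2 S) ha u

end Fox

/-! ### Left inverses for low degree Lie elements in tensor powers -/

section LieElements

variable {M Z : Type*} [AddCommGroup M] [AddCommGroup Z]

/-- For free M the map Λ²(M) → M ⊗ M is split: `ψ` keeps the basis tensors above the diagonal and
kills the others. -/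
theorem exists_tensor_of_alternating [Module.Free ℤ M] (T : M →ₗ[ℤ] M →ₗ[ℤ] Z)
    (alt : ∀ x, T x x = 0) :
    ∃ ψ : M ⊗[ℤ] M →ₗ[ℤ] Z, ∀ x y, ψ (x ⊗ₜ y - y ⊗ₜ x) = T x y := by
  classical
  obtain ⟨_, -⟩ := exists_wellFoundedLT (Module.Free.ChooseBasisIndex ℤ M)
  let e : Module.Basis (Module.Free.ChooseBasisIndex ℤ M) ℤ M := Module.Free.chooseBasis ℤ M
  have anti (x y : M) : T x y = -T y x := by
    have := alt (x + y)
    simp only [map_add, LinearMap.add_apply, alt, zero_add, add_zero] at this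
    rw [add_comm] at this
    exact eq_neg_of_add_eq_zero_left this
  let ψ : M ⊗[ℤ] M →ₗ[ℤ] Z := (e.tensorProduct e).constr ℤ
    fun p => if p.1 < p.2 then T (e p.1) (e p.2) else 0
  have hψ (i j) : ψ (e i ⊗ₜ e j) = if i < j then T (e i) (e j) else 0 := by
    rw [← Module.Basis.tensorProduct_apply]
    exact Module.Basis.constr_basis _ _ _ _
  have key : TensorProduct.curry ψ - (TensorProduct.curry ψ).flip = T := by
    refine e.ext fun i => e.ext fun j => ?_
    change ψ (e i ⊗ₜ e j) - ψ (e j ⊗ₜ e i) = _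
    rw [hψ, hψ]
    rcases lt_trichotomy i j with h | h | h
    · simp [h, h.not_gt]
    · subst h; simp [alt]
    · simp [h, h.not_gt, anti (e i) (e j)]
  refine ⟨ψ, fun x y => ?_⟩
  rw [map_sub, ← key]
  rfl

theorem eq_zero_of_basis {ι : Type*} (e : Module.Basis ι ℤ M) (f : M → Z)
    (add : ∀ x y, f (x + y) = f x + f y) (h : ∀ i, f (e i) = 0) (x : M) : f x = 0 := by
  have : (AddMonoidHom.mk' f add).toIntLinearMap = 0 := e.ext fun i => h i
  exact LinearMap.congr_fun this x

/-- The image of `[[x, y], z]` in the third tensor power, projected in the last two factors. -/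
def lieTensor {C : Type*} [AddCommGroup C] (p : M →ₗ[ℤ] C) (x y z : M) : M ⊗[ℤ] (C ⊗[ℤ] C) :=
  x ⊗ₜ (p y ⊗ₜ p z) - y ⊗ₜ (p x ⊗ₜ p z) - z ⊗ₜ (p x ⊗ₜ p y) + z ⊗ₜ (p y ⊗ₜ p x)

section

variable {C : Type*} [AddCommGroup C] (p : M →ₗ[ℤ] C)

theorem lieTensor_add_left (x x' y z : M) :
    lieTensor p (x + x') y z = lieTensor p x y z + lieTensor p x' y z := by
  simp only [lieTensor, map_add, add_tmul, tmul_add]; abel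

theorem lieTensor_add_mid (x y y' z : M) :
    lieTensor p x (y + y') z = lieTensor p x y z + lieTensor p x y' z := by
  simp only [lieTensor, map_add, add_tmul, tmul_add]; abel

theorem lieTensor_add_right (x y z z' : M) :
    lieTensor p x y (z + z') = lieTensor p x y z + lieTensor p x y z' := by
  simp only [lieTensor, map_add, add_tmul, tmul_add]; abel

end

/-- The coefficients of the retraction onto the Hall basis in degree three. -/
def hallCoeff {ι : Type*} [LinearOrder ι] (t : ι → ι → ι → Z) (p q r : ι) : Z :=
  -- The basic commutators are [[q,p],r] with q > p ≤ r. If p < r, it is read off from the monomial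
  -- p ⊗ q ⊗ r, where it has coefficient -1. For r = p that coefficient is -2, so the monomial q ⊗ p
  -- ⊗ p, with coefficient 1, is used instead; this is the second clause, with the letters renamed.
  if p < q ∧ p < r then -t q p r else if q = r ∧ r < p then t p q r else 0

/-- A Hall basis computation: the free Lie ring in degree three embeds in the tensor power. -/
theorem hallCoeff_identity {ι : Type*} [LinearOrder ι] (t : ι → ι → ι → Z)
    (alt : ∀ i k, t i i k = 0) (anti : ∀ i j k, t i j k = -t j i k)
    (jac : ∀ i j k, t i j k + t j k i + t k i j = 0) (i j k : ι) :
    hallCoeff t i j k - hallCoeff t j i k - hallCoeff t k i j + hallCoeff t k j i = t i j k := by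
  have h1 := jac i j k
  have h2 := anti i j k
  have h3 := anti j k i
  have h4 := anti k i j
  have a1 := alt i k
  have a2 := alt j i
  have a3 := alt k i
  have a4 := alt i j
  clear anti jac alt
  unfold hallCoeff
  rcases lt_trichotomy i j with h | h | h
  · rcases lt_trichotomy j k with h' | h' | h' <;> grind
  · subst h
    rcases lt_trichotomy i k with h' | h' | h' <;> grind
  · rcases lt_trichotomy j k with h' | h' | h' <;> grind

theorem exists_tensor_of_lie_basis {C : Type*} [AddCommGroup C] [Module.Free ℤ C]
    (T : C →ₗ[ℤ] C →ₗ[ℤ] C →ₗ[ℤ] Z) (alt : ∀ x z, T x x z = 0)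
    (anti : ∀ x y z, T x y z = -T y x z) (jac : ∀ x y z, T x y z + T y z x + T z x y = 0) :
    ∃ ψ : C ⊗[ℤ] (C ⊗[ℤ] C) →ₗ[ℤ] Z, ∀ x y z, ψ (lieTensor LinearMap.id x y z) = T x y z := by
  obtain ⟨_, -⟩ := exists_wellFoundedLT (Module.Free.ChooseBasisIndex ℤ C)
  let e : Module.Basis (Module.Free.ChooseBasisIndex ℤ C) ℤ C := Module.Free.chooseBasis ℤ C
  let w := hallCoeff fun i j k => T (e i) (e j) (e k)
  have hw := hallCoeff_identity (fun i j k => T (e i) (e j) (e k)) (fun i k => alt _ _)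
    (fun i j k => anti _ _ _) (fun i j k => jac _ _ _)
  let ψ : C ⊗[ℤ] (C ⊗[ℤ] C) →ₗ[ℤ] Z := (e.tensorProduct (e.tensorProduct e)).constr ℤ
    fun p => w p.1 p.2.1 p.2.2
  have hψ (i j k) : ψ (e i ⊗ₜ (e j ⊗ₜ e k)) = w i j k := by
    have h := (e.tensorProduct (e.tensorProduct e)).constr_basis ℤ
      (fun p => w p.1 p.2.1 p.2.2) (i, j, k)
    rwa [Module.Basis.tensorProduct_apply', Module.Basis.tensorProduct_apply'] at h
  refine ⟨ψ, fun x y z => sub_eq_zero.1 ?_⟩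
  clear_value ψ
  refine eq_zero_of_basis e (fun x => ψ (lieTensor LinearMap.id x y z) - T x y z)
    (fun x x' => ?_) (fun i => ?_) x
  · simp only [lieTensor_add_left, map_add, LinearMap.add_apply]; abel
  refine eq_zero_of_basis e (fun y => ψ (lieTensor LinearMap.id (e i) y z) - T (e i) y z)
    (fun x x' => ?_) (fun j => ?_) y
  · simp only [lieTensor_add_mid, map_add, LinearMap.add_apply]; abel
  refine eq_zero_of_basis e (fun z => ψ (lieTensor LinearMap.id (e i) (e j) z) -
    T (e i) (e j) z) (fun x x' => ?_) (fun k => ?_) z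
  · simp only [lieTensor_add_right, map_add]; abel
  simp only [lieTensor, LinearMap.id_apply, map_add, map_sub, hψ]
  exact sub_eq_zero.2 (hw i j k)

/-- Split M = ker p ⊕ s(C). With the symmetries of `T`, `van` kills every value with two arguments
in ker p. What remains is a part on C, treated by the Hall basis, and parts with exactly one kernel
argument, which the first tensor factor records without loss. -/
theorem exists_tensor_of_lie {C : Type*} [AddCommGroup C] [Module.Free ℤ C] (p : M →ₗ[ℤ] C)
    (hp : Function.Surjective p) (T : M →ₗ[ℤ] M →ₗ[ℤ] M →ₗ[ℤ] Z) (alt : ∀ x z, T x x z = 0)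
    (jac : ∀ x y z, T x y z + T y z x + T z x y = 0)
    (van : ∀ x y z, p x = 0 → p z = 0 → T x y z = 0) :
    ∃ ψ : M ⊗[ℤ] (C ⊗[ℤ] C) →ₗ[ℤ] Z, ∀ x y z, ψ (lieTensor p x y z) = T x y z := by
  obtain ⟨s, hs⟩ := Module.projective_lifting_property p LinearMap.id hp
  replace hs (c : C) : p (s c) = c := LinearMap.congr_fun hs c
  have anti (x y z : M) : T x y z = -T y x z := by
    have := alt (x + y) z
    simp only [map_add, LinearMap.add_apply, alt, zero_add, add_zero] at this
    rw [add_comm] at this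
    exact eq_neg_of_add_eq_zero_left this
  let T' : C →ₗ[ℤ] C →ₗ[ℤ] C →ₗ[ℤ] Z :=
    { toFun := fun x => (T (s x)).compl₁₂ s s
      map_add' := fun x x' => by ext; simp
      map_smul' := fun n x => by ext; simp }
  obtain ⟨ψ₀, key₀⟩ := exists_tensor_of_lie_basis T' (fun x z => alt _ _) (fun x y z => anti _ _ _)
    (fun x y z => jac _ _ _)
  let L : M →ₗ[ℤ] (C ⊗[ℤ] C →ₗ[ℤ] Z) :=
    { toFun := fun m => TensorProduct.lift ((T m).compl₁₂ s s)
      map_add' := fun m m' => TensorProduct.ext' fun c c' => by simp; rfl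
      map_smul' := fun n m => TensorProduct.ext' fun c c' => by simp; rfl }
  let ψ : M ⊗[ℤ] (C ⊗[ℤ] C) →ₗ[ℤ] Z :=
    TensorProduct.lift (L ∘ₗ (LinearMap.id - s ∘ₗ p)) + ψ₀ ∘ₗ p.rTensor _
  have hψ (m : M) (c c' : C) : ψ (m ⊗ₜ (c ⊗ₜ c')) =
      T (m - s (p m)) (s c) (s c') + ψ₀ (p m ⊗ₜ (c ⊗ₜ c')) := rfl
  refine ⟨ψ, fun x y z => ?_⟩
  have h0 := key₀ (p x) (p y) (p z)
  simp only [lieTensor, LinearMap.id_apply, map_add, map_sub] at h0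
  simp only [lieTensor, map_add, map_sub]
  simp only [hψ]
  have ker (m : M) : p (m - s (p m)) = 0 := by rw [map_sub, hs, sub_self]
  obtain ⟨a, X, ha, hx, hX⟩ : ∃ a X, p a = 0 ∧ x = a + X ∧ X = s (p x) :=
    ⟨x - s (p x), s (p x), ker x, by abel, rfl⟩
  obtain ⟨b, Y, hb, hy, hY⟩ : ∃ a X, p a = 0 ∧ y = a + X ∧ X = s (p y) :=
    ⟨y - s (p y), s (p y), ker y, by abel, rfl⟩
  obtain ⟨c, W, hc, hz, hW⟩ : ∃ a X, p a = 0 ∧ z = a + X ∧ X = s (p z) :=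
    ⟨z - s (p z), s (p z), ker z, by abel, rfl⟩
  have ea : x - s (p x) = a := by rw [← hX, hx]; abel
  have eb : y - s (p y) = b := by rw [← hY, hy]; abel
  have ec : z - s (p z) = c := by rw [← hW, hz]; abel
  -- Here `a`, `b`, `c` are the kernel components and `X`, `Y`, `W` the components from C.
  have e1 : T x y z = T X Y W + T a Y W + T X b W + T X Y c := by
    have v2 (u v w : M) (hv : p v = 0) (hw : p w = 0) : T u v w = 0 := by
      rw [anti, van v u w hv hw, neg_zero]
    have v3 (u v w : M) (hu : p u = 0) (hv : p v = 0) : T u v w = 0 := by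
      have := jac u v w
      rwa [v2 w u v hu hv, van v w u hv hu, add_zero, add_zero] at this
    rw [hx, hy, hz]
    simp only [map_add, LinearMap.add_apply]
    rw [v3 a b c ha hb, v3 a b W ha hb, van a Y c ha hc, v2 X b c hb hc]
    abel
  rw [ea, eb, ec, ← hX, ← hY, ← hW, e1]
  -- The Jacobi identity moves the kernel argument from the last slot to the first, where `ψ` can
  -- read it.
  have h1 : T X Y c = T c Y X - T c X Y := by
    have h2 := jac X Y c
    rw [anti Y c X] at h2
    rw [← sub_eq_zero, ← h2]; abel
  have h3 : T X Y W = T' (p x) (p y) (p z) := by rw [hX, hY, hW]; rfl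
  rw [h1, anti X b W, h3, ← h0]
  abel

end LieElements

/-! ### Commutators in groups of small nilpotency class -/

section Commutators

attribute [local instance] commutatorElement

variable {E : Type*} [Group E]

theorem commutator_mul_left_of_central {x x' z : E} (h : ⁅x', z⁆ ∈ Subgroup.center E) :
    ⁅x * x', z⁆ = ⁅x, z⁆ * ⁅x', z⁆ := by
  have h1 : ⁅x * x', z⁆ = x * ⁅x', z⁆ * x⁻¹ * ⁅x, z⁆ := by simp [commutatorElement_def, mul_assoc]
  rw [h1, (Subgroup.mem_center_iff.1 h x), mul_inv_cancel_right,
    (Subgroup.mem_center_iff.1 h ⁅x, z⁆)]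

theorem commutator_mul_right_of_central {x z z' : E} (h : ⁅x, z'⁆ ∈ Subgroup.center E) :
    ⁅x, z * z'⁆ = ⁅x, z⁆ * ⁅x, z'⁆ := by
  have h1 : ⁅x, z * z'⁆ = ⁅x, z⁆ * (z * ⁅x, z'⁆ * z⁻¹) := by
    simp [commutatorElement_def, mul_assoc]
  rw [h1, (Subgroup.mem_center_iff.1 h z), mul_inv_cancel_right]

theorem commutator_inv_left_of_central {x z : E} (h : ⁅x, z⁆ ∈ Subgroup.center E) :
    ⁅x⁻¹, z⁆ = ⁅x, z⁆⁻¹ := by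
  have h1 : ⁅x⁻¹, z⁆ = x⁻¹ * ⁅x, z⁆⁻¹ * x := by simp [commutatorElement_def, mul_assoc]
  have h2 := Subgroup.mem_center_iff.1 (inv_mem h) x⁻¹
  rw [h1, h2, inv_mul_cancel_right]

theorem commutator_central_mul_left {c x z : E} (h : c ∈ Subgroup.center E) :
    ⁅c * x, z⁆ = ⁅x, z⁆ := by
  have h1 : ⁅c * x, z⁆ = c * (x * z * x⁻¹) * c⁻¹ * z⁻¹ := by
    simp [commutatorElement_def, mul_assoc]
  rw [h1, ← Subgroup.mem_center_iff.1 h, mul_inv_cancel_right, commutatorElement_def]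

theorem triple_mul_right (h3 : ∀ x y z : E, ⁅⁅x, y⁆, z⁆ ∈ Subgroup.center E)
    (x y z z' : E) : ⁅⁅x, y⁆, z * z'⁆ = ⁅⁅x, y⁆, z⁆ * ⁅⁅x, y⁆, z'⁆ :=
  commutator_mul_right_of_central (h3 _ _ _)

/-- Expanding [xx',y] produces [x',y] conjugated by x; the conjugation costs a triple commutator,
which is central and disappears in the outer bracket. -/
theorem triple_mul_left (h3 : ∀ x y z : E, ⁅⁅x, y⁆, z⁆ ∈ Subgroup.center E)
    (x x' y z : E) : ⁅⁅x * x', y⁆, z⁆ = ⁅⁅x, y⁆, z⁆ * ⁅⁅x', y⁆, z⁆ := by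
  have h1 : ⁅x * x', y⁆ = ⁅⁅x', y⁆, x⁆⁻¹ * (⁅x', y⁆ * ⁅x, y⁆) := by
    simp [commutatorElement_def, mul_assoc]
  rw [h1, commutator_central_mul_left (inv_mem (h3 _ _ _)),
    commutator_mul_left_of_central (h3 _ _ _), Subgroup.mem_center_iff.1 (h3 x y z)]

theorem triple_swap (h3 : ∀ x y z : E, ⁅⁅x, y⁆, z⁆ ∈ Subgroup.center E)
    (x y z : E) : ⁅⁅y, x⁆, z⁆ = ⁅⁅x, y⁆, z⁆⁻¹ := by
  rw [← commutatorElement_inv x y, commutator_inv_left_of_central (h3 _ _ _)]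

theorem triple_mul_mid (h3 : ∀ x y z : E, ⁅⁅x, y⁆, z⁆ ∈ Subgroup.center E)
    (x y y' z : E) : ⁅⁅x, y * y'⁆, z⁆ = ⁅⁅x, y⁆, z⁆ * ⁅⁅x, y'⁆, z⁆ := by
  rw [triple_swap h3, triple_mul_left h3, mul_inv_rev, ← triple_swap h3, ← triple_swap h3,
    Subgroup.mem_center_iff.1 (h3 x y z)]

theorem triple_inv_left (h3 : ∀ x y z : E, ⁅⁅x, y⁆, z⁆ ∈ Subgroup.center E)
    (x y z : E) : ⁅⁅x⁻¹, y⁆, z⁆ = ⁅⁅x, y⁆, z⁆⁻¹ := by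
  rw [eq_inv_iff_mul_eq_one, ← triple_mul_left h3, inv_mul_cancel]; simp

theorem triple_inv_right (h3 : ∀ x y z : E, ⁅⁅x, y⁆, z⁆ ∈ Subgroup.center E)
    (x y z : E) : ⁅⁅x, y⁆, z⁻¹⁆ = ⁅⁅x, y⁆, z⁆⁻¹ := by
  rw [eq_inv_iff_mul_eq_one, ← triple_mul_right h3, inv_mul_cancel]; simp

theorem triple_jacobi (h3 : ∀ x y z : E, ⁅⁅x, y⁆, z⁆ ∈ Subgroup.center E)
    (x y z : E) : ⁅⁅x, y⁆, z⁆ * ⁅⁅y, z⁆, x⁆ * ⁅⁅z, x⁆, y⁆ = 1 := by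
  -- A form of the Hall–Witt identity. Triple commutators being central, the conjugations drop out
  -- and the inner inverses become signs.
  have h1 : x * z * ⁅⁅z⁻¹, x⁻¹⁆, y⁆ * z⁻¹ * y * ⁅⁅y⁻¹, z⁆, x⁻¹⁆ * y⁻¹ * x⁻¹ = ⁅⁅x, y⁆, z⁆⁻¹ := by
    simp [commutatorElement_def, mul_assoc]
  rw [Subgroup.mem_center_iff.1 (h3 z⁻¹ x⁻¹ y), triple_inv_left h3, triple_swap h3 x⁻¹,
    triple_inv_left h3, triple_swap h3 z, inv_inv, inv_inv, triple_inv_left h3 y,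
    triple_inv_right h3, inv_inv] at h1
  have h2 : ⁅⁅z, x⁆, y⁆ * ⁅⁅y, z⁆, x⁆ = ⁅⁅x, y⁆, z⁆⁻¹ := by
    rw [← h1]
    have e1 := Subgroup.mem_center_iff.1 (h3 y z x) y
    rw [← mul_assoc, mul_inv_cancel_right, mul_assoc _ y, e1]
    simp only [mul_assoc, mul_inv_cancel_left]
    have e2 := Subgroup.mem_center_iff.1 (h3 y z x) x
    rw [← mul_assoc x, e2, mul_inv_cancel_right]
  rw [mul_assoc, Subgroup.mem_center_iff.1 (h3 z x y), h2, mul_inv_cancel]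

end Commutators

/-! ### Commutators as multilinear maps on the abelianization -/

section AbLift

attribute [local instance] commutatorElement

variable {F : Type u} [Group F] (S : Subgroup F) {V : Type*} [AddCommGroup V]

instance centerCommGroup (E : Type*) [Group E] : CommGroup (Subgroup.center E) where
  mul_comm a b := Subtype.ext (Subgroup.mem_center_iff.1 b.2 a)

/-- The linear map on the abelianization induced by an additive function on the group. -/
def abLift (f : S → V) (hf : ∀ x y, f (x * y) = f x + f y) : AbM S →ₗ[ℤ] V :=
  (MonoidHom.toAdditiveLeft (Abelianization.lift
    (MonoidHom.mk' (fun x => Multiplicative.ofAdd (f x)) fun x y => by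
      rw [hf, ofAdd_add]))).toIntLinearMap

theorem abM_hom_ext {f g : AbM S →ₗ[ℤ] V} (h : ∀ x, f (cls S x) = g (cls S x)) : f = g :=
  LinearMap.ext fun m => by
    obtain ⟨x, rfl⟩ := cls_surjective S m
    exact h x

variable {E : Type*} [Group E] (π : S →* E)

theorem exists_bilin_commutator (h2 : ∀ x y : E, ⁅x, y⁆ ∈ Subgroup.center E) :
    ∃ T : AbM S →ₗ[ℤ] AbM S →ₗ[ℤ] Additive (Subgroup.center E),
      ∀ x y, T (cls S x) (cls S y) = Additive.ofMul ⟨⁅π x, π y⁆, h2 _ _⟩ := by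
  let f (x y : S) : Additive (Subgroup.center E) := Additive.ofMul ⟨⁅π x, π y⁆, h2 _ _⟩
  have hr (x y y' : S) : f x (y * y') = f x y + f x y' :=
    congrArg Additive.ofMul (Subtype.ext (by
      simp only [map_mul]; exact commutator_mul_right_of_central (h2 _ _)))
  have hl (x x' y : S) : f (x * x') y = f x y + f x' y :=
    congrArg Additive.ofMul (Subtype.ext (by
      simp only [map_mul]; exact commutator_mul_left_of_central (h2 _ _)))
  exact ⟨abLift S (fun x => abLift S (f x) (hr x)) fun x x' => abM_hom_ext S fun y => hl x x' y,
    fun x y => rfl⟩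

theorem exists_trilin_commutator (h3 : ∀ x y z : E, ⁅⁅x, y⁆, z⁆ ∈ Subgroup.center E) :
    ∃ T : AbM S →ₗ[ℤ] AbM S →ₗ[ℤ] AbM S →ₗ[ℤ] Additive (Subgroup.center E),
      ∀ x y z, T (cls S x) (cls S y) (cls S z) =
        Additive.ofMul ⟨⁅⁅π x, π y⁆, π z⁆, h3 _ _ _⟩ := by
  let f (x y z : S) : Additive (Subgroup.center E) :=
    Additive.ofMul ⟨⁅⁅π x, π y⁆, π z⁆, h3 _ _ _⟩
  have hr (x y z z' : S) : f x y (z * z') = f x y z + f x y z' :=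
    congrArg Additive.ofMul (Subtype.ext (by
      simp only [map_mul]; exact triple_mul_right h3 _ _ _ _))
  have hm (x y y' z : S) : f x (y * y') z = f x y z + f x y' z :=
    congrArg Additive.ofMul (Subtype.ext (by
      simp only [map_mul]; exact triple_mul_mid h3 _ _ _ _))
  have hl (x x' y z : S) : f (x * x') y z = f x y z + f x' y z :=
    congrArg Additive.ofMul (Subtype.ext (by
      simp only [map_mul]; exact triple_mul_left h3 _ _ _ _))
  exact ⟨abLift S (fun x => abLift S (fun y => abLift S (f x y) (hr x y))
    fun y y' => abM_hom_ext S fun z => hm x y y' z)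
    fun x x' => abM_hom_ext S fun y => abM_hom_ext S fun z => hl x x' y z,
    fun x y z => rfl⟩

end AbLift

/-! ### Dimension subgroups of a free subgroup in degrees two and three -/

section Dimension

attribute [local instance] commutatorElement

local notation "⟪" g "⟫" => MonoidAlgebra.of ℤ _ g

variable {F : Type u} [Group F] (S : Subgroup F)

theorem mem_center_quotient {G : Type*} [Group G] (N : Subgroup G) [N.Normal] (x : G)
    (h : ∀ y, ⁅x, y⁆ ∈ N) : (x : G ⧸ N) ∈ Subgroup.center (G ⧸ N) := by
  refine Subgroup.mem_center_iff.2 fun y => ?_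
  induction y using QuotientGroup.induction_on with | H y => ?_
  symm
  rw [← commutatorElement_eq_one_iff_mul_comm]
  exact (QuotientGroup.eq_one_iff (N := N) ⁅x, y⁆).2 (h y)

theorem cls_commutator (u v : S) : cls S ⁅u, v⁆ = 0 := by
  simp only [commutatorElement_def, cls_mul, cls_inv]; abel

theorem commutator_induction {P : S → Prop} (comm : ∀ u v : S, P ⁅u, v⁆)
    (mul : ∀ x y, cls S x = 0 → cls S y = 0 → P x → P y → P (x * y))
    (inv : ∀ x, cls S x = 0 → P x → P x⁻¹) (w : S) (hw : cls S w = 0) : P w := by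
  have h1 {x : S} : cls S x = 0 ↔ x ∈ commutator S := by
    rw [← Abelianization.ker_of]; exact Iff.rfl
  have h2 := h1.1 hw
  rw [commutator_eq_closure] at h2
  have h3 {x : S} (hx : x ∈ Subgroup.closure (commutatorSet S)) : cls S x = 0 := by
    rw [h1, commutator_eq_closure]; exact hx
  induction h2 using Subgroup.closure_induction with
  | mem x hx => obtain ⟨u, v, rfl⟩ := hx; exact comm u v
  | one => simpa using comm 1 1
  | mul x y hx hy ihx ihy => exact mul x y (h3 hx) (h3 hy) (ihx (h3 hx)) (ihy (h3 hy))
  | inv x hx ih => exact inv x (h3 hx) (ih (h3 hx))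

theorem of_mul_sub_one (g h : F) :
    ⟪g * h⟫ - 1 = (⟪g⟫ - 1) * (⟪h⟫ - 1) + (⟪g⟫ - 1) + (⟪h⟫ - 1) := by
  rw [map_mul]; noncomm_ring

theorem of_commutator_sub_one (g h : F) :
    ⟪⁅g, h⁆⟫ - 1 =
      ((⟪g⟫ - 1) * (⟪h⟫ - 1) - (⟪h⟫ - 1) * (⟪g⟫ - 1)) * ⟪(h * g)⁻¹⟫ := by
  have h1 : (⟪g⟫ - 1) * (⟪h⟫ - 1) - (⟪h⟫ - 1) * (⟪g⟫ - 1) = ⟪g * h⟫ - ⟪h * g⟫ := by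
    rw [map_mul, map_mul]; noncomm_ring
  rw [h1, sub_mul, ← map_mul, ← map_mul, mul_inv_cancel, map_one, commutatorElement_def]
  simp only [mul_inv_rev, mul_assoc]

variable {C : Type u} [AddCommGroup C] (p : AbM S →ₗ[ℤ] C)

/-- `m ⊗ m' ↦ m ⊗ (p m' ⊗ p z)`. -/
def tensorRight (z : AbM S) : AbM S ⊗[ℤ] AbM S →ₗ[ℤ] AbM S ⊗[ℤ] (C ⊗[ℤ] C) :=
  (((TensorProduct.mk ℤ C C).flip (p z)) ∘ₗ p).lTensor (AbM S)

theorem tensorRight_tmul (z m m' : AbM S) :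
    tensorRight S p z (m ⊗ₜ m') = m ⊗ₜ (p m' ⊗ₜ p z) := rfl

variable [IsFreeGroup S]

theorem foxDer2_of_mul (u v : S) : foxDer2 S (⟪((u * v : S) : F)⟫ - 1) =
    foxDer2 S (⟪(u : F)⟫ - 1) + foxDer2 S (⟪(v : F)⟫ - 1) + cls S u ⊗ₜ cls S v := by
  rw [Subgroup.coe_mul, of_mul_sub_one, map_add, map_add, foxDer2_mul_sub_one]; abel

/-- Compare the product formula on the two sides of [u,v] · vu = uv; the class of [u,v] is zero, so
no cross term appears. -/
theorem foxDer2_commutator (u v : S) : foxDer2 S (⟪((⁅u, v⁆ : S) : F)⟫ - 1) =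
    cls S u ⊗ₜ cls S v - cls S v ⊗ₜ cls S u := by
  have h1 : ⁅u, v⁆ * (v * u) = u * v := by simp [commutatorElement_def, mul_assoc]
  have h2 := foxDer2_of_mul S ⁅u, v⁆ (v * u)
  rw [h1, foxDer2_of_mul, foxDer2_of_mul, cls_commutator, zero_tmul, add_zero] at h2
  rw [← sub_eq_zero] at h2 ⊢
  rw [← neg_eq_zero, ← h2]
  abel

theorem foxDer2_inv {x : S} (hx : cls S x = 0) :
    foxDer2 S (⟪((x⁻¹ : S) : F)⟫ - 1) = -foxDer2 S (⟪(x : F)⟫ - 1) := by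
  have := foxDer2_of_mul S x x⁻¹
  rw [mul_inv_cancel, hx, zero_tmul, add_zero, Subgroup.coe_one, map_one, sub_self, map_zero] at this
  exact eq_neg_of_add_eq_zero_right this.symm

/-- `γ₂(S) ∩ (1 + Δ(S)³) ⊆ γ₃(S)`. -/
theorem mem_gam_three_of_foxDer2 [S.Normal] (w : S) (hw : cls S w = 0)
    (h : foxDer2 S (⟪(w : F)⟫ - 1) = 0) : (w : F) ∈ gam S 3 := by
  let N := (gam S 3).subgroupOf S
  have h2 : ∀ x y : S ⧸ N, ⁅x, y⁆ ∈ Subgroup.center (S ⧸ N) := fun x y => by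
    induction x using QuotientGroup.induction_on with | H x => ?_
    induction y using QuotientGroup.induction_on with | H y => ?_
    exact mem_center_quotient N ⁅x, y⁆ fun z => Subgroup.commutator_mem_commutator
      (Subgroup.commutator_mem_commutator x.2 y.2) z.2
  obtain ⟨T, hT⟩ := exists_bilin_commutator S (QuotientGroup.mk' N) h2
  obtain ⟨ψ, hψ⟩ := exists_tensor_of_alternating T fun m => by
    obtain ⟨x, rfl⟩ := cls_surjective S m
    rw [hT]
    exact congrArg Additive.ofMul (Subtype.ext (commutatorElement_self _))
  -- `ψ` recovers the class of w modulo γ₃(S) from its second derivative: both are additive on γ₂(S)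
  -- and agree on commutators.
  have key : ∃ c : Subgroup.center (S ⧸ N), (c : S ⧸ N) = w ∧
      ψ (foxDer2 S (⟪(w : F)⟫ - 1)) = Additive.ofMul c := by
    clear h
    revert w
    refine commutator_induction S (fun u v => ⟨⟨_, h2 u v⟩, rfl, ?_⟩) ?_ ?_
    · rw [foxDer2_commutator, hψ, hT]; rfl
    · rintro x y hx hy ⟨c, hc, hc'⟩ ⟨d, hd, hd'⟩
      refine ⟨c * d, by rw [Subgroup.coe_mul, hc, hd]; rfl, ?_⟩
      rw [foxDer2_of_mul, hx, zero_tmul, add_zero, map_add, hc', hd', ofMul_mul]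
    · rintro x hx ⟨c, hc, hc'⟩
      refine ⟨c⁻¹, by rw [Subgroup.coe_inv, hc]; rfl, ?_⟩
      rw [foxDer2_inv S hx, map_neg, hc', ofMul_inv]
  obtain ⟨c, hc, hc'⟩ := key
  rw [h, map_zero] at hc'
  have hc1 : c = 1 := Additive.ofMul.injective hc'.symm
  rw [hc1, Subgroup.coe_one] at hc
  exact (QuotientGroup.eq_one_iff (N := N) w).1 hc.symm

/-- Left multiplication by v changes the second derivative of a by cls v ⊗ (first derivative of a),
and `p` kills this, so the required invariance holds. -/
theorem foxDer3_mul_of_ker (u : S) {a : MonoidAlgebra ℤ F} (ha : eps F a = 0)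
    (ha' : p (foxDer1 S a) = 0) :
    foxDer3 S p ((⟪(u : F)⟫ - 1) * a) = cls S u ⊗ₜ TensorProduct.map p p (foxDer2 S a) := by
  refine foxDer3_mul S p u fun v hv => ?_
  have h := foxDer2_mul S ⟨v, hv⟩ ha
  rw [sub_mul, one_mul, map_sub, sub_eq_iff_eq_add] at h
  rw [h, map_add, TensorProduct.map_tmul, ha', tmul_zero, zero_add]

theorem foxDer3_mul_sub_one (u v : S) {a : MonoidAlgebra ℤ F} (ha : eps F a = 0) :
    foxDer3 S p ((⟪(u : F)⟫ - 1) * ((⟪(v : F)⟫ - 1) * a)) =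
      cls S u ⊗ₜ (p (cls S v) ⊗ₜ p (foxDer1 S a)) := by
  rw [foxDer3_mul_of_ker, foxDer2_mul S v ha, TensorProduct.map_tmul]
  · rw [map_mul, eps_sub_one, zero_mul]
  · rw [foxDer1_mul, ha, zero_smul, map_zero]

/-- Multiplication by z - 1 appends z to the leading term of g. On commutators this follows from
`of_commutator_sub_one`; the trailing unit (yx)⁻¹ does not affect the first derivative of z - 1. -/
theorem foxDer3_gam_two_mul (z g : S) (hg : cls S g = 0) :
    foxDer3 S p ((⟪(g : F)⟫ - 1) * (⟪(z : F)⟫ - 1)) =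
      tensorRight S p (cls S z) (foxDer2 S (⟪(g : F)⟫ - 1)) := by
  have hmul (x y : S) (hy : cls S y = 0) :
      foxDer3 S p ((⟪((x * y : S) : F)⟫ - 1) * (⟪(z : F)⟫ - 1)) =
      foxDer3 S p ((⟪(x : F)⟫ - 1) * (⟪(z : F)⟫ - 1)) +
        foxDer3 S p ((⟪(y : F)⟫ - 1) * (⟪(z : F)⟫ - 1)) := by
    rw [Subgroup.coe_mul, of_mul_sub_one, add_mul, add_mul, mul_assoc, map_add, map_add,
      foxDer3_mul_sub_one S p x y (eps_sub_one _), hy, map_zero, zero_tmul, tmul_zero, zero_add]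
  revert g
  refine commutator_induction S (fun x y => ?_) (fun x y hx hy ihx ihy => ?_) fun x hx ihx => ?_
  · have he : eps F (⟪((y : F) * x)⁻¹⟫ * (⟪(z : F)⟫ - 1)) = 0 := by
      rw [map_mul, eps_sub_one, mul_zero]
    have hd : foxDer1 S (⟪((y : F) * x)⁻¹⟫ * (⟪(z : F)⟫ - 1)) = cls S z := by
      rw [foxDer1_of_mul S (eps_sub_one _) (inv_mem (mul_mem y.2 x.2)), foxDer1_sub_one]
    rw [foxDer2_commutator, map_sub, tensorRight_tmul, tensorRight_tmul]
    have hc : (((⁅x, y⁆ : S) : F)) = ⁅(x : F), (y : F)⁆ := rfl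
    rw [hc, of_commutator_sub_one, sub_mul, sub_mul, mul_assoc, mul_assoc, mul_assoc, mul_assoc,
      map_sub, foxDer3_mul_sub_one S p x y he, foxDer3_mul_sub_one S p y x he, hd]
  · rw [hmul x y hy, ihx, ihy, foxDer2_of_mul, hx, zero_tmul, add_zero, map_add]
  · have h1 := hmul x x⁻¹ (by rw [cls_inv, hx, neg_zero])
    rw [mul_inv_cancel, Subgroup.coe_one, map_one, sub_self, zero_mul, map_zero, ihx] at h1
    rw [foxDer2_inv S hx, map_neg]
    exact eq_neg_of_add_eq_zero_right h1.symm

theorem foxDer3_of_mul (u v : S) : foxDer3 S p (⟪((u * v : S) : F)⟫ - 1) =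
    foxDer3 S p (⟪(u : F)⟫ - 1) + foxDer3 S p (⟪(v : F)⟫ - 1) +
      foxDer3 S p ((⟪(u : F)⟫ - 1) * (⟪(v : F)⟫ - 1)) := by
  rw [Subgroup.coe_mul, of_mul_sub_one, map_add, map_add]; abel

theorem foxDer3_of_mul_gam_three (u v : S) (hu : cls S u = 0)
    (hu' : foxDer2 S (⟪(u : F)⟫ - 1) = 0) : foxDer3 S p (⟪((u * v : S) : F)⟫ - 1) =
    foxDer3 S p (⟪(u : F)⟫ - 1) + foxDer3 S p (⟪(v : F)⟫ - 1) := by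
  rw [foxDer3_of_mul, foxDer3_gam_two_mul S p v u hu, hu', map_zero, add_zero]

theorem foxDer3_inv_gam_three (u : S) (hu : cls S u = 0)
    (hu' : foxDer2 S (⟪(u : F)⟫ - 1) = 0) : foxDer3 S p (⟪((u⁻¹ : S) : F)⟫ - 1) =
    -foxDer3 S p (⟪(u : F)⟫ - 1) := by
  have h := foxDer3_of_mul_gam_three S p u u⁻¹ hu hu'
  rw [mul_inv_cancel, Subgroup.coe_one, map_one, sub_self, map_zero] at h
  exact eq_neg_of_add_eq_zero_right h.symm

/-- The bracket of the leading term of g with z, obtained by comparing the two sides of [g,z] · zg =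
gz. -/
theorem foxDer3_commutator (g z : S) (hg : cls S g = 0) :
    foxDer3 S p (⟪((⁅g, z⁆ : S) : F)⟫ - 1) =
      tensorRight S p (cls S z) (foxDer2 S (⟪(g : F)⟫ - 1)) -
        cls S z ⊗ₜ TensorProduct.map p p (foxDer2 S (⟪(g : F)⟫ - 1)) := by
  have h1 : ⁅g, z⁆ * (z * g) = g * z := by simp [commutatorElement_def, mul_assoc]
  have h2 := foxDer3_of_mul_gam_three S p ⁅g, z⁆ (z * g) (cls_commutator S g z)
    (by rw [foxDer2_commutator, hg, zero_tmul, tmul_zero, sub_self])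
  rw [h1, foxDer3_of_mul, foxDer3_of_mul, foxDer3_gam_two_mul S p z g hg,
    foxDer3_mul_of_ker S p z (eps_sub_one _) (by rw [foxDer1_sub_one, hg, map_zero])] at h2
  rw [← sub_eq_zero] at h2 ⊢
  rw [← neg_eq_zero, ← h2]
  abel

/-- An element of `γ₃(S)` whose leading term lies in `S_ab ⊗ S_ab ⊗ A + S_ab ⊗ A ⊗ S_ab`, with
`A = ker p`, lies in `[[A, S], A] γ₄(S)`. -/
theorem mem_of_foxDer3_eq_zero [S.Normal] [Module.Free ℤ C] (hp : Function.Surjective p)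
    (N : Subgroup F) [N.Normal] (hN : gam S 4 ≤ N)
    (hA : ∀ x y z : S, p (cls S x) = 0 → p (cls S z) = 0 → ⁅⁅(x : F), (y : F)⁆, (z : F)⁆ ∈ N)
    (w : S) (hw : (w : F) ∈ gam S 3) (h : foxDer3 S p (⟪(w : F)⟫ - 1) = 0) : (w : F) ∈ N := by
  let N' := N.subgroupOf S
  have h3 : ∀ x y z : S ⧸ N', ⁅⁅x, y⁆, z⁆ ∈ Subgroup.center (S ⧸ N') := fun x y z => by
    induction x using QuotientGroup.induction_on with | H x => ?_
    induction y using QuotientGroup.induction_on with | H y => ?_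
    induction z using QuotientGroup.induction_on with | H z => ?_
    exact mem_center_quotient N' ⁅⁅x, y⁆, z⁆ fun w => hN (Subgroup.commutator_mem_commutator
      (Subgroup.commutator_mem_commutator
        (Subgroup.commutator_mem_commutator x.2 y.2) z.2) w.2)
  obtain ⟨T, hT⟩ := exists_trilin_commutator S (QuotientGroup.mk' N') h3
  obtain ⟨ψ, hψ⟩ := exists_tensor_of_lie p hp T
    (fun x z => by
      obtain ⟨x, rfl⟩ := cls_surjective S x
      obtain ⟨z, rfl⟩ := cls_surjective S z
      rw [hT]
      exact congrArg Additive.ofMul (Subtype.ext (by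
        simp only [commutatorElement_self, commutatorElement_one_left]; rfl)))
    (fun x y z => by
      obtain ⟨x, rfl⟩ := cls_surjective S x
      obtain ⟨y, rfl⟩ := cls_surjective S y
      obtain ⟨z, rfl⟩ := cls_surjective S z
      rw [hT, hT, hT]
      exact congrArg Additive.ofMul (Subtype.ext (triple_jacobi h3 _ _ _)))
    (fun x y z hx hz => by
      obtain ⟨x, rfl⟩ := cls_surjective S x
      obtain ⟨y, rfl⟩ := cls_surjective S y
      obtain ⟨z, rfl⟩ := cls_surjective S z
      rw [hT]
      exact congrArg Additive.ofMul (Subtype.ext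
        ((QuotientGroup.eq_one_iff (N := N') ⁅⁅x, y⁆, z⁆).2 (hA x y z hx hz))))
  -- With z fixed, the class of [g,z] modulo `N` and the bracket of leading terms are both additive
  -- in g ∈ γ₂(S); for g = [u,v] the bracket is `lieTensor`, on which `ψ` is known.
  have key2 (z g : S) (hg : cls S g = 0) : ∃ c : Subgroup.center (S ⧸ N'),
      (c : S ⧸ N') = (⁅g, z⁆ : S) ∧
      ψ (tensorRight S p (cls S z) (foxDer2 S (⟪(g : F)⟫ - 1)) -
        cls S z ⊗ₜ TensorProduct.map p p (foxDer2 S (⟪(g : F)⟫ - 1))) = Additive.ofMul c := by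
    revert g
    refine commutator_induction S (fun u v => ⟨⟨_, h3 u v z⟩, rfl, ?_⟩) ?_ ?_
    · have e : tensorRight S p (cls S z) (foxDer2 S (⟪((⁅u, v⁆ : S) : F)⟫ - 1)) -
          cls S z ⊗ₜ TensorProduct.map p p (foxDer2 S (⟪((⁅u, v⁆ : S) : F)⟫ - 1)) =
          lieTensor p (cls S u) (cls S v) (cls S z) := by
        rw [foxDer2_commutator, map_sub, map_sub, tensorRight_tmul, tensorRight_tmul,
          TensorProduct.map_tmul, TensorProduct.map_tmul, tmul_sub, lieTensor]
        abel
      rw [e, hψ, hT]; rfl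
    · rintro x y hx hy ⟨c, hc, hc'⟩ ⟨d, hd, hd'⟩
      refine ⟨c * d, ?_, ?_⟩
      · have h1 : ((⁅x * y, z⁆ : S) : S ⧸ N') = ⁅(x : S ⧸ N') * y, (z : S ⧸ N')⁆ := rfl
        have h2 : ⁅(y : S ⧸ N'), (z : S ⧸ N')⁆ = d := hd.symm
        rw [h1, commutator_mul_left_of_central (h2 ▸ d.2), h2, Subgroup.coe_mul, hc]
        rfl
      · rw [ofMul_mul, ← hc', ← hd', ← map_add, foxDer2_of_mul, hx, zero_tmul, add_zero, map_add,
          map_add, tmul_add, add_sub_add_comm]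
    · rintro x hx ⟨c, hc, hc'⟩
      refine ⟨c⁻¹, ?_, ?_⟩
      · have h1 : ((⁅x⁻¹, z⁆ : S) : S ⧸ N') = ⁅(x : S ⧸ N')⁻¹, (z : S ⧸ N')⁆ := rfl
        have h2 : ⁅(x : S ⧸ N'), (z : S ⧸ N')⁆ = c := hc.symm
        rw [h1, commutator_inv_left_of_central (h2 ▸ c.2), h2, Subgroup.coe_inv]
      · rw [ofMul_inv, ← hc', ← map_neg, foxDer2_inv S hx, map_neg, map_neg, tmul_neg, neg_sub_neg,
          neg_sub]
  -- Extension from the generators [g,z] to all of γ₃(S). The vanishing of the first two derivatives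
  -- is carried along because additivity of the third derivative depends on it.
  have key3 (w : F) (hw : w ∈ ⁅gam S 2, S⁆) : ∃ hS : w ∈ S, cls S ⟨w, hS⟩ = 0 ∧
      foxDer2 S (⟪w⟫ - 1) = 0 ∧ ∃ c : Subgroup.center (S ⧸ N'),
        (c : S ⧸ N') = (⟨w, hS⟩ : S) ∧ ψ (foxDer3 S p (⟪w⟫ - 1)) = Additive.ofMul c := by
    induction hw using Subgroup.closure_induction with
    | mem x hx =>
      obtain ⟨g, hg, z, hz, rfl⟩ := hx
      have hgS : g ∈ S := Subgroup.commutator_le_left S S hg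
      have hgc : cls S ⟨g, hgS⟩ = 0 := (cls_eq_zero_iff S _).2 hg
      have hzg : ((⁅(⟨g, hgS⟩ : S), (⟨z, hz⟩ : S)⁆ : S) : F) = ⁅g, z⁆ := rfl
      refine ⟨(⁅(⟨g, hgS⟩ : S), (⟨z, hz⟩ : S)⁆ : S).2,
        cls_commutator S ⟨g, hgS⟩ ⟨z, hz⟩, ?_, ?_⟩
      · rw [← hzg, foxDer2_commutator, hgc, zero_tmul, tmul_zero, sub_self]
      · obtain ⟨c, hc, hc'⟩ := key2 ⟨z, hz⟩ ⟨g, hgS⟩ hgc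
        refine ⟨c, hc, ?_⟩
        rw [← hc', ← hzg, foxDer3_commutator S p _ _ hgc]
    | one => exact ⟨S.one_mem, cls_one S, by simp [← MonoidAlgebra.one_def], 1, rfl,
        by simp [← MonoidAlgebra.one_def]⟩
    | mul x y _ _ ihx ihy =>
      obtain ⟨hx, hx1, hx2, c, hc, hc'⟩ := ihx
      obtain ⟨hy, hy1, hy2, d, hd, hd'⟩ := ihy
      have e : x * y = ((⟨x, hx⟩ * ⟨y, hy⟩ : S) : F) := rfl
      refine ⟨S.mul_mem hx hy, ?_, ?_, c * d, ?_, ?_⟩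
      · exact (cls_mul S ⟨x, hx⟩ ⟨y, hy⟩).trans (by rw [hx1, hy1, add_zero])
      · rw [e, foxDer2_of_mul, hx1, zero_tmul, add_zero]
        exact (congrArg₂ (· + ·) hx2 hy2).trans (add_zero 0)
      · rw [Subgroup.coe_mul, hc, hd]; rfl
      · rw [e, foxDer3_of_mul_gam_three S p _ _ hx1 hx2, map_add, ofMul_mul, ← hc', ← hd']
    | inv x _ ihx =>
      obtain ⟨hx, hx1, hx2, c, hc, hc'⟩ := ihx
      have e : x⁻¹ = (((⟨x, hx⟩ : S)⁻¹ : S) : F) := rfl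
      refine ⟨S.inv_mem hx, ?_, ?_, c⁻¹, ?_, ?_⟩
      · exact (cls_inv S ⟨x, hx⟩).trans (by rw [hx1, neg_zero])
      · rw [e, foxDer2_inv S hx1]
        exact neg_eq_zero.2 hx2
      · rw [Subgroup.coe_inv, hc]; rfl
      · rw [e, foxDer3_inv_gam_three S p _ hx1 hx2, map_neg, ofMul_inv, ← hc']
  obtain ⟨_, _, _, c, hc, hc'⟩ := key3 w hw
  rw [h, map_zero] at hc'
  have hc1 : c = 1 := Additive.ofMul.injective hc'.symm
  rw [hc1, Subgroup.coe_one] at hc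
  exact (QuotientGroup.eq_one_iff (N := N') w).1 hc.symm

end Dimension

/-! ### Group elements congruent to one modulo products of augmentation ideals -/

section FoxSubgroups

attribute [local instance] commutatorElement

local notation "⟪" g "⟫" => MonoidAlgebra.of ℤ _ g

variable {F : Type u} [Group F] {R : Subgroup F}

theorem gam_mono {H H' : Subgroup F} (h : H ≤ H') (n : ℕ) : gam H n ≤ gam H' n := by
  have := gam_map_le (MonoidHom.id F) (H := H) (H' := H') (by rwa [Subgroup.map_id]) n
  rwa [Subgroup.map_id] at this

theorem gam_le (H : Subgroup F) [H.Normal] : ∀ n, gam H n ≤ H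
  | 0 => le_rfl
  | 1 => le_rfl
  | n + 2 => Subgroup.commutator_le_right (gam H (n + 1)) H

theorem aug_le_top (H : Subgroup F) : aug H ≤ aug (⊤ : Subgroup F) :=
  Submodule.span_mono fun _ ⟨g, _, h⟩ => ⟨g, trivial, h⟩

theorem mul_mem_aug_top (a : MonoidAlgebra ℤ F) {b : MonoidAlgebra ℤ F}
    (hb : b ∈ aug (⊤ : Subgroup F)) : a * b ∈ aug (⊤ : Subgroup F) := by
  induction a using groupRing_induction with
  | of g =>
    induction hb using Submodule.span_induction with
    | mem x hx =>
      obtain ⟨h, -, rfl⟩ := hx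
      have : ⟪g⟫ * (⟪h⟫ - 1) = (⟪g * h⟫ - 1) - (⟪g⟫ - 1) := by
        rw [map_mul]; noncomm_ring
      rw [this]
      exact Submodule.sub_mem _ (sub_one_mem_aug trivial) (sub_one_mem_aug trivial)
    | zero => rw [mul_zero]; exact Submodule.zero_mem _
    | add x y _ _ hx hy => rw [mul_add]; exact Submodule.add_mem _ hx hy
    | smul c x _ hx => rw [mul_smul_comm]; exact Submodule.smul_mem _ c hx
  | add x y hx hy => rw [add_mul]; exact Submodule.add_mem _ hx hy
  | smul c x hx => rw [smul_mul_assoc]; exact Submodule.smul_mem _ c hx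

theorem mul_mem_aug_top_pow (n : ℕ) (a : MonoidAlgebra ℤ F) {b : MonoidAlgebra ℤ F}
    (hb : b ∈ aug (⊤ : Subgroup F) ^ (n + 1)) : a * b ∈ aug (⊤ : Subgroup F) ^ (n + 1) := by
  rw [pow_succ'] at hb ⊢
  induction hb using Submodule.mul_induction_on' with
  | mem_mul_mem x hx y hy =>
    rw [← mul_assoc]
    exact Submodule.mul_mem_mul (mul_mem_aug_top a hx) hy
  | add x _ y _ hx hy => rw [mul_add]; exact Submodule.add_mem _ hx hy

theorem mem_foxSucc {n : ℕ} {g : F} :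
    g ∈ foxSucc R n ↔ ⟪g⟫ - 1 ∈ aug R * aug (⊤ : Subgroup F) ^ (n + 1) := Iff.rfl

/-- Up to a unit on the right, [g,h] - 1 is (g-1)(h-1) - (h-1)(g-1). Each product needs one factor 𝔯
on its left, which is why two filtration conditions are imposed on each of g and h. -/
theorem commutator_mem_foxSucc {n : ℕ} {g h : F} {i j k l : ℕ}
    (hg : ⟪g⟫ - 1 ∈ aug R * aug (⊤ : Subgroup F) ^ i)
    (hh : ⟪h⟫ - 1 ∈ aug (⊤ : Subgroup F) ^ j)
    (hh' : ⟪h⟫ - 1 ∈ aug R * aug (⊤ : Subgroup F) ^ k)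
    (hg' : ⟪g⟫ - 1 ∈ aug (⊤ : Subgroup F) ^ l)
    (hij : i + j = n + 1) (hkl : k + l = n + 1) : ⁅g, h⁆ ∈ foxSucc R n := by
  rw [mem_foxSucc, of_commutator_sub_one]
  refine foxIdeal_mul_of R n (Submodule.sub_mem _ ?_ ?_) _
  · rw [foxIdeal, ← hij, pow_add, ← mul_assoc]
    exact Submodule.mul_mem_mul hg hh
  · rw [foxIdeal, ← hkl, pow_add, ← mul_assoc]
    exact Submodule.mul_mem_mul hh' hg'

theorem foxIdeal_le_aug_top_pow (R : Subgroup F) (n : ℕ) :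
    aug R * aug (⊤ : Subgroup F) ^ n ≤ aug (⊤ : Subgroup F) ^ (n + 1) := by
  rw [pow_succ']
  exact mul_le_mul' (aug_le_top R) le_rfl

theorem sub_one_mem_of_mem_gam (n : ℕ) : ∀ g ∈ gam R (n + 1),
    ⟪g⟫ - 1 ∈ aug R * aug (⊤ : Subgroup F) ^ n := by
  induction n with
  | zero => intro g hg; rw [pow_zero, mul_one]; exact sub_one_mem_aug hg
  | succ n ih =>
    have : gam R (n + 2) ≤ foxSucc R n := by
      refine Subgroup.commutator_le.2 fun g hg h hh => commutator_mem_foxSucc (j := 1) (k := 0)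
        (ih g hg) ?_ ?_ (foxIdeal_le_aug_top_pow R n (ih g hg)) rfl (zero_add _)
      · rw [pow_one]; exact sub_one_mem_aug trivial
      · rw [pow_zero, mul_one]; exact sub_one_mem_aug hh
    exact this

theorem sub_one_mem_of_mem_gam_top {n : ℕ} {g : F} (hg : g ∈ gam (⊤ : Subgroup F) (n + 1)) :
    ⟪g⟫ - 1 ∈ aug (⊤ : Subgroup F) ^ (n + 1) := by
  rw [pow_succ']
  exact sub_one_mem_of_mem_gam n g hg

theorem sub_one_mem_of_mem {g : F} (hg : g ∈ R) :
    ⟪g⟫ - 1 ∈ aug R * aug (⊤ : Subgroup F) ^ 0 := by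
  rw [pow_zero, mul_one]; exact sub_one_mem_aug hg

/-- For the middle factor, [R ∩ γ₂(F), R] lies in both γ₂(R) and γ₃(F), so the two products lie in
(𝔯𝔣)𝔣² and 𝔯𝔣³. -/
theorem foxG3_le_fox3 (R : Subgroup F) : foxG3 R ≤ fox3 R := by
  refine sup_le (sup_le ?_ ?_) ?_
  · refine Subgroup.commutator_le.2 fun x hx y hy => ?_
    exact commutator_mem_foxSucc (sub_one_mem_of_mem hx.1) (sub_one_mem_of_mem_gam_top hy.2)
      (sub_one_mem_of_mem hy.1) (sub_one_mem_of_mem_gam_top hx.2) rfl rfl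
  · refine Subgroup.commutator_le.2 fun x hx y hy => ?_
    have hx2 : x ∈ gam R 2 := Subgroup.commutator_mono (inf_le_left : capGam R 2 ≤ R) le_rfl hx
    have hx3 : x ∈ gam (⊤ : Subgroup F) 3 :=
      Subgroup.commutator_mono (inf_le_right : capGam R 2 ≤ gam ⊤ 2) le_top hx
    exact commutator_mem_foxSucc (sub_one_mem_of_mem_gam 1 x hx2)
      (sub_one_mem_of_mem_gam_top hy.2) (sub_one_mem_of_mem hy.1)
      (sub_one_mem_of_mem_gam_top hx3) rfl rfl
  · exact sub_one_mem_of_mem_gam 3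

/-- The error in gᵐ - 1 ≈ m(g - 1) is a multiple of (g - 1)²; passing from one exponent to the next
changes it by (gᵃ - 1)(g - 1). -/
theorem zpow_sub_one_mem (g : F) {n : ℕ} (hg : ⟪g⟫ - 1 ∈ aug (⊤ : Subgroup F) ^ (n + 1)) (m : ℤ) :
    ⟪g ^ m⟫ - 1 - m • (⟪g⟫ - 1) ∈ aug (⊤ : Subgroup F) ^ (n + 1 + (n + 1)) := by
  have hp (a : ℤ) : ⟪g ^ a⟫ - 1 ∈ aug (⊤ : Subgroup F) ^ (n + 1) := by
    induction a using Int.induction_on with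
    | zero => rw [zpow_zero, map_one, sub_self]; exact Submodule.zero_mem _
    | succ a ih =>
      have : ⟪g ^ ((a : ℤ) + 1)⟫ - 1 = ⟪g ^ (a : ℤ)⟫ * (⟪g⟫ - 1) + (⟪g ^ (a : ℤ)⟫ - 1) := by
        rw [zpow_add_one, map_mul]; noncomm_ring
      rw [this]
      exact Submodule.add_mem _ (mul_mem_aug_top_pow n _ hg) ih
    | pred a ih =>
      have : ⟪g ^ (-(a : ℤ) - 1)⟫ - 1 =
          (⟪g ^ (-(a : ℤ))⟫ - 1) - ⟪g ^ (-(a : ℤ) - 1)⟫ * (⟪g⟫ - 1) := by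
        rw [mul_sub, ← map_mul, ← zpow_add_one, sub_add_cancel]; noncomm_ring
      rw [this]
      exact Submodule.sub_mem _ ih (mul_mem_aug_top_pow n _ hg)
  have hs (a : ℤ) : ⟪g ^ (a + 1)⟫ - 1 - (a + 1) • (⟪g⟫ - 1) =
      (⟪g ^ a⟫ - 1 - a • (⟪g⟫ - 1)) + (⟪g ^ a⟫ - 1) * (⟪g⟫ - 1) := by
    rw [zpow_add_one, map_mul, add_smul, one_smul]; noncomm_ring
  have hm (a : ℤ) : (⟪g ^ a⟫ - 1) * (⟪g⟫ - 1) ∈ aug (⊤ : Subgroup F) ^ (n + 1 + (n + 1)) := by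
    rw [pow_add]; exact Submodule.mul_mem_mul (hp a) hg
  induction m using Int.induction_on with
  | zero => rw [zpow_zero, map_one, sub_self, zero_smul, sub_zero]; exact Submodule.zero_mem _
  | succ a ih => rw [hs]; exact Submodule.add_mem _ ih (hm _)
  | pred a ih =>
    have := hs (-(a : ℤ) - 1)
    rw [sub_add_cancel] at this
    rw [← sub_eq_iff_eq_add] at this
    rw [← this]
    exact Submodule.sub_mem _ ih (hm _)

/-- The ideal 𝔯ℤ[F] dies in ℤ[F/R], where distinct group elements stay distinct. -/
theorem mem_of_mem_foxSucc [R.Normal] {n : ℕ} {w : F} (hw : w ∈ foxSucc R n) : w ∈ R := by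
  let q := MonoidAlgebra.mapDomainAlgHom ℤ ℤ (QuotientGroup.mk' R)
  have hq (g : F) : q ⟪g⟫ = ⟪(g : F ⧸ R)⟫ := by
    simp [q]
  have h0 : ∀ a ∈ aug R * aug (⊤ : Subgroup F) ^ (n + 1), q a = 0 := fun a ha => by
    induction ha using Submodule.mul_induction_on' with
    | mem_mul_mem x hx y hy =>
      have : q x = 0 := by
        induction hx using Submodule.span_induction with
        | mem x hx =>
          obtain ⟨u, hu, rfl⟩ := hx
          rw [map_sub, hq, map_one, (QuotientGroup.eq_one_iff u).2 hu, map_one, sub_self]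
        | zero => exact map_zero _
        | add x y _ _ hx hy => rw [map_add, hx, hy, add_zero]
        | smul c x _ hx => rw [map_smul, hx, smul_zero]
      rw [map_mul, this, zero_mul]
    | add x _ y _ hx hy => rw [map_add, hx, hy, add_zero]
  have h1 := h0 _ hw
  rw [map_sub, hq, map_one, sub_eq_zero] at h1
  exact (QuotientGroup.eq_one_iff w).1 (MonoidAlgebra.of_injective (h1.trans (map_one _).symm))

end FoxSubgroups

/-! ### Coordinates of tensors -/

section Coordinates

variable {ι M A A' : Type*} [AddCommGroup M] [AddCommGroup A] [AddCommGroup A']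
  (e : Module.Basis ι ℤ M)

/-- The coefficient of `e i` in an element of `M ⊗ A`. -/
def tensorCoord (A : Type*) [AddCommGroup A] (i : ι) : M ⊗[ℤ] A →ₗ[ℤ] A :=
  (TensorProduct.lid ℤ A).toLinearMap ∘ₗ (e.coord i).rTensor A

theorem tensorCoord_tmul (i : ι) (m : M) (a : A) :
    tensorCoord e A i (m ⊗ₜ a) = e.repr m i • a := rfl

theorem tensorCoord_lTensor (l : A →ₗ[ℤ] A') (i : ι) (t : M ⊗[ℤ] A) :
    tensorCoord e A' i (l.lTensor M t) = l (tensorCoord e A i t) := by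
  induction t with
  | zero => simp only [map_zero]
  | tmul m a => rw [LinearMap.lTensor_tmul, tensorCoord_tmul, tensorCoord_tmul, map_smul]
  | add x y hx hy => simp only [map_add, hx, hy]

theorem exists_sum_tensorCoord (t : M ⊗[ℤ] A) :
    ∃ s : Finset ι, t = ∑ i ∈ s, e i ⊗ₜ[ℤ] tensorCoord e A i t := by
  classical
  obtain ⟨c, rfl⟩ := TensorProduct.eq_repr_basis_left e t
  refine ⟨c.support, Finset.sum_congr rfl fun i hi => ?_⟩
  congr 1
  rw [Finsupp.sum, map_sum, Finset.sum_eq_single i]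
  · rw [tensorCoord_tmul, e.repr_self, Finsupp.single_eq_same, one_smul]
  · intro j _ hj
    rw [tensorCoord_tmul, e.repr_self, Finsupp.single_eq_of_ne hj.symm, zero_smul]
  · intro h; exact absurd hi h

theorem tensorCoord_mem {B : AddSubgroup A} {t : M ⊗[ℤ] A} (ht : t ∈ tensR M B) (i : ι) :
    tensorCoord e A i t ∈ B := by
  induction ht using AddSubgroup.closure_induction with
  | mem x hx => obtain ⟨m, b, hb, rfl⟩ := hx; exact B.zsmul_mem hb _
  | zero => rw [map_zero]; exact B.zero_mem
  | add x y _ _ hx hy => rw [map_add]; exact B.add_mem hx hy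
  | neg x _ hx => rw [map_neg]; exact B.neg_mem hx

theorem mem_tensR_of_tensorCoord {B : AddSubgroup A} {t : M ⊗[ℤ] A}
    (ht : ∀ i, tensorCoord e A i t ∈ B) : t ∈ tensR M B := by
  obtain ⟨s, hs⟩ := exists_sum_tensorCoord e t
  rw [hs]
  exact AddSubgroup.sum_mem _ fun i _ => AddSubgroup.subset_closure ⟨e i, _, ht i, rfl⟩

theorem eq_zero_of_tensorCoord {t : M ⊗[ℤ] A} (ht : ∀ i, tensorCoord e A i t = 0) : t = 0 := by
  obtain ⟨s, hs⟩ := exists_sum_tensorCoord e t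
  rw [hs]
  exact Finset.sum_eq_zero fun i _ => by rw [ht i, tmul_zero]

end Coordinates

/-! ### The Fox subgroup and the Koszul homology of the abelianization -/

section FoxKoszul

attribute [local instance] commutatorElement

local notation "⟪" g "⟫" => MonoidAlgebra.of ℤ _ g

variable {F : Type u} [Group F]

theorem aug_mul_of {S : Subgroup F} {a : MonoidAlgebra ℤ F} (ha : a ∈ aug S) {g : F}
    (hg : g ∈ S) : a * ⟪g⟫ ∈ aug S := by
  induction ha using Submodule.span_induction with
  | mem x hx =>
    obtain ⟨h, hh, rfl⟩ := hx
    have : (⟪h⟫ - 1) * ⟪g⟫ = (⟪h * g⟫ - 1) - (⟪g⟫ - 1) := by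
      rw [map_mul]; noncomm_ring
    rw [this]
    exact Submodule.sub_mem _ (sub_one_mem_aug (S.mul_mem hh hg)) (sub_one_mem_aug hg)
  | zero => rw [zero_mul]; exact Submodule.zero_mem _
  | add x y _ _ hx hy => rw [add_mul]; exact Submodule.add_mem _ hx hy
  | smul c x _ hx => rw [smul_mul_assoc]; exact Submodule.smul_mem _ c hx

theorem aug_sq_mul_of {S : Subgroup F} {a : MonoidAlgebra ℤ F} (ha : a ∈ aug S * aug S) {g : F}
    (hg : g ∈ S) : a * ⟪g⟫ ∈ aug S * aug S := by
  induction ha using Submodule.mul_induction_on' with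
  | mem_mul_mem x hx y hy => rw [mul_assoc]; exact Submodule.mul_mem_mul hx (aug_mul_of hy hg)
  | add x _ y _ hx hy => rw [add_mul]; exact Submodule.add_mem _ hx hy

theorem sub_one_mul_sub_one_mem {S : Subgroup F} (u v : S) :
    (⟪(u : F)⟫ - 1) * (⟪(v : F)⟫ - 1) ∈ aug S * aug S :=
  Submodule.mul_mem_mul (sub_one_mem_aug u.2) (sub_one_mem_aug v.2)

theorem inv_sub_one_mem {S : Subgroup F} (u : S) :
    ⟪((u⁻¹ : S) : F)⟫ - 1 + (⟪(u : F)⟫ - 1) ∈ aug S * aug S := by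
  have : ⟪((u⁻¹ : S) : F)⟫ - 1 + (⟪(u : F)⟫ - 1) =
      -((⟪(u : F)⟫ - 1) * (⟪((u⁻¹ : S) : F)⟫ - 1)) := by
    rw [sub_mul, mul_sub, ← map_mul, ← Subgroup.coe_mul, mul_inv_cancel, Subgroup.coe_one, map_one]
    noncomm_ring
  rw [this]
  exact Submodule.neg_mem _ (sub_one_mul_sub_one_mem u u⁻¹)

/-- Modulo Δ(S)² the map v ↦ v - 1 is a homomorphism from S, so integral combinations of such
elements again have this form. -/
theorem exists_sub_mem_aug_sq {S : Subgroup F} {a : MonoidAlgebra ℤ F} (ha : a ∈ subRing S)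
    (h0 : eps F a = 0) : ∃ v : S, a - (⟪(v : F)⟫ - 1) ∈ aug S * aug S := by
  -- Subtracting the augmentation gives a statement about every element of ℤ[S], so the induction
  -- can run over its group elements.
  suffices ∃ v : S, a - eps F a • 1 - (⟪(v : F)⟫ - 1) ∈ aug S * aug S by
    simpa only [h0, zero_smul, sub_zero] using this
  clear h0
  have ha' : a ∈ (Submodule.span ℤ {a | ∃ u ∈ S, a = ⟪u⟫}).toAddSubgroup := ha
  clear ha
  rw [Submodule.span_int_eq_addSubgroupClosure] at ha'
  induction ha' using AddSubgroup.closure_induction with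
  | mem x hx =>
    obtain ⟨u, hu, rfl⟩ := hx
    refine ⟨⟨u, hu⟩, ?_⟩
    rw [eps_of, one_smul, sub_self]
    exact Submodule.zero_mem _
  | zero =>
    refine ⟨1, ?_⟩
    rw [map_zero, zero_smul, Subgroup.coe_one, map_one, sub_self, sub_self, sub_self]
    exact Submodule.zero_mem _
  | add x y _ _ hx hy =>
    obtain ⟨v, hv⟩ := hx
    obtain ⟨v', hv'⟩ := hy
    refine ⟨v * v', ?_⟩
    rw [Subgroup.coe_mul, of_mul_sub_one, map_add, add_smul]
    convert Submodule.sub_mem _ (Submodule.add_mem _ hv hv') (sub_one_mul_sub_one_mem v v') using 1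
    abel
  | neg x _ hx =>
    obtain ⟨v, hv⟩ := hx
    refine ⟨v⁻¹, ?_⟩
    rw [map_neg, neg_smul]
    convert Submodule.neg_mem _ (Submodule.add_mem _ hv (inv_sub_one_mem v)) using 1
    abel

theorem sub_one_mem_aug_sq {S : Subgroup F} (w : S) (hw : cls S w = 0) :
    ⟪(w : F)⟫ - 1 ∈ aug S * aug S := by
  revert w
  refine commutator_induction S (fun u v => ?_) (fun x y _ _ hx hy => ?_) fun x _ hx => ?_
  · have hc : (((⁅u, v⁆ : S) : F)) = ⁅(u : F), (v : F)⁆ := rfl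
    rw [hc, of_commutator_sub_one]
    exact aug_sq_mul_of (Submodule.sub_mem _ (sub_one_mul_sub_one_mem u v)
      (sub_one_mul_sub_one_mem v u)) (S.inv_mem (S.mul_mem v.2 u.2))
  · rw [Subgroup.coe_mul, of_mul_sub_one]
    exact Submodule.add_mem _ (Submodule.add_mem _ (sub_one_mul_sub_one_mem x y) hx) hy
  · exact (Submodule.add_mem_iff_left _ hx).1 (inv_sub_one_mem x)

theorem eps_of_mem_aug_mul {S : Subgroup F} {a : MonoidAlgebra ℤ F}
    {I : Submodule ℤ (MonoidAlgebra ℤ F)} (ha : a ∈ aug S * I) : eps F a = 0 := by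
  induction ha using Submodule.mul_induction_on' with
  | mem_mul_mem x hx y hy => rw [map_mul, eps_of_mem_aug hx, zero_mul]
  | add x _ y _ hx hy => rw [map_add, hx, hy, add_zero]

theorem eps_of_mem_cube {a : MonoidAlgebra ℤ F} (ha : a ∈ aug (⊤ : Subgroup F) ^ 3) :
    eps F a = 0 := by
  rw [pow_succ'] at ha; exact eps_of_mem_aug_mul ha

theorem aug_mul_induction {S : Subgroup F} {I : Submodule ℤ (MonoidAlgebra ℤ F)}
    {P : MonoidAlgebra ℤ F → Prop} (gen : ∀ (u : S), ∀ b ∈ I, P ((⟪(u : F)⟫ - 1) * b))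
    (add : ∀ x y, P x → P y → P (x + y))
    {a : MonoidAlgebra ℤ F} (ha : a ∈ aug S * I) : P a := by
  induction ha using Submodule.mul_induction_on' with
  | mem_mul_mem x hx y hy =>
    induction hx using Submodule.span_induction generalizing y with
    | mem x hx => obtain ⟨u, hu, rfl⟩ := hx; exact gen ⟨u, hu⟩ y hy
    | zero =>
      rw [zero_mul]
      simpa using gen 1 0 I.zero_mem
    | add x x' _ _ hx hx' => rw [add_mul]; exact add _ _ (hx y hy) (hx' y hy)
    | smul c x _ hx =>
      rw [smul_mul_assoc, ← mul_smul_comm]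
      exact hx _ (I.smul_mem c hy)
  | add x _ y _ hx hy => exact add x y hx hy

variable (S : Subgroup F) [IsFreeGroup S]

theorem foxDer1_of_mem {a : MonoidAlgebra ℤ F} {I : Submodule ℤ (MonoidAlgebra ℤ F)}
    (hI : ∀ b ∈ I, eps F b = 0) (ha : a ∈ aug S * I) : foxDer1 S a = 0 := by
  refine aug_mul_induction (P := fun a => foxDer1 S a = 0) (fun u b hb => ?_)
    (fun x y hx hy => ?_) ha
  · rw [foxDer1_mul, hI b hb, zero_smul]
  · rw [map_add, hx, hy, add_zero]

theorem foxDer2_of_mem {a : MonoidAlgebra ℤ F} {I : Submodule ℤ (MonoidAlgebra ℤ F)}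
    (hI : ∀ b ∈ I, eps F b = 0) (hI' : ∀ b ∈ I, foxDer1 S b = 0) (ha : a ∈ aug S * I) :
    foxDer2 S a = 0 := by
  refine aug_mul_induction (P := fun a => foxDer2 S a = 0) (fun u b hb => ?_)
    (fun x y hx hy => ?_) ha
  · rw [foxDer2_mul S u (hI b hb), hI' b hb, tmul_zero]
  · rw [map_add, hx, hy, add_zero]

/-- The coefficients of d(u) multiply b from the left, and powers of 𝔣 are left ideals. -/
theorem foxD_mem {a : MonoidAlgebra ℤ F} (n : ℕ)
    (ha : a ∈ aug S * aug (⊤ : Subgroup F) ^ (n + 1)) :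
    foxD S a ∈ tensR (AbM S) (aug (⊤ : Subgroup F) ^ (n + 1)).toAddSubgroup := by
  refine aug_mul_induction (P := fun a => foxD S a ∈ tensR (AbM S) _) (fun u b hb => ?_)
    (fun x y hx hy => ?_) ha
  · rw [foxD_mul]
    induction foxCross S u with
    | zero => rw [map_zero]; exact AddSubgroup.zero_mem _
    | tmul m c =>
      exact AddSubgroup.subset_closure ⟨m, c * b, mul_mem_aug_top_pow n c hb, rfl⟩
    | add x y hx hy => rw [map_add]; exact AddSubgroup.add_mem _ hx hy
  · rw [map_add]; exact AddSubgroup.add_mem _ hx hy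

theorem foxDer2_mem_altSq (w : S) (hw : cls S w = 0) :
    foxDer2 S (⟪(w : F)⟫ - 1) ∈ altSq (⊤ : AddSubgroup (AbM S)) := by
  revert w
  refine commutator_induction S (fun u v => ?_) (fun x y hx _ ihx ihy => ?_) fun x hx ihx => ?_
  · rw [foxDer2_commutator]
    exact AddSubgroup.subset_closure ⟨_, trivial, _, trivial, rfl⟩
  · rw [foxDer2_of_mul, hx, zero_tmul, add_zero]
    exact AddSubgroup.add_mem _ ihx ihy
  · rw [foxDer2_inv S hx]
    exact AddSubgroup.neg_mem _ ihx

end FoxKoszul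

/-! ### Derivatives over `R` compared with derivatives over `F` -/

section FoxHom

attribute [local instance] commutatorElement

local notation "⟪" g "⟫" => MonoidAlgebra.of ℤ _ g

variable {F : Type u} [Group F] {F' : Type u} [Group F'] {R : Subgroup F} {R' : Subgroup F'}

/-- The map of abelianizations induced by `f : F → F'` with `f(R) ⊆ R'`. -/
def abMap (f : F →* F') (h : R.map f ≤ R') : AbM R →ₗ[ℤ] AbM R' :=
  abLift R (fun u => cls R' ⟨f u, h ⟨u, u.2, rfl⟩⟩) fun x y => by
    rw [← cls_mul]
    exact congrArg (cls R') (Subtype.ext (map_mul f _ _))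

theorem abMap_cls (f : F →* F') (h : R.map f ≤ R') (u : R) :
    abMap f h (cls R u) = cls R' ⟨f u, h ⟨u, u.2, rfl⟩⟩ := rfl

variable (R) in
/-- The map `R_ab → F_ab`. -/
def abIncl : AbM R →ₗ[ℤ] AbM (⊤ : Subgroup F) := abMap (MonoidHom.id F) le_top

theorem abIncl_cls (u : R) : abIncl R (cls R u) = cls (⊤ : Subgroup F) ⟨u, trivial⟩ := rfl

theorem abIncl_cls_eq_zero (u : R) : abIncl R (cls R u) = 0 ↔ (u : F) ∈ gam (⊤ : Subgroup F) 2 := by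
  rw [abIncl_cls, cls_eq_zero_iff]

variable (R) in
/-- The image of `R_ab → F_ab`. -/
abbrev AbImage : Type u := LinearMap.range (abIncl R)

variable (R) in
/-- The map of `R_ab` onto its image in `F_ab`. -/
def abProj : AbM R →ₗ[ℤ] AbImage R := (abIncl R).rangeRestrict

theorem abProj_surjective : Function.Surjective (abProj R) := (abIncl R).surjective_rangeRestrict

theorem abProj_cls_eq_zero (u : R) : abProj R (cls R u) = 0 ↔ (u : F) ∈ gam (⊤ : Subgroup F) 2 := by
  rw [← abIncl_cls_eq_zero, ← Subtype.coe_inj]; exact Iff.rfl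

theorem map_subtype_map_abProj (t : AbM R ⊗[ℤ] AbM R) :
    TensorProduct.map (LinearMap.range (abIncl R)).subtype (LinearMap.range (abIncl R)).subtype
      (TensorProduct.map (abProj R) (abProj R) t) = TensorProduct.map (abIncl R) (abIncl R) t := by
  induction t with
  | zero => simp only [map_zero]
  | tmul x y => rfl
  | add x y hx hy => simp only [map_add, hx, hy]

variable (R) in
/-- The image of `R ∩ γ₃(F)` in `R_ab`. -/
def foxBAb : AddSubgroup (AbM R) :=
  Subgroup.toAddSubgroup (((capGam R 3).subgroupOf R).map Abelianization.of)

theorem mem_foxBAb {m : AbM R} :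
    m ∈ foxBAb R ↔ ∃ u : R, (u : F) ∈ gam (⊤ : Subgroup F) 3 ∧ cls R u = m := by
  constructor
  · rintro ⟨u, hu, rfl⟩
    exact ⟨u, hu.2, rfl⟩
  · rintro ⟨u, hu, rfl⟩
    exact ⟨u, ⟨u.2, hu⟩, rfl⟩

variable [IsFreeGroup F]

instance : Module.Free ℤ (AbImage R) := free_int_submodule _

theorem map_subtype_injective : Function.Injective
    (TensorProduct.map (LinearMap.range (abIncl R)).subtype
      (LinearMap.range (abIncl R)).subtype) :=
  map_injective_of_free _ (Submodule.injective_subtype _)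

/-- Derivatives over R and over F depend on unrelated free generators, but on Δ(R)² both second
derivatives send (u-1)(v-1) to u ⊗ v. -/
theorem map_abIncl_foxDer2 {b : MonoidAlgebra ℤ F} (hb : b ∈ aug R * aug R) :
    TensorProduct.map (abIncl R) (abIncl R) (foxDer2 R b) = foxDer2 ⊤ b := by
  have h1 (u : R) (c : MonoidAlgebra ℤ F) (hc : c ∈ aug R) :
      TensorProduct.map (abIncl R) (abIncl R) (foxDer2 R ((⟪(u : F)⟫ - 1) * c)) =
        foxDer2 ⊤ ((⟪(u : F)⟫ - 1) * c) := by
    induction hc using Submodule.span_induction with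
    | mem x hx =>
      obtain ⟨v, hv, rfl⟩ := hx
      exact (congrArg _ (foxDer2_mul_sub_one R u ⟨v, hv⟩)).trans
        (foxDer2_mul_sub_one (⊤ : Subgroup F) ⟨u, trivial⟩ ⟨v, trivial⟩).symm
    | zero => simp only [mul_zero, map_zero]
    | add x y _ _ hx hy => simp only [mul_add, map_add, hx, hy]
    | smul n x _ hx =>
      rw [mul_smul_comm, map_smul, map_smul, hx]
      exact (map_smul _ n _).symm
  refine aug_mul_induction (P := fun b => TensorProduct.map (abIncl R) (abIncl R) (foxDer2 R b) =
    foxDer2 ⊤ b) h1 (fun x y hx hy => ?_) hb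
  rw [map_add, map_add, map_add, hx, hy]

theorem foxDer1_aug_sq {S : Subgroup F} {b : MonoidAlgebra ℤ F} (hb : b ∈ aug S * aug S) :
    foxDer1 S b = 0 :=
  foxDer1_of_mem S (fun _ => eps_of_mem_aug) hb

theorem foxDer2_aug_cube {a : MonoidAlgebra ℤ F} (ha : a ∈ aug (⊤ : Subgroup F) ^ 3) :
    foxDer2 (⊤ : Subgroup F) a = 0 := by
  rw [pow_succ'] at ha
  refine foxDer2_of_mem ⊤ (I := aug (⊤ : Subgroup F) ^ 2) (fun b hb => ?_) (fun b hb => ?_) ha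
  · rw [pow_two] at hb; exact eps_of_mem_aug_mul hb
  · rw [pow_two] at hb; exact foxDer1_aug_sq hb

theorem exists_gam_two_of_altSq {τ : AbImage R ⊗[ℤ] AbImage R}
    (hτ : τ ∈ altSq (⊤ : AddSubgroup (AbImage R))) :
    ∃ g : R, cls R g = 0 ∧
      TensorProduct.map (abProj R) (abProj R) (foxDer2 R (⟪(g : F)⟫ - 1)) = τ := by
  induction hτ using AddSubgroup.closure_induction with
  | mem x hx =>
    obtain ⟨c, -, c', -, rfl⟩ := hx
    obtain ⟨m, rfl⟩ := abProj_surjective c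
    obtain ⟨m', rfl⟩ := abProj_surjective c'
    obtain ⟨u, rfl⟩ := cls_surjective R m
    obtain ⟨v, rfl⟩ := cls_surjective R m'
    exact ⟨⁅u, v⁆, cls_commutator R u v, by rw [foxDer2_commutator, map_sub]; rfl⟩
  | zero =>
    exact ⟨1, cls_one R, by rw [Subgroup.coe_one, map_one, sub_self, map_zero, map_zero]⟩
  | add x y _ _ hx hy =>
    obtain ⟨g, hg, rfl⟩ := hx
    obtain ⟨h, hh, rfl⟩ := hy
    exact ⟨g * h, by rw [cls_mul, hg, hh, add_zero],
      by rw [foxDer2_of_mul, hg, zero_tmul, add_zero, map_add]⟩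
  | neg x _ hx =>
    obtain ⟨g, hg, rfl⟩ := hx
    exact ⟨g⁻¹, by rw [cls_inv, hg, neg_zero], by rw [foxDer2_inv R hg, map_neg]⟩

theorem foxDer1_top_cube {a : MonoidAlgebra ℤ F} (ha : a ∈ aug (⊤ : Subgroup F) ^ 3) :
    foxDer1 (⊤ : Subgroup F) a = 0 := by
  rw [pow_succ'] at ha
  refine foxDer1_of_mem ⊤ (I := aug (⊤ : Subgroup F) ^ 2) (fun b hb => ?_) ha
  rw [pow_two] at hb; exact eps_of_mem_aug_mul hb

/-- The first derivative maps `ℤ[R] ∩ 𝔣³` to the image of `R ∩ γ₃(F)` in `R_ab`. -/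
theorem foxDer1_mem_foxBAb {a : MonoidAlgebra ℤ F} (haR : a ∈ subRing R)
    (ha : a ∈ aug (⊤ : Subgroup F) ^ 3) : foxDer1 R a ∈ foxBAb R := by
  -- Write a = (v - 1) + b with b ∈ Δ(R)². Then v carries the first derivative of a, and the aim is
  -- to move v into γ₃(F) by a factor from γ₂(R).
  obtain ⟨v, hv⟩ := exists_sub_mem_aug_sq haR (eps_of_mem_cube ha)
  have hv1 : foxDer1 R a = cls R v := by
    rw [← sub_eq_zero, ← foxDer1_sub_one, ← map_sub]
    exact foxDer1_aug_sq hv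
  let v' : (⊤ : Subgroup F) := ⟨v, trivial⟩
  have hv2 : cls ⊤ v' = 0 := by
    have h := foxDer1_aug_sq (mul_le_mul' (aug_le_top R) (aug_le_top R) hv)
    rw [map_sub, foxDer1_top_cube ha, zero_sub, neg_eq_zero] at h
    rw [← h]
    exact (foxDer1_sub_one (⊤ : Subgroup F) v').symm
  set b := a - (⟪(v : F)⟫ - 1) with hb
  have hv3 : TensorProduct.map (abIncl R) (abIncl R) (foxDer2 R b) =
      -foxDer2 ⊤ (⟪(v' : F)⟫ - 1) := by
    rw [map_abIncl_foxDer2 hv, hb, map_sub, foxDer2_aug_cube ha, zero_sub]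
  -- Since a ∈ 𝔣³, the second derivative of b over F is minus the leading term of v ∈ γ₂(F), hence
  -- antisymmetric; injectivity brings this down to the image of R_ab.
  have hτ : swap _ (TensorProduct.map (abProj R) (abProj R) (foxDer2 R b)) =
      -TensorProduct.map (abProj R) (abProj R) (foxDer2 R b) := by
    apply map_subtype_injective
    rw [← swap_map, map_neg, map_subtype_map_abProj, hv3, map_neg,
      swap_of_mem_altSq (foxDer2_mem_altSq ⊤ v' hv2)]
  -- The element g ∈ γ₂(R) cancels the leading term of v over F, so vg ∈ γ₃(F), while vg and v have
  -- the same class in R_ab.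
  obtain ⟨g, hg, hg'⟩ := exists_gam_two_of_altSq (mem_altSq_top_of_antisymm hτ)
  refine mem_foxBAb.2 ⟨v * g, ?_, by rw [cls_mul, hg, add_zero, hv1]⟩
  let g' : (⊤ : Subgroup F) := ⟨g, trivial⟩
  refine mem_gam_three_of_foxDer2 ⊤ (v' * g') ?_ ?_
  · rw [cls_mul, hv2, zero_add, cls_eq_zero_iff]
    exact gam_mono le_top 2 ((cls_eq_zero_iff R g).1 hg)
  · rw [foxDer2_of_mul, hv2, zero_tmul, add_zero]
    have h := map_abIncl_foxDer2 (sub_one_mem_aug_sq g hg)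
    rw [← map_subtype_map_abProj, hg', map_subtype_map_abProj, hv3] at h
    rw [← neg_eq_iff_add_eq_zero]
    exact h

/-- A zero first derivative puts a in Δ(R)², where the second derivatives over R and F agree; over F
it vanishes because a ∈ 𝔣³, and the tensor square of the image of R_ab embeds in that of F_ab. -/
theorem map_abProj_foxDer2_eq_zero {a : MonoidAlgebra ℤ F} (haR : a ∈ subRing R)
    (ha : a ∈ aug (⊤ : Subgroup F) ^ 3) (h : foxDer1 R a = 0) :
    TensorProduct.map (abProj R) (abProj R) (foxDer2 R a) = 0 := by
  obtain ⟨v, hv⟩ := exists_sub_mem_aug_sq haR (eps_of_mem_cube ha)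
  have hv1 : cls R v = 0 := by
    rw [← h, ← sub_eq_zero, ← foxDer1_sub_one, ← map_sub, ← neg_eq_zero, ← map_neg, neg_sub]
    exact foxDer1_aug_sq hv
  have ha2 : a ∈ aug R * aug R := by
    have := Submodule.add_mem _ hv (sub_one_mem_aug_sq v hv1)
    rwa [sub_add_cancel] at this
  apply map_subtype_injective
  rw [map_subtype_map_abProj, map_abIncl_foxDer2 ha2, foxDer2_aug_cube ha, map_zero]

end FoxHom

/-! ### The subgroup `W` -/

section FoxW

attribute [local instance] commutatorElement

local notation "⟪" g "⟫" => MonoidAlgebra.of ℤ _ g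

variable {F : Type u} [Group F] {R : Subgroup F}

theorem aug_top_pow_le (n k : ℕ) :
    aug (⊤ : Subgroup F) ^ (n + 1 + k) ≤ aug (⊤ : Subgroup F) ^ (n + 1) := by
  rw [add_comm, pow_add]
  exact Submodule.mul_le.2 fun a _ b hb => mul_mem_aug_top_pow n a hb

theorem cls_zpow (x : R) (m : ℤ) : cls R (x ^ m) = m • cls R x := by
  rw [cls, map_zpow, ofMul_zpow]; rfl

/-- Modulo 𝔣³ one has m(y - 1) ≡ yᵐ - 1 ≡ (r - 1) + (s - 1) ≡ s - 1: the quadratic error lies in 𝔣⁴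
as y ∈ γ₂(F), and r ∈ γ₃(F). -/
theorem smul_sub_one_sub_mem {m : ℤ} {y r s : F} (hy : y ∈ capGam R 2) (hr : r ∈ capGam R 3)
    (h : y ^ m = r * s) :
    m • (⟪y⟫ - 1) - (⟪s⟫ - 1) ∈ aug (⊤ : Subgroup F) ^ 3 := by
  have h1 := aug_top_pow_le 2 1
    (zpow_sub_one_mem y (n := 1) (sub_one_mem_of_mem_gam_top hy.2) m)
  have hr3 : ⟪r⟫ - 1 ∈ aug (⊤ : Subgroup F) ^ 3 := sub_one_mem_of_mem_gam_top hr.2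
  have h2 : (⟪r⟫ - 1) * (⟪s⟫ - 1) ∈ aug (⊤ : Subgroup F) ^ 3 := by
    refine aug_top_pow_le 2 1 ?_
    rw [pow_succ]
    exact Submodule.mul_mem_mul hr3 (sub_one_mem_aug trivial)
  rw [h, of_mul_sub_one] at h1
  convert Submodule.sub_mem _ (Submodule.add_mem _ h2 hr3) h1 using 1
  abel

variable (R) in
/-- The homomorphism `w ↦ w - 1` from `F(2, R)` to `ℤ[F]` modulo `𝔯𝔣³`. -/
def foxSuccHom : Additive (foxSucc R 1) →+ MonoidAlgebra ℤ F ⧸ foxIdeal R 3 :=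
  AddMonoidHom.mk' (fun w => (foxIdeal R 3).mkQ (⟪(w.toMul : F)⟫ - 1)) fun x y => by
    have h : (⟪(x.toMul : F)⟫ - 1) * (⟪(y.toMul : F)⟫ - 1) ∈ foxIdeal R 3 := by
      rw [foxIdeal, pow_succ, ← mul_assoc]
      exact Submodule.mul_mem_mul x.toMul.2 (sub_one_mem_aug trivial)
    have h0 : (foxIdeal R 3).mkQ _ = 0 := (Submodule.Quotient.mk_eq_zero _).2 h
    rw [toMul_add, Subgroup.coe_mul, of_mul_sub_one, map_add, map_add, h0, zero_add]

/-- The trailing unit in `of_commutator_sub_one` changes an element of 𝔯𝔣² only by an element of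
𝔯𝔣³. -/
theorem foxSuccHom_commutator {g h : F} (hgh : (⟪g⟫ - 1) * (⟪h⟫ - 1) ∈ foxIdeal R 2)
    (hhg : (⟪h⟫ - 1) * (⟪g⟫ - 1) ∈ foxIdeal R 2) (hm : ⁅g, h⁆ ∈ foxSucc R 1) :
    foxSuccHom R (Additive.ofMul ⟨_, hm⟩) = (foxIdeal R 3).mkQ
      ((⟪g⟫ - 1) * (⟪h⟫ - 1) - (⟪h⟫ - 1) * (⟪g⟫ - 1)) := by
  refine (congrArg (foxIdeal R 3).mkQ (of_commutator_sub_one g h)).trans ?_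
  rw [← sub_eq_zero, ← map_sub]
  refine (Submodule.Quotient.mk_eq_zero _).2 ?_
  rw [← mul_sub_one, foxIdeal, pow_succ, ← mul_assoc]
  exact Submodule.mul_mem_mul (Submodule.sub_mem _ hgh hhg) (sub_one_mem_aug trivial)

theorem mem_fox3_of_foxSuccHom {w : foxSucc R 1} (hw : foxSuccHom R (Additive.ofMul w) = 0) :
    (w : F) ∈ fox3 R :=
  (Submodule.Quotient.mk_eq_zero (foxIdeal R 3)).1 hw

theorem sub_one_mul_sub_one_mem_foxIdeal {g h : F} {i j k : ℕ}
    (hg : ⟪g⟫ - 1 ∈ aug R * aug (⊤ : Subgroup F) ^ i) (hh : ⟪h⟫ - 1 ∈ aug (⊤ : Subgroup F) ^ j)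
    (hij : i + j = k) : (⟪g⟫ - 1) * (⟪h⟫ - 1) ∈ foxIdeal R k := by
  rw [foxIdeal, ← hij, pow_add, ← mul_assoc]
  exact Submodule.mul_mem_mul hg hh

variable [R.Normal]

/-- With X = x - 1, Y = y - 1, X' = s_x - 1, Y' = s_y - 1, the generator minus 1 is, modulo 𝔯𝔣³,
X(mY - Y') - Y(mX - X') + Y'X - X'Y. The first two terms lie in 𝔯𝔣³ by `smul_sub_one_sub_mem`, the
last two because s_x, s_y ∈ γ₂(R) and x, y ∈ γ₂(F). -/
theorem foxW_generator_mem {m : ℤ} {x y rx sx ry sy : F} (hx : x ∈ capGam R 2)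
    (hy : y ∈ capGam R 2) (hrx : rx ∈ capGam R 3) (hsx : sx ∈ gam R 2) (hxm : x ^ m = rx * sx)
    (hry : ry ∈ capGam R 3) (hsy : sy ∈ gam R 2) (hym : y ^ m = ry * sy) :
    ⁅x, y⁆ ^ m * ⁅x, sy⁆⁻¹ * ⁅y, sx⁆ ∈ fox3 R := by
  have hR {g : F} (hg : g ∈ capGam R 2) := sub_one_mem_of_mem hg.1
  have hF {g : F} (hg : g ∈ capGam R 2) : ⟪g⟫ - 1 ∈ aug (⊤ : Subgroup F) ^ 2 :=
    sub_one_mem_of_mem_gam_top hg.2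
  have hs {s : F} (hs : s ∈ gam R 2) : s ∈ capGam R 2 := ⟨gam_le R 2 hs, gam_mono le_top 2 hs⟩
  have hp {g h : F} (hg : g ∈ capGam R 2) (hh : h ∈ capGam R 2) :
      (⟪g⟫ - 1) * (⟪h⟫ - 1) ∈ foxIdeal R 2 := sub_one_mul_sub_one_mem_foxIdeal (hR hg) (hF hh) rfl
  have hc {g h : F} (hg : g ∈ capGam R 2) (hh : h ∈ capGam R 2) : ⁅g, h⁆ ∈ foxSucc R 1 :=
    commutator_mem_foxSucc (hR hg) (hF hh) (hR hh) (hF hg) rfl rfl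
  have hsp {s g : F} (hs : s ∈ gam R 2) (hg : g ∈ capGam R 2) :
      (⟪s⟫ - 1) * (⟪g⟫ - 1) ∈ foxIdeal R 3 :=
    sub_one_mul_sub_one_mem_foxIdeal (sub_one_mem_of_mem_gam 1 s hs) (hF hg) rfl
  have hm {g h r s : F} (hg : g ∈ capGam R 2) (hh : h ∈ capGam R 2) (hr : r ∈ capGam R 3)
      (hhm : h ^ m = r * s) :
      (⟪g⟫ - 1) * (m • (⟪h⟫ - 1) - (⟪s⟫ - 1)) ∈ foxIdeal R 3 :=
    Submodule.mul_mem_mul (sub_one_mem_aug hg.1) (smul_sub_one_sub_mem hh hr hhm)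
  let a : foxSucc R 1 := ⟨_, hc hx hy⟩
  let b : foxSucc R 1 := ⟨_, hc hx (hs hsy)⟩
  let c : foxSucc R 1 := ⟨_, hc hy (hs hsx)⟩
  have key : foxSuccHom R (Additive.ofMul (a ^ m * b⁻¹ * c)) = 0 := by
    rw [ofMul_mul, ofMul_mul, ofMul_zpow, ofMul_inv, map_add, map_add, map_neg, map_zsmul,
      foxSuccHom_commutator (hp hx hy) (hp hy hx), foxSuccHom_commutator (hp hx (hs hsy))
      (hp (hs hsy) hx), foxSuccHom_commutator (hp hy (hs hsx)) (hp (hs hsx) hy), ← map_zsmul,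
      ← map_neg, ← map_add, ← map_add]
    refine (Submodule.Quotient.mk_eq_zero _).2 ?_
    convert Submodule.sub_mem _ (Submodule.add_mem _ (Submodule.sub_mem _ (hm hx hy hry hym)
      (hm hy hx hrx hxm)) (hsp hsy hx)) (hsp hsx hy) using 1
    generalize ⟪x⟫ - 1 = X, ⟪y⟫ - 1 = Y, ⟪sx⟫ - 1 = X', ⟪sy⟫ - 1 = Y'
    rw [mul_sub, mul_sub, smul_sub, mul_smul_comm, mul_smul_comm]
    abel
  have h := mem_fox3_of_foxSuccHom key
  rwa [Subgroup.coe_mul, Subgroup.coe_mul, Subgroup.coe_zpow, Subgroup.coe_inv] at h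

theorem foxW_le_fox3 (R : Subgroup F) [R.Normal] : foxW R ≤ fox3 R := by
  rw [foxW, Subgroup.closure_le]
  rintro _ ⟨m, x, y, rx, sx, ry, sy, hx, hy, hrx, hsx, hxm, hry, hsy, hym, rfl⟩
  exact foxW_generator_mem hx hy hrx hsx hxm hry hsy hym

end FoxW

/-! ### The quotient `F(3, R) / G(3, R)` as a Koszul homology group -/

section FoxQuotient

attribute [local instance] commutatorElement

local notation "⟪" g "⟫" => MonoidAlgebra.of ℤ _ g

variable {F : Type u} [Group F] [IsFreeGroup F] {R : Subgroup F}

/-- These coordinates are the Fox derivatives ∂ᵢw with respect to the free generators of R.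
Everything about F(3,R) is extracted from their lying in ℤ[R] ∩ 𝔣³. -/
theorem tensorCoord_foxCross_mem (w : R) (hw : (w : F) ∈ fox3 R) (i : IsFreeGroup.Generators R) :
    tensorCoord (genBasis R) _ i (foxCross R w) ∈ subRing R ∧
      tensorCoord (genBasis R) _ i (foxCross R w) ∈ aug (⊤ : Subgroup F) ^ 3 := by
  refine ⟨tensorCoord_mem _ (foxCross_mem R w) i, ?_⟩
  have h := foxD_mem R 2 hw
  rw [foxD_sub_one] at h
  exact tensorCoord_mem _ h i

theorem tensorCoord_foxDer2 (w : R) (i : IsFreeGroup.Generators R) :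
    tensorCoord (genBasis R) _ i (foxDer2 R (⟪(w : F)⟫ - 1)) =
      foxDer1 R (tensorCoord (genBasis R) _ i (foxCross R w)) := by
  rw [← tensorCoord_lTensor, ← foxD_sub_one]
  rfl

theorem tensorCoord_foxDer3 (w : R) (i : IsFreeGroup.Generators R) :
    tensorCoord (genBasis R) _ i (foxDer3 R (abProj R) (⟪(w : F)⟫ - 1)) =
      TensorProduct.map (abProj R) (abProj R)
        (foxDer2 R (tensorCoord (genBasis R) _ i (foxCross R w))) := by
  rw [← foxD_sub_one]
  exact tensorCoord_lTensor _ (TensorProduct.map (abProj R) (abProj R) ∘ₗ foxDer2 R) i _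

theorem cls_eq_zero_of_mem_fox3 (w : R) (hw : (w : F) ∈ fox3 R) : cls R w = 0 := by
  rw [← foxDer1_sub_one]
  exact foxDer1_of_mem R (fun b hb => eps_of_mem_cube hb) hw

theorem foxDer2_mem_koszulZ (w : R) (hw : (w : F) ∈ fox3 R) :
    foxDer2 R (⟪(w : F)⟫ - 1) ∈ koszulZ (foxBAb R) := by
  refine AddSubgroup.mem_inf.2 ⟨foxDer2_mem_altSq R w (cls_eq_zero_of_mem_fox3 w hw),
    mem_tensR_of_tensorCoord (genBasis R) fun i => ?_⟩
  rw [tensorCoord_foxDer2]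
  exact foxDer1_mem_foxBAb (tensorCoord_foxCross_mem w hw i).1 (tensorCoord_foxCross_mem w hw i).2

/-- F_ab is torsion-free, so m x ∈ B with m ≠ 0 forces x into γ₂(F). Generators of the cycles thus
yield the data in the definition of W. -/
theorem exists_of_smul_cls_mem {m : ℤ} (hm : m ≠ 0) {x : R} (h : m • cls R x ∈ foxBAb R) :
    (x : F) ∈ capGam R 2 ∧ ∃ r ∈ capGam R 3, ∃ s ∈ gam R 2, (x : F) ^ m = r * s := by
  obtain ⟨r, hr, hrx⟩ := mem_foxBAb.1 h
  constructor
  · refine ⟨x.2, (abIncl_cls_eq_zero x).1 ((smul_eq_zero.1 ?_).resolve_left hm)⟩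
    rw [← map_smul, ← hrx, abIncl_cls_eq_zero]
    exact Subgroup.commutator_le_left (gam ⊤ 2) ⊤ hr
  · refine ⟨r, ⟨r.2, hr⟩, ((r⁻¹ * x ^ m : R) : F), ?_, by simp⟩
    rw [← cls_eq_zero_iff, cls_mul, cls_inv, cls_zpow, hrx, neg_add_cancel]

theorem fox3_le_gam (R : Subgroup F) [R.Normal] : fox3 R ≤ gam R 2 := fun w hw =>
  (cls_eq_zero_iff R ⟨w, mem_of_mem_foxSucc hw⟩).1 (cls_eq_zero_of_mem_fox3 _ hw)

variable [R.Normal]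

variable (R) in
/-- The homomorphism `γ₂(R) → R_ab ⊗ R_ab`, with `[u, v] ↦ u ⊗ v - v ⊗ u`. -/
def foxDer2Hom : Additive (gam R 2) →+ AbM R ⊗[ℤ] AbM R :=
  AddMonoidHom.mk' (fun w => foxDer2 R (⟪(w.toMul : F)⟫ - 1)) fun x y => by
    have h := foxDer2_of_mul R ⟨_, gam_le R 2 x.toMul.2⟩ ⟨_, gam_le R 2 y.toMul.2⟩
    rw [(cls_eq_zero_iff R _).2 x.toMul.2, zero_tmul, add_zero] at h
    exact h

theorem foxDer2Hom_commutator (u v : R) (h : ⁅(u : F), (v : F)⁆ ∈ gam R 2) :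
    foxDer2Hom R (Additive.ofMul ⟨_, h⟩) = cls R u ⊗ₜ cls R v - cls R v ⊗ₜ cls R u :=
  foxDer2_commutator R u v

theorem foxDer2_eq_zero_of_mem (w : F) (hw : w ∈ gam R 3) : foxDer2 R (⟪w⟫ - 1) = 0 := by
  have key : gam R 3 ≤ ((foxDer2Hom R).ker.toSubgroup').map (gam R 2).subtype := by
    refine Subgroup.commutator_le.2 fun g hg z hz => ?_
    have h : ⁅g, z⁆ ∈ gam R 2 := Subgroup.commutator_mem_commutator (gam_le R 2 hg) hz
    refine ⟨⟨_, h⟩, ?_, rfl⟩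
    refine (foxDer2Hom_commutator ⟨g, gam_le R 2 hg⟩ ⟨z, hz⟩ h).trans ?_
    rw [(cls_eq_zero_iff R ⟨g, gam_le R 2 hg⟩).2 hg, zero_tmul, tmul_zero, sub_self]
  obtain ⟨w', hw', rfl⟩ := key hw
  exact hw'

variable (R) in
/-- The homomorphism on `F(3, R)` that sends `w` to the leading term of `w - 1` in
`R_ab ⊗ R_ab`. -/
def foxHom : Additive (fox3 R) →+ koszulZ (foxBAb R) :=
  AddMonoidHom.codRestrict
    ((foxDer2Hom R).comp (MonoidHom.toAdditive (Subgroup.inclusion (fox3_le_gam R)))) _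
    fun w => foxDer2_mem_koszulZ (R := R) ⟨w.toMul, mem_of_mem_foxSucc (n := 2) w.toMul.2⟩
      w.toMul.2

theorem foxHom_apply (w : fox3 R) :
    (foxHom R (Additive.ofMul w) : AbM R ⊗[ℤ] AbM R) = foxDer2 R (⟪(w : F)⟫ - 1) := rfl

theorem exists_foxG3_of_altSq {t : AbM R ⊗[ℤ] AbM R} (ht : t ∈ altSq (foxBAb R)) :
    ∃ g : fox3 R, (g : F) ∈ foxG3 R ∧ (foxHom R (Additive.ofMul g) : AbM R ⊗[ℤ] AbM R) = t := by
  induction ht using AddSubgroup.closure_induction with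
  | mem x hx =>
    obtain ⟨b, hb, b', hb', rfl⟩ := hx
    obtain ⟨u, hu, rfl⟩ := mem_foxBAb.1 hb
    obtain ⟨v, hv, rfl⟩ := mem_foxBAb.1 hb'
    have hg : ⁅(u : F), (v : F)⁆ ∈ foxG3 R := Subgroup.mem_sup_left (Subgroup.mem_sup_left
      (Subgroup.commutator_mem_commutator (H₁ := capGam R 3) (H₂ := capGam R 3)
        ⟨u.2, hu⟩ ⟨v.2, hv⟩))
    exact ⟨⟨_, foxG3_le_fox3 R hg⟩, hg, foxDer2_commutator R u v⟩
  | zero => exact ⟨1, Subgroup.one_mem _, congrArg Subtype.val (map_zero (foxHom R))⟩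
  | add x y _ _ hx hy =>
    obtain ⟨g, hg, rfl⟩ := hx
    obtain ⟨h, hh, rfl⟩ := hy
    exact ⟨g * h, Subgroup.mul_mem _ hg hh, congrArg Subtype.val
      (map_add (foxHom R) (Additive.ofMul g) (Additive.ofMul h))⟩
  | neg x _ hx =>
    obtain ⟨g, hg, rfl⟩ := hx
    exact ⟨g⁻¹, Subgroup.inv_mem _ hg, congrArg Subtype.val
      (map_neg (foxHom R) (Additive.ofMul g))⟩

/-- Now w ∈ γ₃(R), and every ∂ᵢw has zero first derivative. By `map_abProj_foxDer2_eq_zero` the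
projected second derivatives of the ∂ᵢw vanish; they are the coordinates of the third derivative of
w. -/
theorem mem_foxG3_of_foxDer2_eq_zero (w : R) (hw : (w : F) ∈ fox3 R)
    (h : foxDer2 R (⟪(w : F)⟫ - 1) = 0) : (w : F) ∈ foxG3 R := by
  have h3 := mem_gam_three_of_foxDer2 R w (cls_eq_zero_of_mem_fox3 w hw) h
  refine mem_of_foxDer3_eq_zero R (abProj R) abProj_surjective (foxG3 R) le_sup_right
    (fun x y z hx hz => ?_) w h3 ?_
  · rw [abProj_cls_eq_zero] at hx hz
    exact Subgroup.mem_sup_left (Subgroup.mem_sup_right (Subgroup.commutator_mem_commutator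
      (Subgroup.commutator_mem_commutator (H₁ := capGam R 2) ⟨x.2, hx⟩ y.2)
      (show (z : F) ∈ capGam R 2 from ⟨z.2, hz⟩)))
  · refine eq_zero_of_tensorCoord (genBasis R) fun i => ?_
    rw [tensorCoord_foxDer3]
    refine map_abProj_foxDer2_eq_zero (tensorCoord_foxCross_mem w hw i).1
      (tensorCoord_foxCross_mem w hw i).2 ?_
    rw [← tensorCoord_foxDer2, h, map_zero]

theorem mem_foxG3_of_foxHom_eq_zero (w : fox3 R) (h : foxHom R (Additive.ofMul w) = 0) :
    (w : F) ∈ foxG3 R := by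
  refine mem_foxG3_of_foxDer2_eq_zero (R := R) ⟨w, mem_of_mem_foxSucc (n := 2) w.2⟩ w.2 ?_
  rw [← foxHom_apply, h]
  rfl

theorem mem_foxG3_of_foxHom_mem (w : fox3 R)
    (h : (foxHom R (Additive.ofMul w) : AbM R ⊗[ℤ] AbM R) ∈ altSq (foxBAb R)) :
    (w : F) ∈ foxG3 R := by
  obtain ⟨g, hg, hgw⟩ := exists_foxG3_of_altSq h
  have h1 : foxHom R (Additive.ofMul (g⁻¹ * w)) = 0 := by
    have h2 : foxHom R (Additive.ofMul w) = foxHom R (Additive.ofMul g) := Subtype.ext hgw.symm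
    rw [ofMul_mul, ofMul_inv, map_add, map_neg, h2, neg_add_cancel]
  have h2 := mem_foxG3_of_foxHom_eq_zero (g⁻¹ * w) h1
  have h3 := Subgroup.mul_mem _ hg h2
  rwa [Subgroup.coe_mul, Subgroup.coe_inv, mul_inv_cancel_left] at h3

/-- γ₂(R ∩ γ₃(F)) has leading terms in Λ²(B); the other two factors lie in γ₃(R), where the leading
term is zero. -/
theorem foxHom_mem_of_mem_foxG3 (w : fox3 R) (hw : (w : F) ∈ foxG3 R) :
    (foxHom R (Additive.ofMul w) : AbM R ⊗[ℤ] AbM R) ∈ altSq (foxBAb R) := by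
  let K : AddSubgroup (koszulZ (foxBAb R)) := (altSq (foxBAb R)).addSubgroupOf _
  let L : Subgroup F := ((K.comap (foxHom R)).toSubgroup').map (fox3 R).subtype
  have key : foxG3 R ≤ L := by
    have hL (g : F) (hg : g ∈ foxG3 R)
        (h : foxDer2 R (⟪g⟫ - 1) ∈ altSq (foxBAb R)) : g ∈ L :=
      ⟨⟨g, foxG3_le_fox3 R hg⟩, h, rfl⟩
    have h3 (g : F) (hg : g ∈ foxG3 R) (h : g ∈ gam R 3) : g ∈ L :=
      hL g hg (by rw [foxDer2_eq_zero_of_mem g h]; exact AddSubgroup.zero_mem _)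
    refine sup_le (sup_le ?_ fun g hg => ?_) fun g hg => ?_
    · refine Subgroup.commutator_le.2 fun u hu v hv => hL _ ?_ ?_
      · exact Subgroup.mem_sup_left (Subgroup.mem_sup_left
          (Subgroup.commutator_mem_commutator hu hv))
      · refine (foxDer2_commutator R ⟨u, hu.1⟩ ⟨v, hv.1⟩).symm ▸ ?_
        exact AddSubgroup.subset_closure
          ⟨_, mem_foxBAb.2 ⟨_, hu.2, rfl⟩, _, mem_foxBAb.2 ⟨_, hv.2, rfl⟩, rfl⟩
    · refine h3 g (Subgroup.mem_sup_left (Subgroup.mem_sup_right hg)) ?_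
      exact Subgroup.commutator_mono (Subgroup.commutator_mono inf_le_left le_rfl) inf_le_left hg
    · refine h3 g (Subgroup.mem_sup_right hg) ?_
      have : (gam R 3).Normal := inferInstance
      exact Subgroup.commutator_le_left (gam R 3) R hg
  obtain ⟨w', hw', h⟩ := key hw
  rw [← Subtype.ext h]
  exact hw'

theorem exists_foxW_of_tauSub {t : AbM R ⊗[ℤ] AbM R} (ht : t ∈ tauSub (foxBAb R)) :
    ∃ w : fox3 R, (w : F) ∈ foxW R ∧ (foxHom R (Additive.ofMul w) : AbM R ⊗[ℤ] AbM R) = t := by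
  induction ht using AddSubgroup.closure_induction with
  | mem t ht =>
    obtain ⟨m, c, d, hc, hd, rfl⟩ := ht
    -- For m = 0 nothing forces x and y into γ₂(F), but the tensor is zero.
    rcases eq_or_ne m 0 with rfl | hm
    · exact ⟨1, Subgroup.one_mem _, by rw [zero_smul]; exact congrArg Subtype.val (map_zero (foxHom R))⟩
    obtain ⟨x, rfl⟩ := cls_surjective R c
    obtain ⟨y, rfl⟩ := cls_surjective R d
    obtain ⟨hx, rx, hrx, sx, hsx, hxm⟩ := exists_of_smul_cls_mem hm hc
    obtain ⟨hy, ry, hry, sy, hsy, hym⟩ := exists_of_smul_cls_mem hm hd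
    refine ⟨⟨_, foxW_generator_mem hx hy hrx hsx hxm hry hsy hym⟩,
      Subgroup.subset_closure ⟨m, x, y, rx, sx, ry, sy, hx, hy, hrx, hsx, hxm, hry, hsy, hym, rfl⟩,
      ?_⟩
    have hc (u v : R) : ⁅(u : F), (v : F)⁆ ∈ gam R 2 :=
      Subgroup.commutator_mem_commutator u.2 v.2
    have hsx' : cls R ⟨sx, gam_le R 2 hsx⟩ = 0 := (cls_eq_zero_iff R _).2 hsx
    have hsy' : cls R ⟨sy, gam_le R 2 hsy⟩ = 0 := (cls_eq_zero_iff R _).2 hsy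
    let a : gam R 2 := ⟨_, hc x y⟩
    let b : gam R 2 := ⟨_, hc x ⟨sy, gam_le R 2 hsy⟩⟩
    let c : gam R 2 := ⟨_, hc y ⟨sx, gam_le R 2 hsx⟩⟩
    -- The correcting commutators involve s_x, s_y ∈ γ₂(R), so they do not affect the leading term.
    change foxDer2Hom R (Additive.ofMul (a ^ m * b⁻¹ * c)) = _
    rw [ofMul_mul, ofMul_mul, ofMul_zpow, ofMul_inv, map_add, map_add, map_neg, map_zsmul,
      foxDer2Hom_commutator, foxDer2Hom_commutator, foxDer2Hom_commutator, hsx', hsy', zero_tmul,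
      tmul_zero, zero_tmul, tmul_zero, sub_self, neg_zero, add_zero, add_zero]
  | zero => exact ⟨1, Subgroup.one_mem _, congrArg Subtype.val (map_zero (foxHom R))⟩
  | add x y _ _ hx hy =>
    obtain ⟨g, hg, rfl⟩ := hx
    obtain ⟨h, hh, rfl⟩ := hy
    exact ⟨g * h, Subgroup.mul_mem _ hg hh, congrArg Subtype.val
      (map_add (foxHom R) (Additive.ofMul g) (Additive.ofMul h))⟩
  | neg x _ hx =>
    obtain ⟨g, hg, rfl⟩ := hx
    exact ⟨g⁻¹, Subgroup.inv_mem _ hg, congrArg Subtype.val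
      (map_neg (foxHom R) (Additive.ofMul g))⟩

open scoped Pointwise in
theorem fox3_eq_foxG3_mul_foxW (R : Subgroup F) [R.Normal] :
    (fox3 R : Set F) = (foxG3 R : Set F) * (foxW R : Set F) := by
  refine Set.Subset.antisymm (fun w hw => ?_) ?_
  · let w' : fox3 R := ⟨w, hw⟩
    obtain ⟨v, hv, hvw⟩ := exists_foxW_of_tauSub
      (koszulZ_le_tauSub (foxBAb R) (foxHom R (Additive.ofMul w')).2)
    have h1 : foxHom R (Additive.ofMul v) = foxHom R (Additive.ofMul w') := Subtype.ext hvw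
    have h2 : foxHom R (Additive.ofMul (w' * v⁻¹)) = 0 := by
      rw [ofMul_mul, ofMul_inv, map_add, map_neg, h1, add_neg_cancel]
    refine Set.mem_mul.2 ⟨((w' * v⁻¹ : fox3 R) : F), mem_foxG3_of_foxHom_mem _ ?_, v, hv, ?_⟩
    · rw [h2]; exact AddSubgroup.zero_mem _
    · rw [← Subgroup.coe_mul, inv_mul_cancel_right]
  · rintro _ ⟨g, hg, v, hv, rfl⟩
    exact Subgroup.mul_mem _ (foxG3_le_fox3 R hg) (foxW_le_fox3 R hv)

/-! ### The isomorphism -/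

variable (R) in
/-- The homomorphism from `F(3, R) / G(3, R)` to the Koszul homology of the image of `R ∩ γ₃(F)` in
`R_ab`. -/
def foxQuotHom : FoxQuot R →* Multiplicative (KoszulH (foxBAb R)) :=
  QuotientGroup.lift _ (AddMonoidHom.toMultiplicativeRight
    ((QuotientAddGroup.mk' _).comp (foxHom R))) fun w hw =>
      (QuotientAddGroup.eq_zero_iff _).2 (foxHom_mem_of_mem_foxG3 w hw)

theorem foxQuotHom_mk (w : fox3 R) : foxQuotHom R (w : FoxQuot R) =
    Multiplicative.ofAdd (foxHom R (Additive.ofMul w) : KoszulH (foxBAb R)) := rfl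

theorem foxQuotHom_bijective : Function.Bijective (foxQuotHom R) := by
  constructor
  · refine (injective_iff_map_eq_one _).2 fun w hw => ?_
    induction w using QuotientGroup.induction_on with | H w => ?_
    exact (QuotientGroup.eq_one_iff w).2 (mem_foxG3_of_foxHom_mem w
      ((QuotientAddGroup.eq_zero_iff (foxHom R (Additive.ofMul w))).1 hw))
  · intro t
    obtain ⟨t, rfl⟩ := Multiplicative.ofAdd.surjective t
    induction t using QuotientAddGroup.induction_on with | H t => ?_
    obtain ⟨w, -, hw⟩ := exists_foxW_of_tauSub (koszulZ_le_tauSub (foxBAb R) t.2)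
    refine ⟨(w : FoxQuot R), ?_⟩
    rw [foxQuotHom_mk]
    exact congrArg (fun s : koszulZ (foxBAb R) => Multiplicative.ofAdd (s : KoszulH (foxBAb R)))
      (Subtype.ext hw)

end FoxQuotient

/-! ### Comparison of presentations -/

section Comparison

variable {A M K C : Type u} [AddCommGroup A] [AddCommGroup M] [AddCommGroup K] [AddCommGroup C]
  {B₀ : AddSubgroup A} {B : AddSubgroup M}

theorem mem_of_mk_comp_eq {π : A →ₗ[ℤ] K} {j : K →+ M ⧸ B} {θ : A →ₗ[ℤ] M}
    (hπ : ∀ a, π a = 0 ↔ a ∈ B₀) (hθ : ∀ a, (θ a : M ⧸ B) = j (π a)) (a : A) (ha : a ∈ B₀) :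
    θ a ∈ B := by
  rw [← QuotientAddGroup.eq_zero_iff, hθ, (hπ a).2 ha, map_zero]

/-- M/B is an extension of the free group C by K. The projection `e` of M onto ker p is the identity
on B, hence acts trivially on `KoszulH B` by `koszulMap_of_eqOn`, although it is not congruent to
the identity. Lifting `e` through the presentation of K gives `q`, with q ∘ θ ≡ 1 modulo B₀ and θ ∘
q ≡ e modulo B. -/
theorem koszulMap_bijective [Module.Free ℤ A] [Module.Free ℤ M] [Module.Free ℤ C]
    {π : A →ₗ[ℤ] K} (hπs : Function.Surjective π) (hπ : ∀ a, π a = 0 ↔ a ∈ B₀)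
    {p : M →ₗ[ℤ] C} (hp : Function.Surjective p)
    {j : K →+ M ⧸ B} (hj : Function.Injective j)
    (hjp : ∀ m : M, p m = 0 ↔ ∃ k, j k = (m : M ⧸ B))
    (θ : A →ₗ[ℤ] M) (hθ : ∀ a, (θ a : M ⧸ B) = j (π a)) :
    Function.Bijective (koszulMap θ (mem_of_mk_comp_eq hπ hθ)) := by
  obtain ⟨s, hs⟩ := Module.projective_lifting_property p LinearMap.id hp
  have hs' (c : C) : p (s c) = c := LinearMap.congr_fun hs c
  let e : M →ₗ[ℤ] M := LinearMap.id - s ∘ₗ p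
  have he (m : M) : e m = m - s (p m) := rfl
  have he0 (m : M) : p (e m) = 0 := by rw [he, map_sub, hs', sub_self]
  have he1 (m : M) (hm : p m = 0) : e m = m := by rw [he, hm, map_zero, sub_zero]
  have hB (m : M) (hm : m ∈ B) : p m = 0 :=
    (hjp m).2 ⟨0, by rw [map_zero, (QuotientAddGroup.eq_zero_iff m).2 hm]⟩
  choose a ha using fun i => (hjp (e (Module.Free.chooseBasis ℤ M i))).1 (he0 _)
  choose a' ha' using fun i => hπs (a i)
  let q : M →ₗ[ℤ] A := (Module.Free.chooseBasis ℤ M).constr ℤ a'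
  have hq (m : M) : j (π (q m)) = (e m : M ⧸ B) := by
    have : (j.comp π.toAddMonoidHom).toIntLinearMap ∘ₗ q =
        (QuotientAddGroup.mk' B).toIntLinearMap ∘ₗ e := by
      refine (Module.Free.chooseBasis ℤ M).ext fun i => ?_
      have h1 : q (Module.Free.chooseBasis ℤ M i) = a' i :=
        (Module.Free.chooseBasis ℤ M).constr_basis ℤ a' i
      change j (π (q (Module.Free.chooseBasis ℤ M i))) = _
      rw [h1, ha', ha]
      rfl
    exact LinearMap.congr_fun this m
  have hqB (b : M) (hb : b ∈ B) : q b ∈ B₀ := by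
    rw [← hπ]
    refine hj ?_
    rw [hq, he1 b (hB b hb), map_zero, (QuotientAddGroup.eq_zero_iff b).2 hb]
  have hqθ (x : A) : q (θ x) - x ∈ B₀ := by
    rw [← hπ, map_sub, sub_eq_zero]
    refine hj ?_
    rw [hq, he1, hθ]
    exact (hjp _).2 ⟨π x, (hθ x).symm⟩
  have hθq (m : M) : θ (q m) - e m ∈ B := by
    rw [← QuotientAddGroup.eq_zero_iff, QuotientAddGroup.mk_sub, hθ, hq, sub_self]
  refine Function.bijective_iff_has_inverse.2 ⟨koszulMap q hqB, fun x => ?_, fun x => ?_⟩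
  · rw [koszulMap_comp]
    exact koszulMap_id _ _ hqθ x
  · rw [koszulMap_comp]
    have he2 (b : M) (hb : b ∈ B) : e b = b := he1 b (hB b hb)
    rw [koszulMap_eq (θ.comp q) e _ (fun b hb => (he2 b hb).symm ▸ hb) hθq]
    exact koszulMap_of_eqOn e he2 x

end Comparison

/-! ### The presentation of `(R ∩ γ₂(F)) / (γ₂(R) (R ∩ γ₃(F)))` by `R_ab` -/

section FoxK

variable {F : Type u} [Group F] {R : Subgroup F}

theorem cls_mem_foxBAb [R.Normal] (u : R) : cls R u ∈ foxBAb R ↔ (u : F) ∈ foxB R := by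
  constructor
  · intro h
    obtain ⟨r, hr, hru⟩ := mem_foxBAb.1 h
    have h1 : ((u * r⁻¹ : R) : F) ∈ gam R 2 := by
      rw [← cls_eq_zero_iff, cls_mul, cls_inv, hru, add_neg_cancel]
    have h2 : (u : F) = ((u * r⁻¹ : R) : F) * r := by simp
    rw [h2]
    exact Subgroup.mul_mem _ (Subgroup.mem_sup_left h1)
      (Subgroup.mem_sup_right (show (r : F) ∈ capGam R 3 from ⟨r.2, hr⟩))
  · have key : foxB R ≤ ((foxBAb R).toSubgroup'.comap Abelianization.of).map R.subtype := by
      refine sup_le (fun g hg => ?_) fun g hg => ?_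
      · refine ⟨⟨g, gam_le R 2 hg⟩, ?_, rfl⟩
        have h : cls R ⟨g, gam_le R 2 hg⟩ = 0 := (cls_eq_zero_iff R _).2 hg
        have h' := (foxBAb R).zero_mem
        rw [← h] at h'
        exact h'
      · exact ⟨⟨g, hg.1⟩, mem_foxBAb.2 ⟨_, hg.2, rfl⟩, rfl⟩
    intro h
    obtain ⟨v, hv, hvu⟩ := key h
    rw [← Subtype.ext hvu]
    exact hv

variable (R) in
/-- The injection of `(R ∩ γ₂(F)) / (γ₂(R) (R ∩ γ₃(F)))` into the quotient of `R_ab` by the image of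
`R ∩ γ₃(F)`. -/
def foxKIncl [R.Normal] : Additive (FoxK R) →+ AbM R ⧸ foxBAb R :=
  MonoidHom.toAdditiveLeft (QuotientGroup.lift _
    (MonoidHom.mk' (fun u : capGam R 2 =>
      Multiplicative.ofAdd (cls R ⟨u, u.2.1⟩ : AbM R ⧸ foxBAb R)) fun x y => by
        rw [← ofAdd_add, ← QuotientAddGroup.mk_add, ← cls_mul]; rfl)
    fun u hu => (QuotientAddGroup.eq_zero_iff _).2 ((cls_mem_foxBAb _).2 hu))

theorem foxKIncl_mk [R.Normal] (u : capGam R 2) :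
    foxKIncl R (Additive.ofMul (u : FoxK R)) = (cls R ⟨u, u.2.1⟩ : AbM R ⧸ foxBAb R) := rfl

theorem foxKIncl_injective [R.Normal] : Function.Injective (foxKIncl R) := by
  refine (injective_iff_map_eq_zero _).2 fun k hk => ?_
  obtain ⟨k, rfl⟩ := Additive.ofMul.surjective k
  induction k using QuotientGroup.induction_on with | H u => ?_
  exact congrArg Additive.ofMul ((QuotientGroup.eq_one_iff u).2
    ((cls_mem_foxBAb _).1 ((QuotientAddGroup.eq_zero_iff _).1 hk)))

/-- The kernel of R_ab → F_ab is (R ∩ γ₂(F))/γ₂(R); dividing it by B gives `FoxK R`. -/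
theorem abProj_eq_zero_iff [R.Normal] (m : AbM R) :
    abProj R m = 0 ↔ ∃ k, foxKIncl R k = (m : AbM R ⧸ foxBAb R) := by
  obtain ⟨u, rfl⟩ := cls_surjective R m
  rw [abProj_cls_eq_zero]
  constructor
  · exact fun hu => ⟨Additive.ofMul ((⟨u, u.2, hu⟩ : capGam R 2) : FoxK R), rfl⟩
  · rintro ⟨k, hk⟩
    obtain ⟨k, rfl⟩ := Additive.ofMul.surjective k
    induction k using QuotientGroup.induction_on with | H v => ?_
    rw [foxKIncl_mk, QuotientAddGroup.eq, ← cls_inv, ← cls_mul] at hk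
    have h3 : foxB R ≤ gam (⊤ : Subgroup F) 2 := sup_le (gam_mono le_top 2)
      fun g hg => Subgroup.commutator_le_left (gam ⊤ 2) ⊤ hg.2
    have h4 := Subgroup.mul_mem _ v.2.2 (h3 ((cls_mem_foxBAb _).1 hk))
    rwa [Subgroup.coe_mul, Subgroup.coe_inv, mul_inv_cancel_left] at h4

variable [R.Normal]

variable (R) in
theorem exists_foxTheta : ∃ θ : FreeAbelianGroup (Additive (FoxK R)) →ₗ[ℤ] AbM R,
    ∀ a, (θ a : AbM R ⧸ foxBAb R) = foxKIncl R (freeProj _ a) := by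
  choose g hg using fun k => QuotientAddGroup.mk_surjective (foxKIncl R k)
  refine ⟨(FreeAbelianGroup.lift g).toIntLinearMap, fun a => ?_⟩
  have : (QuotientAddGroup.mk' (foxBAb R)).comp (FreeAbelianGroup.lift g) =
      (foxKIncl R).comp (freeProj _) := by
    ext k
    simp [freeProj, hg]
  exact DFunLike.congr_fun this a

variable (R) in
/-- A map of presentations from the canonical presentation of
`(R ∩ γ₂(F)) / (γ₂(R) (R ∩ γ₃(F)))` to its presentation by a subgroup of `R_ab`. -/
def foxTheta : FreeAbelianGroup (Additive (FoxK R)) →ₗ[ℤ] AbM R := (exists_foxTheta R).choose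

theorem mk_foxTheta (a : FreeAbelianGroup (Additive (FoxK R))) :
    (foxTheta R a : AbM R ⧸ foxBAb R) = foxKIncl R (freeProj _ a) :=
  (exists_foxTheta R).choose_spec a

theorem freeProj_surjective (A : Type u) [AddCommGroup A] : Function.Surjective (freeProj A) :=
  fun a => ⟨FreeAbelianGroup.of a, by simp [freeProj]⟩

theorem foxTheta_mem (a : FreeAbelianGroup (Additive (FoxK R))) (ha : a ∈ (freeProj _).ker) :
    foxTheta R a ∈ foxBAb R := by
  rw [← QuotientAddGroup.eq_zero_iff, mk_foxTheta, AddMonoidHom.mem_ker.1 ha, map_zero]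

theorem koszulMap_foxTheta_bijective [IsFreeGroup F] :
    Function.Bijective (koszulMap (foxTheta R) foxTheta_mem) :=
  koszulMap_bijective (π := (freeProj (Additive (FoxK R))).toIntLinearMap)
    (freeProj_surjective _) (fun _ => Iff.rfl) abProj_surjective foxKIncl_injective
    abProj_eq_zero_iff (foxTheta R) mk_foxTheta

end FoxK

/-! ### Naturality of the leading term -/

section Naturality

local notation "⟪" g "⟫" => MonoidAlgebra.of ℤ _ g

variable {F : Type u} [Group F] {F' : Type u} [Group F'] {R : Subgroup F} {R' : Subgroup F'}
  (f : F →* F') (h : R.map f ≤ R')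

theorem abMap_mem_foxBAb (m : AbM R) (hm : m ∈ foxBAb R) : abMap f h m ∈ foxBAb R' := by
  obtain ⟨u, hu, rfl⟩ := mem_foxBAb.1 hm
  exact mem_foxBAb.2 ⟨_, gam_map_le f le_top 3 ⟨u, hu, rfl⟩, (abMap_cls f h u).symm⟩

variable [IsFreeGroup F] [IsFreeGroup F']

/-- `f` need not respect the chosen free generators, so the derivatives themselves are not natural.
On γ₂(R) the leading term is determined by [u,v] ↦ u ⊗ v - v ⊗ u, which is independent of
generators. -/
theorem foxDer2_map (w : R) (hw : cls R w = 0) :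
    TensorProduct.map (abMap f h) (abMap f h) (foxDer2 R (⟪(w : F)⟫ - 1)) =
      foxDer2 R' (⟪f w⟫ - 1) := by
  let g : R →* R' := (f.comp R.subtype).codRestrict R' fun u => h ⟨u, u.2, rfl⟩
  have hg (x : R) : abMap f h (cls R x) = cls R' (g x) := rfl
  have hg0 (x : R) (hx : cls R x = 0) : cls R' (g x) = 0 := by rw [← hg, hx, map_zero]
  change _ = foxDer2 R' (⟪(g w : F')⟫ - 1)
  revert w
  refine commutator_induction R (fun x y => ?_) (fun x y hx hy ihx ihy => ?_) fun x hx ihx => ?_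
  · rw [map_commutatorElement, foxDer2_commutator, foxDer2_commutator, map_sub]
    rfl
  · rw [map_mul, foxDer2_of_mul, foxDer2_of_mul, hx, hg0 x hx, zero_tmul, zero_tmul, add_zero,
      add_zero, map_add, ihx, ihy]
  · rw [map_inv, foxDer2_inv R hx, foxDer2_inv R' (hg0 x hx), map_neg, ihx]

end Naturality

/-! ### The symmetric square of a truncated simplicial abelian group -/

/-- A simplicial abelian group, truncated at dimension two, with the face maps `d₀`, `d₁` and
`e₀`, `e₁`, `e₂` and the degeneracies `s` and `s₀`, `s₁`. -/
structure SimplicialTrunc (X₀ X₁ X₂ : Type u) [AddCommGroup X₀] [AddCommGroup X₁]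
    [AddCommGroup X₂] where
  d₀ : X₁ →ₗ[ℤ] X₀
  d₁ : X₁ →ₗ[ℤ] X₀
  s : X₀ →ₗ[ℤ] X₁
  e₀ : X₂ →ₗ[ℤ] X₁
  e₁ : X₂ →ₗ[ℤ] X₁
  e₂ : X₂ →ₗ[ℤ] X₁
  s₀ : X₁ →ₗ[ℤ] X₂
  s₁ : X₁ →ₗ[ℤ] X₂
  d₀_s : ∀ a, d₀ (s a) = a
  d₁_s : ∀ a, d₁ (s a) = a
  d₀_e₁ : ∀ y, d₀ (e₁ y) = d₀ (e₀ y)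
  d₀_e₂ : ∀ y, d₀ (e₂ y) = d₁ (e₀ y)
  d₁_e₂ : ∀ y, d₁ (e₂ y) = d₁ (e₁ y)
  e₀_s₀ : ∀ x, e₀ (s₀ x) = x
  e₁_s₀ : ∀ x, e₁ (s₀ x) = x
  e₂_s₀ : ∀ x, e₂ (s₀ x) = s (d₁ x)
  e₀_s₁ : ∀ x, e₀ (s₁ x) = s (d₀ x)
  e₁_s₁ : ∀ x, e₁ (s₁ x) = x
  e₂_s₁ : ∀ x, e₂ (s₁ x) = x

namespace SimplicialTrunc

variable {X₀ X₁ X₂ : Type u} [AddCommGroup X₀] [AddCommGroup X₁] [AddCommGroup X₂]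
  (X : SimplicialTrunc X₀ X₁ X₂)

/-- The boundaries of the normalized complex in degree zero. -/
def bdry : AddSubgroup X₀ := ((LinearMap.ker X.d₁).map X.d₀).toAddSubgroup

theorem mem_bdry {b : X₀} : b ∈ X.bdry ↔ ∃ n, X.d₁ n = 0 ∧ X.d₀ n = b := Iff.rfl

theorem sub_mem_bdry (x : X₁) : X.d₀ x - X.d₁ x ∈ X.bdry :=
  X.mem_bdry.2 ⟨x - X.s (X.d₁ x), by rw [map_sub, X.d₁_s, sub_self], by rw [map_sub, X.d₀_s]⟩

/-- The map on `X₁ ⊗ X₁` that represents one-dimensional classes of the symmetric square by elements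
of `X₀ ⊗ X₀`. -/
def rho : X₁ ⊗[ℤ] X₁ →ₗ[ℤ] X₀ ⊗[ℤ] X₀ :=
  -- Once the factors commute, the two summands telescope to d₀x d₀x' - d₁x d₁x', the differential
  -- in SP²(X₀); uncommuted, they have their second factors in the boundaries. So cycles go to
  -- Λ²(X₀) ∩ (X₀ ⊗ B).
  let d : X₁ →ₗ[ℤ] X₀ := X.d₀ - X.d₁
  TensorProduct.map X.d₀ d + TensorProduct.map X.d₁ d ∘ₗ (TensorProduct.comm ℤ X₁ X₁).toLinearMap

theorem rho_tmul (x x' : X₁) : X.rho (x ⊗ₜ x') =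
    X.d₀ x ⊗ₜ (X.d₀ x' - X.d₁ x') + X.d₁ x' ⊗ₜ (X.d₀ x - X.d₁ x) := rfl

theorem rho_mem_tensR (t : X₁ ⊗[ℤ] X₁) : X.rho t ∈ tensR X₀ X.bdry := by
  induction t with
  | zero => rw [map_zero]; exact AddSubgroup.zero_mem _
  | tmul x x' =>
    rw [rho_tmul]
    exact AddSubgroup.add_mem _ (AddSubgroup.subset_closure ⟨_, _, X.sub_mem_bdry x', rfl⟩)
      (AddSubgroup.subset_closure ⟨_, _, X.sub_mem_bdry x, rfl⟩)
  | add t t' h h' => rw [map_add]; exact AddSubgroup.add_mem _ h h'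

theorem tmul_sub_mem_altSq {A : Type u} [AddCommGroup A] {B : AddSubgroup A} {b b' : A}
    (hb : b ∈ B) (hb' : b' ∈ B) : b ⊗ₜ[ℤ] b' - b' ⊗ₜ[ℤ] b ∈ altSq B :=
  AddSubgroup.subset_closure ⟨b, hb, b', hb', rfl⟩

theorem rho_sp2Rel {t : X₁ ⊗[ℤ] X₁} (ht : t ∈ sp2Rel X₁) : X.rho t ∈ altSq X.bdry := by
  induction ht using AddSubgroup.closure_induction with
  | mem t ht =>
    obtain ⟨x, x', rfl⟩ := ht
    convert tmul_sub_mem_altSq (X.sub_mem_bdry x) (X.sub_mem_bdry x') using 1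
    rw [map_sub, rho_tmul, rho_tmul]
    simp only [tmul_sub, sub_tmul]
    abel
  | zero => rw [map_zero]; exact AddSubgroup.zero_mem _
  | add t t' _ _ h h' => rw [map_add]; exact AddSubgroup.add_mem _ h h'
  | neg t _ h => rw [map_neg]; exact AddSubgroup.neg_mem _ h

/-- The differential `X₁ ⊗ X₁ → X₀ ⊗ X₀`. -/
def del₁ : X₁ ⊗[ℤ] X₁ →ₗ[ℤ] X₀ ⊗[ℤ] X₀ := TensorProduct.map X.d₀ X.d₀ - TensorProduct.map X.d₁ X.d₁

/-- The differential `X₂ ⊗ X₂ → X₁ ⊗ X₁`. -/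
def del₂ : X₂ ⊗[ℤ] X₂ →ₗ[ℤ] X₁ ⊗[ℤ] X₁ :=
  TensorProduct.map X.e₀ X.e₀ - TensorProduct.map X.e₁ X.e₁ + TensorProduct.map X.e₂ X.e₂

theorem del₁_tmul (x x' : X₁) :
    X.del₁ (x ⊗ₜ x') = X.d₀ x ⊗ₜ X.d₀ x' - X.d₁ x ⊗ₜ X.d₁ x' := rfl

theorem del₂_tmul (y y' : X₂) : X.del₂ (y ⊗ₜ y') =
    X.e₀ y ⊗ₜ X.e₀ y' - X.e₁ y ⊗ₜ X.e₁ y' + X.e₂ y ⊗ₜ X.e₂ y' := rfl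

theorem rho_sub_del₁_mem (t : X₁ ⊗[ℤ] X₁) : X.rho t - X.del₁ t ∈ sp2Rel X₀ := by
  rw [← altSq_top]
  induction t with
  | zero => rw [map_zero, map_zero, sub_zero]; exact AddSubgroup.zero_mem _
  | tmul x x' =>
    have h (a b : X₀) : a ⊗ₜ[ℤ] b - b ⊗ₜ[ℤ] a ∈ altSq (⊤ : AddSubgroup X₀) :=
      tmul_sub_mem_altSq trivial trivial
    convert AddSubgroup.sub_mem _ (h (X.d₀ x - X.d₁ x) (-X.d₁ x')) (AddSubgroup.zero_mem _) using 1
    rw [rho_tmul, del₁_tmul]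
    simp only [tmul_sub, sub_tmul, tmul_neg, neg_tmul]
    abel
  | add t t' h h' => rw [map_add, map_add, add_sub_add_comm]; exact AddSubgroup.add_mem _ h h'

theorem rho_del₂_mem (t : X₂ ⊗[ℤ] X₂) : X.rho (X.del₂ t) ∈ altSq X.bdry := by
  induction t with
  | zero => rw [map_zero, map_zero]; exact AddSubgroup.zero_mem _
  | tmul y y' =>
    convert tmul_sub_mem_altSq (X.sub_mem_bdry (X.e₂ y')) (X.sub_mem_bdry (X.e₀ y)) using 1
    rw [del₂_tmul, map_add, map_sub, rho_tmul, rho_tmul, rho_tmul]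
    simp only [tmul_sub, sub_tmul, X.d₀_e₁, X.d₀_e₂, X.d₁_e₂]
    abel
  | add t t' h h' => rw [map_add, map_add]; exact AddSubgroup.add_mem _ h h'

/-- The section of `rho` on `X₀ ⊗ ker d₁`. -/
def sigma : X₀ ⊗[ℤ] LinearMap.ker X.d₁ →ₗ[ℤ] X₁ ⊗[ℤ] X₁ :=
  TensorProduct.map X.s (LinearMap.ker X.d₁).subtype

theorem sigma_tmul (a : X₀) (n : LinearMap.ker X.d₁) :
    X.sigma (a ⊗ₜ n) = X.s a ⊗ₜ (n : X₁) := rfl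

theorem rho_sigma (t : X₀ ⊗[ℤ] LinearMap.ker X.d₁) :
    X.rho (X.sigma t) = (X.d₀ ∘ₗ (LinearMap.ker X.d₁).subtype).lTensor X₀ t := by
  induction t with
  | zero => simp only [map_zero]
  | tmul a n =>
    rw [sigma_tmul, rho_tmul, X.d₀_s, X.d₁_s, LinearMap.mem_ker.1 n.2, zero_tmul, add_zero, sub_zero]
    rfl
  | add t t' h h' => simp only [map_add, h, h']

theorem exists_sigma {t : X₀ ⊗[ℤ] X₀} (ht : t ∈ tensR X₀ X.bdry) :
    ∃ t', X.rho (X.sigma t') = t := by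
  induction ht using AddSubgroup.closure_induction with
  | mem t ht =>
    obtain ⟨a, b, hb, rfl⟩ := ht
    obtain ⟨n, hn, rfl⟩ := X.mem_bdry.1 hb
    exact ⟨a ⊗ₜ ⟨n, hn⟩, by rw [rho_sigma]; rfl⟩
  | zero => exact ⟨0, by rw [map_zero, map_zero]⟩
  | add t t' _ _ h h' =>
    obtain ⟨r, rfl⟩ := h
    obtain ⟨r', rfl⟩ := h'
    exact ⟨r + r', by rw [map_add, map_add]⟩
  | neg t _ h =>
    obtain ⟨r, rfl⟩ := h
    exact ⟨-r, by rw [map_neg, map_neg]⟩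

theorem exists_rho_eq {t : X₀ ⊗[ℤ] X₀} (ht : t ∈ koszulZ X.bdry) :
    ∃ z, X.rho z = t ∧ X.del₁ z ∈ sp2Rel X₀ := by
  have ht' := AddSubgroup.mem_inf.1 ht
  obtain ⟨t', rfl⟩ := X.exists_sigma ht'.2
  refine ⟨_, rfl, ?_⟩
  have h := AddSubgroup.sub_mem _ (altSq_top X₀ ▸ ht'.1) (X.rho_sub_del₁_mem (X.sigma t'))
  rwa [sub_sub_cancel] at h

/-- The elements of `X₁ ⊗ X₁` that represent boundaries in the symmetric square. -/
def sqBdry : AddSubgroup (X₁ ⊗[ℤ] X₁) := X.del₂.toAddMonoidHom.range ⊔ sp2Rel X₁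

theorem rho_mem_of_mem_sqBdry {z : X₁ ⊗[ℤ] X₁} (hz : z ∈ X.sqBdry) : X.rho z ∈ altSq X.bdry := by
  obtain ⟨_, ⟨t, rfl⟩, r, hr, rfl⟩ := AddSubgroup.mem_sup.1 hz
  rw [map_add]
  exact AddSubgroup.add_mem _ (X.rho_del₂_mem t) (X.rho_sp2Rel hr)

theorem tmul_sub_tmul_mem (x x' : X₁) : x ⊗ₜ[ℤ] x' - x' ⊗ₜ x ∈ X.sqBdry :=
  AddSubgroup.mem_sup_right (AddSubgroup.subset_closure ⟨x, x', rfl⟩)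

theorem del₂_mem (t : X₂ ⊗[ℤ] X₂) : X.del₂ t ∈ X.sqBdry := AddSubgroup.mem_sup_left ⟨t, rfl⟩

theorem degenerate_mem (a a' : X₀) : X.s a ⊗ₜ[ℤ] X.s a' ∈ X.sqBdry := by
  have h := X.del₂_mem (X.s₀ (X.s a) ⊗ₜ X.s₀ (X.s a'))
  rwa [del₂_tmul, X.e₀_s₀, X.e₀_s₀, X.e₁_s₀, X.e₁_s₀, X.e₂_s₀, X.e₂_s₀, X.d₁_s, X.d₁_s, sub_self,
    zero_add] at h

/-- The boundary of s₀n ⊗ s₁n' is n ⊗ s d₀n' - n ⊗ n', because d₁n = 0 kills the last face. -/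
theorem normalized_mem {n : X₁} (hn : X.d₁ n = 0) (n' : X₁) :
    n ⊗ₜ[ℤ] n' - X.s (X.d₀ n') ⊗ₜ n ∈ X.sqBdry := by
  have h := X.del₂_mem (X.s₀ n ⊗ₜ X.s₁ n')
  rw [del₂_tmul, X.e₀_s₀, X.e₁_s₀, X.e₂_s₀, X.e₀_s₁, X.e₁_s₁, X.e₂_s₁, hn, map_zero, zero_tmul,
    add_zero] at h
  convert AddSubgroup.sub_mem _ (X.tmul_sub_tmul_mem n (X.s (X.d₀ n'))) h using 1
  abel

/-- Split each factor as x = s d₁x + n with d₁n = 0. Products of degenerate elements are boundaries,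
mixed products are in the image of `sigma` up to symmetry, and n ⊗ n' is handled by
`normalized_mem`. -/
theorem exists_sigma_sub_mem (z : X₁ ⊗[ℤ] X₁) : ∃ t, z - X.sigma t ∈ X.sqBdry := by
  induction z with
  | zero => exact ⟨0, by rw [map_zero, sub_zero]; exact AddSubgroup.zero_mem _⟩
  | tmul x x' =>
    have hn (x : X₁) : ∃ n : LinearMap.ker X.d₁, x = X.s (X.d₁ x) + n :=
      ⟨⟨x - X.s (X.d₁ x), by rw [LinearMap.mem_ker, map_sub, X.d₁_s, sub_self]⟩, by simp⟩
    obtain ⟨n, hx⟩ := hn x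
    obtain ⟨n', hx'⟩ := hn x'
    set a := X.d₁ x
    set a' := X.d₁ x'
    refine ⟨a ⊗ₜ n' + a' ⊗ₜ n + X.d₀ n' ⊗ₜ n, ?_⟩
    rw [map_add, map_add, sigma_tmul, sigma_tmul, sigma_tmul, hx, hx']
    convert AddSubgroup.add_mem _ (AddSubgroup.add_mem _ (X.degenerate_mem a a')
      (X.tmul_sub_tmul_mem n (X.s a'))) (X.normalized_mem n.2 n') using 1
    simp only [tmul_add, add_tmul]
    abel
  | add z z' h h' =>
    obtain ⟨t, ht⟩ := h
    obtain ⟨t', ht'⟩ := h'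
    exact ⟨t + t', by rw [map_add, add_sub_add_comm]; exact AddSubgroup.add_mem _ ht ht'⟩

theorem exists_of_mem_altSq {r : X₀ ⊗[ℤ] X₀} (hr : r ∈ altSq X.bdry) :
    ∃ t, X.rho (X.sigma t) = r ∧ X.sigma t ∈ X.sqBdry := by
  induction hr using AddSubgroup.closure_induction with
  | mem r hr =>
    obtain ⟨b, hb, b', hb', rfl⟩ := hr
    obtain ⟨n, hn, rfl⟩ := X.mem_bdry.1 hb
    obtain ⟨n', hn', rfl⟩ := X.mem_bdry.1 hb'
    refine ⟨X.d₀ n ⊗ₜ ⟨n', hn'⟩ - X.d₀ n' ⊗ₜ ⟨n, hn⟩, by rw [rho_sigma, map_sub]; rfl, ?_⟩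
    rw [map_sub, sigma_tmul, sigma_tmul]
    convert AddSubgroup.add_mem _ (AddSubgroup.sub_mem _ (X.normalized_mem hn n')
      (X.normalized_mem hn' n)) (X.tmul_sub_tmul_mem n' n) using 1
    abel
  | zero => exact ⟨0, by simp only [map_zero], by rw [map_zero]; exact AddSubgroup.zero_mem _⟩
  | add r r' _ _ h h' =>
    obtain ⟨t, rfl, ht⟩ := h
    obtain ⟨t', rfl, ht'⟩ := h'
    exact ⟨t + t', by simp only [map_add], by rw [map_add]; exact AddSubgroup.add_mem _ ht ht'⟩
  | neg r _ h =>
    obtain ⟨t, rfl, ht⟩ := h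
    exact ⟨-t, by simp only [map_neg], by rw [map_neg]; exact AddSubgroup.neg_mem _ ht⟩

/-- It suffices to treat z = σ(t). There ρσ = 1 ⊗ d₀ is injective, since `hX` makes d₀ injective on
ker d₁ and X₀ is flat; so t is the explicit preimage from `exists_of_mem_altSq`, whose image under σ
is a boundary. -/
theorem mem_sqBdry_of_rho_mem [Module.Free ℤ X₀] (hX : ∀ x, X.d₁ x = 0 → X.d₀ x = 0 → x = 0)
    {z : X₁ ⊗[ℤ] X₁} (hz : X.rho z ∈ altSq X.bdry) : z ∈ X.sqBdry := by
  obtain ⟨t, ht⟩ := X.exists_sigma_sub_mem z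
  have h1 := AddSubgroup.sub_mem _ hz (X.rho_mem_of_mem_sqBdry ht)
  rw [← map_sub, sub_sub_cancel] at h1
  obtain ⟨t', h2, h3⟩ := X.exists_of_mem_altSq h1
  have hinj : Function.Injective (X.d₀ ∘ₗ (LinearMap.ker X.d₁).subtype) :=
    (injective_iff_map_eq_zero _).2 fun n hn => Subtype.ext (hX n n.2 hn)
  have h4 : t' = t := by
    refine Module.Flat.lTensor_preserves_injective_linearMap (M := X₀) _ hinj ?_
    rw [← rho_sigma, ← rho_sigma, h2]
  have := AddSubgroup.add_mem _ ht (h4 ▸ h3)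
  rwa [sub_add_cancel] at this

end SimplicialTrunc

/-! ### The first homotopy group of the symmetric square -/

section KoszulIncl

variable {A A' : Type u} [AddCommGroup A] [AddCommGroup A']

/-- The inclusion of the Koszul homology in the cokernel of `Λ²(B) → A ⊗ A`. -/
def koszulIncl (B : AddSubgroup A) : KoszulH B →+ (A ⊗[ℤ] A) ⧸ altSq B :=
  QuotientAddGroup.map _ _ (koszulZ B).subtype le_rfl

theorem koszulIncl_mk {B : AddSubgroup A} (t : koszulZ B) :
    koszulIncl B (t : KoszulH B) = ((t : A ⊗[ℤ] A) : (A ⊗[ℤ] A) ⧸ altSq B) := rfl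

theorem koszulIncl_injective (B : AddSubgroup A) : Function.Injective (koszulIncl B) := by
  refine (injective_iff_map_eq_zero _).2 fun t ht => ?_
  induction t using QuotientAddGroup.induction_on with | H t => ?_
  exact (QuotientAddGroup.eq_zero_iff t).2 ((QuotientAddGroup.eq_zero_iff (t : A ⊗[ℤ] A)).1 ht)

theorem koszulIncl_koszulMap {B : AddSubgroup A} {B' : AddSubgroup A'} (f : A →ₗ[ℤ] A')
    (hf : ∀ b ∈ B, f b ∈ B') {k : KoszulH B} {t : A ⊗[ℤ] A}
    (h : koszulIncl B k = (t : (A ⊗[ℤ] A) ⧸ altSq B)) :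
    koszulIncl B' (koszulMap f hf k) =
      (TensorProduct.map f f t : (A' ⊗[ℤ] A') ⧸ altSq B') := by
  induction k using QuotientAddGroup.induction_on with | H k => ?_
  rw [koszulMap_mk, koszulIncl_mk]
  rw [koszulIncl_mk, QuotientAddGroup.eq] at h
  rw [QuotientAddGroup.eq]
  change -TensorProduct.map f f (k : A ⊗[ℤ] A) + TensorProduct.map f f t ∈ altSq B'
  rw [← map_neg, ← map_add]
  exact map_mem_altSq f hf h

end KoszulIncl

namespace SimplicialTrunc

variable {X₀ X₁ X₂ : Type u} [AddCommGroup X₀] [AddCommGroup X₁] [AddCommGroup X₂]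
  (X : SimplicialTrunc X₀ X₁ X₂)

/-- The map that `rho` induces on the symmetric square. -/
def rhoSP2 : SP2 X₁ →+ (X₀ ⊗[ℤ] X₀) ⧸ altSq X.bdry :=
  QuotientAddGroup.map _ _ X.rho.toAddMonoidHom fun _ ht => X.rho_sp2Rel ht

theorem rhoSP2_mk (t : X₁ ⊗[ℤ] X₁) :
    X.rhoSP2 (t : SP2 X₁) = (X.rho t : (X₀ ⊗[ℤ] X₀) ⧸ altSq X.bdry) := rfl

theorem exists_koszulH {t : X₁ ⊗[ℤ] X₁} (ht : X.del₁ t ∈ sp2Rel X₀) :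
    ∃ k, koszulIncl X.bdry k = X.rhoSP2 (t : SP2 X₁) := by
  have h := AddSubgroup.add_mem _ (X.rho_sub_del₁_mem t) ht
  rw [sub_add_cancel, ← altSq_top] at h
  exact ⟨((⟨X.rho t, AddSubgroup.mem_inf.2 ⟨h, X.rho_mem_tensR t⟩⟩ : koszulZ X.bdry) :
    KoszulH X.bdry), rfl⟩

theorem exists_cycle (k : KoszulH X.bdry) :
    ∃ t, X.del₁ t ∈ sp2Rel X₀ ∧ X.rhoSP2 (t : SP2 X₁) = koszulIncl X.bdry k := by
  induction k using QuotientAddGroup.induction_on with | H k => ?_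
  obtain ⟨z, hz, hz'⟩ := X.exists_rho_eq k.2
  exact ⟨z, hz', by rw [rhoSP2_mk, hz, koszulIncl_mk]⟩

theorem rhoSP2_del₂ (t : X₂ ⊗[ℤ] X₂) : X.rhoSP2 (X.del₂ t : SP2 X₁) = 0 :=
  (QuotientAddGroup.eq_zero_iff _).2 (X.rho_del₂_mem t)

theorem exists_boundary [Module.Free ℤ X₀] (hX : ∀ x, X.d₁ x = 0 → X.d₀ x = 0 → x = 0)
    {z : X₁ ⊗[ℤ] X₁} (hz : X.rhoSP2 (z : SP2 X₁) = 0) :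
    ∃ t, (X.del₂ t : SP2 X₁) = (z : SP2 X₁) := by
  obtain ⟨_, ⟨t, rfl⟩, r, hr, hz'⟩ := AddSubgroup.mem_sup.1
    (X.mem_sqBdry_of_rho_mem hX ((QuotientAddGroup.eq_zero_iff _).1 hz))
  refine ⟨t, (QuotientAddGroup.eq).2 ?_⟩
  rw [← hz']
  change -X.del₂ t + (X.del₂ t + r) ∈ _
  rwa [neg_add_cancel_left]

variable {Y₀ Y₁ Y₂ : Type u} [AddCommGroup Y₀] [AddCommGroup Y₁] [AddCommGroup Y₂]
  (Y : SimplicialTrunc Y₀ Y₁ Y₂) (f₀ : X₀ →ₗ[ℤ] Y₀) (f₁ : X₁ →ₗ[ℤ] Y₁)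

theorem map_mem_bdry (h0 : ∀ x, f₀ (X.d₀ x) = Y.d₀ (f₁ x)) (h1 : ∀ x, f₀ (X.d₁ x) = Y.d₁ (f₁ x)) :
    ∀ b ∈ X.bdry, f₀ b ∈ Y.bdry := by
  intro b hb
  obtain ⟨n, hn, rfl⟩ := X.mem_bdry.1 hb
  exact Y.mem_bdry.2 ⟨f₁ n, by rw [← h1, hn, map_zero], (h0 n).symm⟩

theorem rho_map (h0 : ∀ x, f₀ (X.d₀ x) = Y.d₀ (f₁ x)) (h1 : ∀ x, f₀ (X.d₁ x) = Y.d₁ (f₁ x))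
    (t : X₁ ⊗[ℤ] X₁) :
    TensorProduct.map f₀ f₀ (X.rho t) = Y.rho (TensorProduct.map f₁ f₁ t) := by
  induction t with
  | zero => simp only [map_zero]
  | tmul x x' =>
    rw [TensorProduct.map_tmul, rho_tmul, rho_tmul, map_add, TensorProduct.map_tmul,
      TensorProduct.map_tmul, map_sub, map_sub, h0, h0, h1, h1]
  | add t t' h h' => simp only [map_add, h, h']

end SimplicialTrunc

/-! ### Homology of complexes of abelian groups in terms of elements -/

section Homology

open HomologicalComplex

variable (K : ChainComplex AddCommGrpCat.{u} ℕ)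

theorem homologyπ_surjective (i : ℕ) : Function.Surjective (K.homologyπ i) :=
  (AddCommGrpCat.epi_iff_surjective _).1 inferInstance

theorem exists_iCycles_eq (z : K.X 1) (hz : K.d 1 0 z = 0) :
    ∃ c : K.cycles 1, K.iCycles 1 c = z := by
  have h : (ShortComplex.mk (K.iCycles 1) (K.d 1 0) (K.iCycles_d 1 0)).Exact :=
    ShortComplex.exact_of_f_is_kernel _ (K.cyclesIsKernel 1 0 (by simp))
  exact (ShortComplex.ab_exact_iff _).1 h z hz

theorem d_iCycles (c : K.cycles 1) : K.d 1 0 (K.iCycles 1 c) = 0 := by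
  rw [← ConcreteCategory.comp_apply, K.iCycles_d]
  rfl

theorem homologyπ_eq_zero_iff (c : K.cycles 1) :
    K.homologyπ 1 c = 0 ↔ ∃ y : K.X 2, K.d 2 1 y = K.iCycles 1 c := by
  have h : (ShortComplex.mk (K.toCycles 2 1) (K.homologyπ 1) (K.toCycles_comp_homologyπ 2 1)).Exact :=
    ShortComplex.exact_of_g_is_cokernel _ (K.homologyIsCokernel 2 1 (by simp))
  have hi : Function.Injective (K.iCycles 1) := (AddCommGrpCat.mono_iff_injective _).1 inferInstance
  have hd (y : K.X 2) : K.iCycles 1 (K.toCycles 2 1 y) = K.d 2 1 y := by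
    rw [← ConcreteCategory.comp_apply, K.toCycles_i]
  constructor
  · intro hc
    obtain ⟨y, hy⟩ := (ShortComplex.ab_exact_iff _).1 h c hc
    exact ⟨y, by rw [← hd]; exact congrArg _ hy⟩
  · rintro ⟨y, hy⟩
    rw [← hd] at hy
    rw [← hi hy, ← ConcreteCategory.comp_apply, K.toCycles_comp_homologyπ]
    rfl

end Homology

/-! ### Simplicial abelian groups -/

section SimplicialAb

open Opposite Simplicial AlgebraicTopology

theorem addCommGrp_congr {A B : AddCommGrpCat.{u}} {f g : A ⟶ B} (h : f = g) (x : A) : f x = g x := by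
  rw [h]

variable (X : SimplicialObject AddCommGrpCat.{u})

/-- The truncation of a simplicial abelian group. -/
def simplicialTrunc : SimplicialTrunc (X _⦋0⦌) (X _⦋1⦌) (X _⦋2⦌) where
  d₀ := (X.δ (0 : Fin 2)).hom.toIntLinearMap
  d₁ := (X.δ (1 : Fin 2)).hom.toIntLinearMap
  s := (X.σ (0 : Fin 1)).hom.toIntLinearMap
  e₀ := (X.δ (0 : Fin 3)).hom.toIntLinearMap
  e₁ := (X.δ (1 : Fin 3)).hom.toIntLinearMap
  e₂ := (X.δ (2 : Fin 3)).hom.toIntLinearMap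
  s₀ := (X.σ (0 : Fin 2)).hom.toIntLinearMap
  s₁ := (X.σ (1 : Fin 2)).hom.toIntLinearMap
  d₀_s := addCommGrp_congr (X.δ_comp_σ_self (i := (0 : Fin 1)))
  d₁_s := addCommGrp_congr (X.δ_comp_σ_succ (i := (0 : Fin 1)))
  d₀_e₁ := addCommGrp_congr (X.δ_comp_δ (i := (0 : Fin 2)) (j := 0) le_rfl)
  d₀_e₂ := addCommGrp_congr (X.δ_comp_δ (i := (0 : Fin 2)) (j := 1) (by decide))
  d₁_e₂ := addCommGrp_congr (X.δ_comp_δ (i := (1 : Fin 2)) (j := 1) le_rfl)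
  e₀_s₀ := addCommGrp_congr (X.δ_comp_σ_self (i := (0 : Fin 2)))
  e₁_s₀ := addCommGrp_congr (X.δ_comp_σ_succ (i := (0 : Fin 2)))
  e₂_s₀ := addCommGrp_congr (X.δ_comp_σ_of_gt (i := (1 : Fin 2)) (j := (0 : Fin 1)) (by decide))
  e₀_s₁ := addCommGrp_congr (X.δ_comp_σ_of_le (i := (0 : Fin 2)) (j := (0 : Fin 1)) (by decide))
  e₁_s₁ := addCommGrp_congr (X.δ_comp_σ_self (i := (1 : Fin 2)))
  e₂_s₁ := addCommGrp_congr (X.δ_comp_σ_succ (i := (1 : Fin 2)))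

/-- The unnormalized complex of the symmetric square of a simplicial abelian group. -/
abbrev sp2Complex : ChainComplex AddCommGrpCat.{u} ℕ :=
  (alternatingFaceMapComplex AddCommGrpCat.{u}).obj
    (((SimplicialObject.whiskering _ _).obj sp2Functor).obj X)

theorem sp2Complex_d_one (t : X _⦋1⦌ ⊗[ℤ] X _⦋1⦌) :
    (sp2Complex X).d 1 0 (t : SP2 (X _⦋1⦌)) = ((simplicialTrunc X).del₁ t : SP2 (X _⦋0⦌)) := by
  have h : (sp2Complex X).d 1 0 = sp2Functor.map (X.δ (0 : Fin 2)) -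
      sp2Functor.map (X.δ (1 : Fin 2)) := by
    rw [alternatingFaceMapComplex_obj_d, AlternatingFaceMapComplex.objD, Fin.sum_univ_two]
    change (-1 : ℤ) ^ 0 • sp2Functor.map (X.δ (0 : Fin 2)) +
      (-1 : ℤ) ^ 1 • sp2Functor.map (X.δ (1 : Fin 2)) = _
    rw [pow_zero, one_smul, pow_one, neg_one_smul, sub_eq_add_neg]
  exact addCommGrp_congr h _

theorem sp2Complex_d_two (t : X _⦋2⦌ ⊗[ℤ] X _⦋2⦌) :
    (sp2Complex X).d 2 1 (t : SP2 (X _⦋2⦌)) = ((simplicialTrunc X).del₂ t : SP2 (X _⦋1⦌)) := by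
  have h : (sp2Complex X).d 2 1 = sp2Functor.map (X.δ (0 : Fin 3)) -
      sp2Functor.map (X.δ (1 : Fin 3)) + sp2Functor.map (X.δ (2 : Fin 3)) := by
    rw [alternatingFaceMapComplex_obj_d, AlternatingFaceMapComplex.objD, Fin.sum_univ_three]
    change (-1 : ℤ) ^ 0 • sp2Functor.map (X.δ (0 : Fin 3)) +
      (-1 : ℤ) ^ 1 • sp2Functor.map (X.δ (1 : Fin 3)) +
      (-1 : ℤ) ^ 2 • sp2Functor.map (X.δ (2 : Fin 3)) = _
    rw [pow_zero, one_smul, pow_one, neg_one_smul, ← sub_eq_add_neg, neg_one_sq, one_smul]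
  exact addCommGrp_congr h _

/-- `rho` on the chains of degree one of the complex of the symmetric square. -/
def rhoChain : (sp2Complex X).X 1 →+ (X _⦋0⦌ ⊗[ℤ] X _⦋0⦌) ⧸ altSq (simplicialTrunc X).bdry :=
  (simplicialTrunc X).rhoSP2

theorem exists_rep_one (z : (sp2Complex X).X 1) :
    ∃ t : X _⦋1⦌ ⊗[ℤ] X _⦋1⦌, z = (t : SP2 (X _⦋1⦌)) :=
  (QuotientAddGroup.mk_surjective (s := sp2Rel (X _⦋1⦌)) z).imp fun _ h => h.symm

theorem exists_rep_two (z : (sp2Complex X).X 2) :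
    ∃ t : X _⦋2⦌ ⊗[ℤ] X _⦋2⦌, z = (t : SP2 (X _⦋2⦌)) :=
  (QuotientAddGroup.mk_surjective (s := sp2Rel (X _⦋2⦌)) z).imp fun _ h => h.symm

theorem d_one_eq_zero_iff (t : X _⦋1⦌ ⊗[ℤ] X _⦋1⦌) :
    (sp2Complex X).d 1 0 (t : SP2 (X _⦋1⦌)) = 0 ↔ (simplicialTrunc X).del₁ t ∈ sp2Rel (X _⦋0⦌) :=
  (Eq.congr_left (sp2Complex_d_one X t)).trans (QuotientAddGroup.eq_zero_iff _)

theorem exists_koszulIncl_eq (c : (sp2Complex X).cycles 1) :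
    ∃ k, koszulIncl (simplicialTrunc X).bdry k = rhoChain X ((sp2Complex X).iCycles 1 c) := by
  obtain ⟨t, ht⟩ := exists_rep_one X ((sp2Complex X).iCycles 1 c)
  have h := d_iCycles _ c
  rw [ht] at h ⊢
  exact (simplicialTrunc X).exists_koszulH ((d_one_eq_zero_iff X t).1 h)

/-- The map from one-cycles of the symmetric square to the Koszul homology. -/
def cyclesToKoszul : (sp2Complex X).cycles 1 →+ KoszulH (simplicialTrunc X).bdry :=
  (AddMonoidHom.ofInjective (koszulIncl_injective (simplicialTrunc X).bdry)).symm.toAddMonoidHom.comp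
    (((rhoChain X).comp ((sp2Complex X).iCycles 1).hom).codRestrict
      (koszulIncl (simplicialTrunc X).bdry).range (exists_koszulIncl_eq X))

theorem koszulIncl_cyclesToKoszul (c : (sp2Complex X).cycles 1) :
    koszulIncl _ (cyclesToKoszul X c) = rhoChain X ((sp2Complex X).iCycles 1 c) :=
  congrArg Subtype.val ((AddMonoidHom.ofInjective
    (koszulIncl_injective (simplicialTrunc X).bdry)).apply_symm_apply _)

theorem rhoChain_d (y : (sp2Complex X).X 2) : rhoChain X ((sp2Complex X).d 2 1 y) = 0 := by
  obtain ⟨t, rfl⟩ := exists_rep_two X y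
  rw [sp2Complex_d_two]
  exact (simplicialTrunc X).rhoSP2_del₂ t

/-- The map from the first homotopy group of the symmetric square to the Koszul homology. -/
def homologyToKoszul : (sp2Complex X).homology 1 →+ KoszulH (simplicialTrunc X).bdry :=
  AddMonoidHom.liftOfSurjective ((sp2Complex X).homologyπ 1).hom
    (homologyπ_surjective (sp2Complex X) 1) ⟨cyclesToKoszul X, fun c hc => by
      obtain ⟨y, hy⟩ := (homologyπ_eq_zero_iff _ c).1 hc
      refine koszulIncl_injective _ ?_
      rw [koszulIncl_cyclesToKoszul, ← hy, rhoChain_d, map_zero]⟩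

theorem homologyToKoszul_π (c : (sp2Complex X).cycles 1) :
    homologyToKoszul X ((sp2Complex X).homologyπ 1 c) = cyclesToKoszul X c :=
  AddMonoidHom.liftOfRightInverse_comp_apply _ _ _ _ c

theorem homologyToKoszul_bijective [Module.Free ℤ (X _⦋0⦌)]
    (hX : ∀ x : X _⦋1⦌, X.δ (1 : Fin 2) x = 0 → X.δ (0 : Fin 2) x = 0 → x = 0) :
    Function.Bijective (homologyToKoszul X) := by
  constructor
  · refine (injective_iff_map_eq_zero _).2 fun h hh => ?_
    obtain ⟨c, rfl⟩ := homologyπ_surjective (sp2Complex X) 1 h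
    rw [homologyToKoszul_π] at hh
    have h1 := koszulIncl_cyclesToKoszul X c
    rw [hh, map_zero] at h1
    refine (homologyπ_eq_zero_iff _ c).2 ?_
    obtain ⟨t, ht⟩ := exists_rep_one X ((sp2Complex X).iCycles 1 c)
    rw [ht] at h1 ⊢
    obtain ⟨r, hr⟩ := (simplicialTrunc X).exists_boundary hX h1.symm
    exact ⟨(r : SP2 (X _⦋2⦌)), (sp2Complex_d_two X r).trans hr⟩
  · intro k
    obtain ⟨t, ht, ht'⟩ := (simplicialTrunc X).exists_cycle k
    obtain ⟨c, hc⟩ := exists_iCycles_eq (sp2Complex X) (t : SP2 (X _⦋1⦌))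
      ((d_one_eq_zero_iff X t).2 ht)
    refine ⟨(sp2Complex X).homologyπ 1 c, koszulIncl_injective _ ?_⟩
    rw [homologyToKoszul_π, koszulIncl_cyclesToKoszul, hc]
    exact ht'

variable {X} {Y : SimplicialObject AddCommGrpCat.{u}} (g : X ⟶ Y)

/-- The map of complexes of symmetric squares induced by a map of simplicial abelian groups. -/
abbrev sp2ComplexMap : sp2Complex X ⟶ sp2Complex Y :=
  (alternatingFaceMapComplex AddCommGrpCat.{u}).map
    (((SimplicialObject.whiskering _ _).obj sp2Functor).map g)

/-- The map in degree zero. -/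
abbrev mapZero : X _⦋0⦌ →ₗ[ℤ] Y _⦋0⦌ := (g.app (op ⦋0⦌)).hom.toIntLinearMap

/-- The map in degree one. -/
abbrev mapOne : X _⦋1⦌ →ₗ[ℤ] Y _⦋1⦌ := (g.app (op ⦋1⦌)).hom.toIntLinearMap

theorem mapZero_d₀ (x : X _⦋1⦌) :
    mapZero g ((simplicialTrunc X).d₀ x) = (simplicialTrunc Y).d₀ (mapOne g x) :=
  addCommGrp_congr (g.naturality (SimplexCategory.δ (0 : Fin 2)).op) x

theorem mapZero_d₁ (x : X _⦋1⦌) :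
    mapZero g ((simplicialTrunc X).d₁ x) = (simplicialTrunc Y).d₁ (mapOne g x) :=
  addCommGrp_congr (g.naturality (SimplexCategory.δ (1 : Fin 2)).op) x

theorem mapZero_mem_bdry : ∀ b ∈ (simplicialTrunc X).bdry, mapZero g b ∈ (simplicialTrunc Y).bdry :=
  SimplicialTrunc.map_mem_bdry _ _ _ (mapOne g) (mapZero_d₀ g) (mapZero_d₁ g)

theorem homologyToKoszul_naturality (h : (sp2Complex X).homology 1) :
    homologyToKoszul Y (HomologicalComplex.homologyMap (sp2ComplexMap g) 1 h) =
      koszulMap (mapZero g) (mapZero_mem_bdry g) (homologyToKoszul X h) := by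
  obtain ⟨c, rfl⟩ := homologyπ_surjective (sp2Complex X) 1 h
  have h1 : HomologicalComplex.homologyMap (sp2ComplexMap g) 1 ((sp2Complex X).homologyπ 1 c) =
      (sp2Complex Y).homologyπ 1 (HomologicalComplex.cyclesMap (sp2ComplexMap g) 1 c) :=
    addCommGrp_congr (HomologicalComplex.homologyπ_naturality (sp2ComplexMap g) 1) c
  have h2 : (sp2Complex Y).iCycles 1 (HomologicalComplex.cyclesMap (sp2ComplexMap g) 1 c) =
      (sp2ComplexMap g).f 1 ((sp2Complex X).iCycles 1 c) :=
    addCommGrp_congr (HomologicalComplex.cyclesMap_i (sp2ComplexMap g) 1) c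
  refine koszulIncl_injective _ ?_
  rw [h1, homologyToKoszul_π, homologyToKoszul_π, koszulIncl_cyclesToKoszul, h2]
  obtain ⟨t, ht⟩ := exists_rep_one X ((sp2Complex X).iCycles 1 c)
  have h3 := koszulIncl_cyclesToKoszul X c
  rw [ht] at h3 ⊢
  refine Eq.trans ?_ (koszulIncl_koszulMap _ (mapZero_mem_bdry g) h3).symm
  exact congrArg (QuotientAddGroup.mk (s := altSq (simplicialTrunc Y).bdry))
    (SimplicialTrunc.rho_map _ _ _ _ (mapZero_d₀ g) (mapZero_d₁ g) t).symm

end SimplicialAb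

/-! ### The normalized complex in low degrees -/

section Moore

open Opposite Simplicial AlgebraicTopology

variable (X : SimplicialObject AddCommGrpCat.{u})

/-- The normalized complex of a simplicial abelian group. -/
abbrev moore : ChainComplex AddCommGrpCat.{u} ℕ := (normalizedMooreComplex _).obj X

/-- The inclusion of the normalized complex in the unnormalized one. -/
abbrev mooreIncl (n : ℕ) : (moore X).X n ⟶ X _⦋n⦌ := (NormalizedMooreComplex.objX X n).arrow

theorem mooreIncl_naturality {Y : SimplicialObject AddCommGrpCat.{u}} (g : X ⟶ Y) (n : ℕ) :
    ((normalizedMooreComplex _).map g).f n ≫ mooreIncl Y n = mooreIncl X n ≫ g.app (op ⦋n⦌) :=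
  congrArg (fun k => HomologicalComplex.Hom.f k n)
    ((inclusionOfMooreComplex AddCommGrpCat.{u}).naturality g)

instance (n : ℕ) : Mono (mooreIncl X n) :=
  inferInstanceAs (Mono (NormalizedMooreComplex.objX X n).arrow)

instance : IsIso (mooreIncl X 0) := inferInstanceAs (IsIso (⊤ : Subobject (X _⦋0⦌)).arrow)

theorem mooreIncl_injective (n : ℕ) : Function.Injective (mooreIncl X n) :=
  (AddCommGrpCat.mono_iff_injective _).1 inferInstance

theorem mooreIncl_zero_surjective : Function.Surjective (mooreIncl X 0) :=
  (AddCommGrpCat.epi_iff_surjective _).1 inferInstance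

theorem moore_d : (moore X).d 1 0 ≫ mooreIncl X 0 = mooreIncl X 1 ≫ X.δ (0 : Fin 2) := by
  have h : (moore X).d 1 0 = mooreIncl X 1 ≫ X.δ (0 : Fin 2) ≫ inv (mooreIncl X 0) :=
    normalizedMooreComplex_objD X 0
  rw [h, Category.assoc, Category.assoc, IsIso.inv_hom_id, Category.comp_id]

theorem mooreIncl_δ_one : mooreIncl X 1 ≫ X.δ (1 : Fin 2) = 0 := by
  -- In degree one the Moore subobject is an intersection over `Fin 1`, that is, the kernel of `δ 1`
  -- alone; `δ 0` remains as the differential.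
  have h := Subobject.finset_inf_arrow_factors Finset.univ
    (fun k : Fin 1 => Limits.kernelSubobject (X.δ k.succ)) 0 (Finset.mem_univ _)
  have h1 := Subobject.factorThru_arrow _ _ h
  change mooreIncl X 1 ≫ X.δ (Fin.succ (0 : Fin 1)) = 0
  refine (congrArg (· ≫ X.δ (Fin.succ (0 : Fin 1))) h1.symm).trans ?_
  beta_reduce
  rw [Category.assoc, Limits.kernelSubobject_arrow_comp, Limits.comp_zero]
  rfl

theorem exists_mooreIncl_eq (x : X _⦋1⦌) (hx : X.δ (1 : Fin 2) x = 0) :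
    ∃ y, mooreIncl X 1 y = x := by
  have hf : (NormalizedMooreComplex.objX X 1).Factors (Limits.kernel.ι (X.δ (1 : Fin 2))) := by
    refine (Subobject.finset_inf_factors _).2 fun i _ => Limits.kernelSubobject_factors _ _ ?_
    obtain rfl : i = 0 := Fin.ext (Nat.lt_one_iff.1 i.2)
    exact Limits.kernel.condition _
  have hex : (ShortComplex.mk (Limits.kernel.ι (X.δ (1 : Fin 2))) (X.δ (1 : Fin 2))
      (Limits.kernel.condition _)).Exact :=
    ShortComplex.exact_of_f_is_kernel _ (Limits.kernelIsKernel _)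
  obtain ⟨w, hw⟩ := (ShortComplex.ab_exact_iff _).1 hex x hx
  exact ⟨Subobject.factorThru _ _ hf w,
    (addCommGrp_congr (Subobject.factorThru_arrow _ _ hf) w).trans hw⟩

theorem mem_bdry_iff (a : (moore X).X 0) :
    mooreIncl X 0 a ∈ (simplicialTrunc X).bdry ↔ ∃ y, (moore X).d 1 0 y = a := by
  constructor
  · intro h
    obtain ⟨n, hn, hna⟩ := (simplicialTrunc X).mem_bdry.1 h
    obtain ⟨y, rfl⟩ := exists_mooreIncl_eq X n hn
    exact ⟨y, mooreIncl_injective X 0 ((addCommGrp_congr (moore_d X) y).trans hna)⟩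
  · rintro ⟨y, rfl⟩
    exact (simplicialTrunc X).mem_bdry.2 ⟨mooreIncl X 1 y,
      addCommGrp_congr (mooreIncl_δ_one X) y, (addCommGrp_congr (moore_d X) y).symm⟩

theorem eq_zero_of_moore_injective (h : Function.Injective ((moore X).d 1 0)) (x : X _⦋1⦌)
    (h1 : X.δ (1 : Fin 2) x = 0) (h0 : X.δ (0 : Fin 2) x = 0) : x = 0 := by
  obtain ⟨y, rfl⟩ := exists_mooreIncl_eq X x h1
  have h2 : mooreIncl X 0 ((moore X).d 1 0 y) = 0 := (addCommGrp_congr (moore_d X) y).trans h0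
  rw [(injective_iff_map_eq_zero _).1 h _
    ((injective_iff_map_eq_zero _).1 (mooreIncl_injective X 0) _ h2), map_zero]

end Moore

/-! ### The simplicial abelian group of a complex -/

section DoldKan

open Opposite Simplicial AlgebraicTopology

variable (P : ChainComplex AddCommGrpCat.{u} ℕ)

/-- The normalized complex of `K P` is isomorphic to `P`. -/
def mooreΓ : (Abelian.DoldKan.Γ ⋙ normalizedMooreComplex AddCommGrpCat.{u}) ≅ 𝟭 _ :=
  Abelian.DoldKan.equivalence.counitIso

/-- The isomorphism between the zeroth group of `K P` and the zeroth group of `P`. -/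
def zeroIso : (Abelian.DoldKan.Γ.obj P) _⦋0⦌ ≅ P.X 0 :=
  (asIso (mooreIncl (Abelian.DoldKan.Γ.obj P) 0)).symm ≪≫
    (HomologicalComplex.eval _ _ 0).mapIso (mooreΓ.app P)

theorem zeroIso_mooreIncl (a : (moore (Abelian.DoldKan.Γ.obj P)).X 0) :
    (zeroIso P).hom (mooreIncl _ 0 a) = (mooreΓ.hom.app P).f 0 a := by
  have h : mooreIncl (Abelian.DoldKan.Γ.obj P) 0 ≫ (zeroIso P).hom = (mooreΓ.hom.app P).f 0 :=
    (asIso (mooreIncl (Abelian.DoldKan.Γ.obj P) 0)).hom_inv_id_assoc _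
  exact addCommGrp_congr h a

theorem zeroIso_naturality {Q : ChainComplex AddCommGrpCat.{u} ℕ} (f : P ⟶ Q)
    (a : (Abelian.DoldKan.Γ.obj P) _⦋0⦌) :
    (zeroIso Q).hom ((Abelian.DoldKan.Γ.map f).app (op ⦋0⦌) a) = f.f 0 ((zeroIso P).hom a) := by
  obtain ⟨b, rfl⟩ := mooreIncl_zero_surjective _ a
  have h1 := addCommGrp_congr (mooreIncl_naturality _ (Abelian.DoldKan.Γ.map f) 0) b
  have h2 := addCommGrp_congr (congrArg (fun g => HomologicalComplex.Hom.f g 0)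
    (mooreΓ.hom.naturality f)) b
  have h3 : (zeroIso Q).hom ((Abelian.DoldKan.Γ.map f).app (op ⦋0⦌) (mooreIncl _ 0 b)) =
      (zeroIso Q).hom (mooreIncl _ 0
        (((normalizedMooreComplex _).map (Abelian.DoldKan.Γ.map f)).f 0 b)) :=
    congrArg _ h1.symm
  rw [h3, zeroIso_mooreIncl, zeroIso_mooreIncl]
  exact h2

theorem mooreΓ_f_bijective (n : ℕ) : Function.Bijective ((mooreΓ.hom.app P).f n) :=
  ConcreteCategory.bijective_of_isIso ((mooreΓ.hom.app P).f n)

/-- The counit of the Dold–Kan equivalence identifies the Moore complex of K P with P, so the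
boundaries in degree zero are the image of the differential of P. -/
theorem zeroIso_mem_iff (a : (Abelian.DoldKan.Γ.obj P) _⦋0⦌) :
    a ∈ (simplicialTrunc (Abelian.DoldKan.Γ.obj P)).bdry ↔
      ∃ y, P.d 1 0 y = (zeroIso P).hom a := by
  obtain ⟨b, rfl⟩ := mooreIncl_zero_surjective _ a
  have hd (y) : P.d 1 0 ((mooreΓ.hom.app P).f 1 y) =
      (mooreΓ.hom.app P).f 0 ((moore (Abelian.DoldKan.Γ.obj P)).d 1 0 y) :=
    addCommGrp_congr ((mooreΓ.hom.app P).comm 1 0) y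
  rw [mem_bdry_iff, zeroIso_mooreIncl]
  constructor
  · rintro ⟨y, rfl⟩
    exact ⟨_, hd y⟩
  · rintro ⟨y, hy⟩
    obtain ⟨z, rfl⟩ := (mooreΓ_f_bijective P 1).2 y
    exact ⟨z, (mooreΓ_f_bijective P 0).1 ((hd z).symm.trans hy)⟩

theorem moore_d_injective (h : Function.Injective (P.d 1 0)) :
    Function.Injective ((moore (Abelian.DoldKan.Γ.obj P)).d 1 0) := by
  have hd : (mooreΓ.hom.app P).f 1 ≫ P.d 1 0 =
      (moore (Abelian.DoldKan.Γ.obj P)).d 1 0 ≫ (mooreΓ.hom.app P).f 0 :=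
    (mooreΓ.hom.app P).comm 1 0
  have hi : Function.Injective ((mooreΓ.hom.app P).f 1 ≫ P.d 1 0) :=
    fun x y hxy => (mooreΓ_f_bijective P 1).1 (h hxy)
  rw [hd] at hi
  exact fun x y hxy => hi (congrArg ((mooreΓ.hom.app P).f 0) hxy)

end DoldKan

/-! ### `L₁SP²` as a Koszul homology group -/

section LOneSP2

open Opposite Simplicial

variable (A : AddCommGrpCat.{u})

/-- The simplicial abelian group of the canonical free resolution of `A`. -/
abbrev simplicialRes : SimplicialObject AddCommGrpCat.{u} :=
  Abelian.DoldKan.Γ.obj (freeRes.obj A)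

/-- The zeroth group of the simplicial resolution of `A` is the free abelian group on `A`. -/
def resZeroEquiv : (simplicialRes A) _⦋0⦌ ≃+ FreeAbelianGroup A :=
  (zeroIso (freeRes.obj A)).addCommGroupIsoToAddEquiv

theorem resZeroEquiv_naturality {A B : AddCommGrpCat.{u}} (f : A ⟶ B)
    (a : (simplicialRes A) _⦋0⦌) :
    resZeroEquiv B (mapZero (Abelian.DoldKan.Γ.map (freeRes.map f)) a) =
      FreeAbelianGroup.map f.hom (resZeroEquiv A a) :=
  zeroIso_naturality _ (freeRes.map f) a

theorem mem_bdry_simplicialRes (a : (simplicialRes A) _⦋0⦌) :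
    a ∈ (simplicialTrunc (simplicialRes A)).bdry ↔ resZeroEquiv A a ∈ (freeProj A).ker := by
  have h := zeroIso_mem_iff (freeRes.obj A) a
  have hd : (freeRes.obj A).d 1 0 = freeResD A 0 := freeResComplex_d A 0
  rw [hd] at h
  refine h.trans ⟨?_, fun ha => ⟨⟨_, ha⟩, rfl⟩⟩
  rintro ⟨y, hy⟩
  have hy' : (freeProj A).ker.subtype y = resZeroEquiv A a := hy
  rw [← hy']
  exact y.2

instance : Module.Free ℤ ((simplicialRes A) _⦋0⦌) :=
  Module.Free.of_equiv (resZeroEquiv A).symm.toIntLinearEquiv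

/-- The differential of the canonical resolution in degree one is an inclusion, which gives the
injectivity needed in `homologyToKoszul_bijective`. -/
theorem simplicialRes_eq_zero (x : (simplicialRes A) _⦋1⦌)
    (h1 : (simplicialRes A).δ (1 : Fin 2) x = 0) (h0 : (simplicialRes A).δ (0 : Fin 2) x = 0) :
    x = 0 := by
  refine eq_zero_of_moore_injective _ (moore_d_injective _ ?_) x h1 h0
  have hd : (freeRes.obj A).d 1 0 = freeResD A 0 := freeResComplex_d A 0
  rw [hd]
  exact Subtype.val_injective

theorem resZeroEquiv_mem (b) (hb : b ∈ (simplicialTrunc (simplicialRes A)).bdry) :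
    (resZeroEquiv A).toAddMonoidHom.toIntLinearMap b ∈ (freeProj A).ker :=
  (mem_bdry_simplicialRes A b).1 hb

theorem koszulMap_resZeroEquiv_bijective :
    Function.Bijective (koszulMap _ (resZeroEquiv_mem A)) := by
  have hs (b) (hb : b ∈ (freeProj A).ker) :
      (resZeroEquiv A).symm.toAddMonoidHom.toIntLinearMap b ∈
        (simplicialTrunc (simplicialRes A)).bdry :=
    (mem_bdry_simplicialRes A _).2 (((resZeroEquiv A).apply_symm_apply b).symm ▸ hb)
  refine Function.bijective_iff_has_inverse.2 ⟨koszulMap _ hs, fun x => ?_, fun x => ?_⟩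
  · rw [koszulMap_comp]
    exact koszulMap_of_eqOn _ (fun b _ => (resZeroEquiv A).symm_apply_apply b) x
  · rw [koszulMap_comp]
    exact koszulMap_of_eqOn _ (fun b _ => (resZeroEquiv A).apply_symm_apply b) x

/-- The comparison of `L₁SP²(A)` with the Koszul homology of the canonical presentation of `A`. -/
def l1ToKoszul : L1SP2.obj A →+ KoszulH (freeProj A).ker :=
  (koszulMap _ (resZeroEquiv_mem A)).comp (homologyToKoszul (simplicialRes A))

theorem l1ToKoszul_bijective : Function.Bijective (l1ToKoszul A) :=
  (koszulMap_resZeroEquiv_bijective A).comp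
    (homologyToKoszul_bijective _ (simplicialRes_eq_zero A))

variable {A}

theorem freeAbelianGroup_map_mem_ker {A B : Type u} [AddCommGroup A] [AddCommGroup B] (f : A →+ B)
    (b) (hb : b ∈ (freeProj A).ker) :
    (FreeAbelianGroup.map f).toIntLinearMap b ∈ (freeProj B).ker := by
  refine (freeProj_map f b).trans ?_
  rw [AddMonoidHom.mem_ker.1 hb, map_zero]

theorem l1ToKoszul_naturality {B : AddCommGrpCat.{u}} (f : A ⟶ B) (x : L1SP2.obj A) :
    l1ToKoszul B (L1SP2.map f x) =
      koszulMap _ (freeAbelianGroup_map_mem_ker f.hom) (l1ToKoszul A x) := by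
  have h : homologyToKoszul (simplicialRes B) (L1SP2.map f x) =
      koszulMap _ (mapZero_mem_bdry (Abelian.DoldKan.Γ.map (freeRes.map f)))
        (homologyToKoszul (simplicialRes A) x) :=
    homologyToKoszul_naturality (Abelian.DoldKan.Γ.map (freeRes.map f)) x
  change koszulMap _ (resZeroEquiv_mem B) (homologyToKoszul (simplicialRes B) (L1SP2.map f x)) =
    koszulMap _ _ (koszulMap _ (resZeroEquiv_mem A) (homologyToKoszul (simplicialRes A) x))
  rw [h, koszulMap_comp, koszulMap_comp]
  congr 2
  exact LinearMap.ext (resZeroEquiv_naturality f)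

end LOneSP2

/-! ### The natural isomorphism -/

section Main

local notation "⟪" g "⟫" => MonoidAlgebra.of ℤ _ g

/-- The map induced by a morphism of pairs on `(R ∩ γ₂(F)) / (γ₂(R) (R ∩ γ₃(F)))`. -/
def foxKMap {P Q : FreePair.{u}} (f : P ⟶ Q) : Additive (FoxK P.R) →+ Additive (FoxK Q.R) :=
  (foxKFunctor.map f).hom

theorem foxKIncl_naturality {P Q : FreePair.{u}} (f : P ⟶ Q) (k : Additive (FoxK P.R))
    {m : AbM P.R} (h : foxKIncl P.R k = (m : AbM P.R ⧸ foxBAb P.R)) :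
    foxKIncl Q.R (foxKMap f k) = (abMap f.1 f.2 m : AbM Q.R ⧸ foxBAb Q.R) := by
  obtain ⟨k, rfl⟩ := Additive.ofMul.surjective k
  induction k using QuotientGroup.induction_on with | H u => ?_
  rw [foxKIncl_mk, QuotientAddGroup.eq] at h
  have h1 : foxKIncl Q.R (foxKMap f (Additive.ofMul (u : FoxK P.R))) =
    (abMap f.1 f.2 (cls P.R ⟨u, u.2.1⟩) : AbM Q.R ⧸ foxBAb Q.R) := rfl
  rw [h1, QuotientAddGroup.eq, ← map_neg, ← map_add]
  exact abMap_mem_foxBAb f.1 f.2 _ h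

/-- `foxTheta` depends on chosen lifts, so it commutes with `f` only modulo B; this is the
hypothesis of `koszulMap_eq`, so the maps on Koszul homology commute exactly. -/
theorem foxTheta_naturality {P Q : FreePair.{u}} (f : P ⟶ Q)
    (a : FreeAbelianGroup (Additive (FoxK P.R))) :
    foxTheta Q.R (FreeAbelianGroup.map (foxKMap f) a) -
      abMap f.1 f.2 (foxTheta P.R a) ∈ foxBAb Q.R := by
  rw [← QuotientAddGroup.eq_zero_iff, QuotientAddGroup.mk_sub, sub_eq_zero, mk_foxTheta,
    freeProj_map]
  exact foxKIncl_naturality f _ (mk_foxTheta a).symm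

theorem foxQuotHom_naturality {P Q : FreePair.{u}} (f : P ⟶ Q) (w : FoxQuot P.R) :
    (foxQuotHom Q.R (foxQuotFunctor.map f w)).toAdd =
      koszulMap _ (abMap_mem_foxBAb f.1 f.2) (foxQuotHom P.R w).toAdd := by
  induction w using QuotientGroup.induction_on with | H w => ?_
  let w' : fox3 Q.R := ⟨f.1 w, fox3_map_le f.1 f.2 ⟨w, w.2, rfl⟩⟩
  have h1 : foxQuotFunctor.map f (w : FoxQuot P.R) = (w' : FoxQuot Q.R) := rfl
  rw [h1, foxQuotHom_mk, foxQuotHom_mk, toAdd_ofAdd, toAdd_ofAdd, koszulMap_mk]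
  refine congrArg (QuotientAddGroup.mk (s := (altSq (foxBAb Q.R)).addSubgroupOf _))
    (Subtype.ext ?_)
  exact (foxDer2_map f.1 f.2 ⟨w, mem_of_mem_foxSucc (n := 2) w.2⟩
    (cls_eq_zero_of_mem_fox3 _ w.2)).symm

/-- The comparison of `L₁SP²` with the Koszul homology of the image of `R ∩ γ₃(F)` in `R_ab`. -/
def l1ToFox (P : FreePair.{u}) : L1SP2.obj (foxKFunctor.obj P) →+ KoszulH (foxBAb P.R) :=
  (koszulMap (foxTheta P.R) foxTheta_mem).comp (l1ToKoszul (foxKFunctor.obj P))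

theorem l1ToFox_bijective (P : FreePair.{u}) : Function.Bijective (l1ToFox P) :=
  koszulMap_foxTheta_bijective.comp (l1ToKoszul_bijective _)

theorem l1ToFox_naturality {P Q : FreePair.{u}} (f : P ⟶ Q) (x : L1SP2.obj (foxKFunctor.obj P)) :
    l1ToFox Q (L1SP2.map (foxKFunctor.map f) x) =
      koszulMap _ (abMap_mem_foxBAb f.1 f.2) (l1ToFox P x) := by
  change koszulMap (foxTheta Q.R) foxTheta_mem
    (l1ToKoszul (foxKFunctor.obj Q) (L1SP2.map (foxKFunctor.map f) x)) =
      koszulMap _ _ (koszulMap (foxTheta P.R) foxTheta_mem (l1ToKoszul (foxKFunctor.obj P) x))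
  rw [l1ToKoszul_naturality]
  refine (koszulMap_comp _ _ _ _ _).trans (Eq.trans ?_ (koszulMap_comp _ _ _ _ _).symm)
  exact DFunLike.congr_fun (koszulMap_eq _ _ _ _ (foxTheta_naturality f)) _

/-- `F(3, R) / G(3, R)` is isomorphic to `L₁SP²((R ∩ γ₂(F)) / (γ₂(R) (R ∩ γ₃(F))))`. -/
def foxQuotEquiv (P : FreePair.{u}) :
    FoxQuot P.R ≃* Multiplicative (L1SP2.obj (foxKFunctor.obj P)) :=
  (MulEquiv.ofBijective (foxQuotHom P.R) foxQuotHom_bijective).trans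
    (AddEquiv.toMultiplicative (AddEquiv.ofBijective (l1ToFox P) (l1ToFox_bijective P))).symm

theorem l1ToFox_foxQuotEquiv (P : FreePair.{u}) (w : FoxQuot P.R) :
    l1ToFox P (foxQuotEquiv P w).toAdd = (foxQuotHom P.R w).toAdd :=
  (AddEquiv.ofBijective (l1ToFox P) (l1ToFox_bijective P)).apply_symm_apply _

theorem foxQuotEquiv_naturality {P Q : FreePair.{u}} (f : P ⟶ Q) (w : FoxQuot P.R) :
    foxQuotEquiv Q (foxQuotFunctor.map f w) =
      Multiplicative.ofAdd (L1SP2.map (foxKFunctor.map f) (foxQuotEquiv P w).toAdd) := by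
  refine Multiplicative.toAdd.injective ((l1ToFox_bijective Q).1 ?_)
  refine (l1ToFox_foxQuotEquiv Q _).trans ((foxQuotHom_naturality f w).trans ?_)
  rw [← l1ToFox_foxQuotEquiv]
  exact (l1ToFox_naturality f _).symm

/-- The natural isomorphism between `F(3, R) / G(3, R)` and
`L₁SP²((R ∩ γ₂(F)) / (γ₂(R) (R ∩ γ₃(F))))`. -/
def foxQuotIso : foxQuotFunctor.{u} ≅ foxKFunctor.{u} ⋙ L1SP2.{u} ⋙ abToGrp.{u} :=
  NatIso.ofComponents (fun P => MulEquiv.toGrpIso (X := foxQuotFunctor.obj P)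
      (Y := abToGrp.obj (L1SP2.obj (foxKFunctor.obj P))) (foxQuotEquiv P))
    fun f => GrpCat.hom_ext (MonoidHom.ext (foxQuotEquiv_naturality f))

end Main

open scoped Pointwise in
theorem theorem2 :
    (∀ (F : Type u) [Group F] [IsFreeGroup F] (R : Subgroup F) [R.Normal], foxG3 R ≤ fox3 R) ∧
    Nonempty (foxQuotFunctor.{u} ≅ foxKFunctor.{u} ⋙ L1SP2.{u} ⋙ abToGrp.{u}) ∧
    (∀ (F : Type u) [Group F] [IsFreeGroup F] (R : Subgroup F) [R.Normal],
      (fox3 R : Set F) = (foxG3 R : Set F) * (foxW R : Set F)) :=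
  ⟨fun _ _ _ _ _ => foxG3_le_fox3 _, ⟨foxQuotIso⟩, fun _ _ _ R _ => fox3_eq_foxG3_mul_foxW R⟩

end
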